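/- Let $N\ge 3$ be an integer, $s\in(0,1)$ and $\alpha\in(0,N)$. Let $F\in C^1(\mathbb R;\mathbb R)$ and suppose that $f:=F'$ satisfies: (f1) there is a constant $C>0$ such that $|t f(t)|\le C\left(|t|^{\frac{N+\alpha}{N}}+|t|^{\frac{N+\alpha}{N-2}}\right)$ for all $t\in\mathbb R$; (f2) $\displaystyle\lim_{t\to0}\frac{F(t)}{|t|^{\frac{N+\alpha}{N}}}=0=\lim_{|t|\to\infty}\frac{F(t)}{|t|^{\frac{N+\alpha}{N-2}}}$; (f3) there is $t_0\in\mathbb R\setminus\{0\}$ with $F(t_0)\neq0$. Let $I_\alpha(x)=\dfrac{\Gamma(\frac{N-\alpha}{2})}{\pi^{N/2}2^{\alpha}\Gamma(\frac{\alpha}{2})}\,|x|^{-(N-\alpha)}$ be the Riesz potential, $(I_\alpha*g)(x)=\int_{\mathbb R^N}I_\alpha(x-y)g(y)\,dy$, and let $C(N,s)=\left(\int_{\mathbb R^N}\frac{1-\cos x_1}{|x|^{N+2s}}\,dx\right)^{-1}$ be the normalizing constant of the fractional Laplacian $(-\Delta)^s$. Then the equation $$-\Delta u+(-\Delta)^s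 u+u=(I_\alpha*F(u))\,F'(u)\quad\text{in }\mathbb R^N$$ has a nontrivial weak solution in $H^1(\mathbb R^N)$: there is $u\in H^1(\mathbb R^N)$, not almost everywhere zero, such that for every $v\in H^1(\mathbb R^N)$ all integrals below converge absolutely, with $(I_\alpha*F(u))(x)$ an absolutely convergent integral for almost every $x$, and $$\int_{\mathbb R^N}\nabla u\cdot\nabla v\,dx+\frac{C(N,s)}{2}\int_{\mathbb R^N}\int_{\mathbb R^N}\frac{(u(x)-u(y))(v(x)-v(y))}{|x-y|^{N+2s}}\,dx\,dy+\int_{\mathbb R^N}uv\,dx=\int_{\mathbb R^N}(I_\alpha*F(u))\,f(u)\,v\,dx .$$ -/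

import Mathlib

open MeasureTheory Filter Topology
open scoped ContDiff

noncomputable section

namespace Choquard

/-- The Euclidean space `ℝ^N` with the Euclidean norm and Lebesgue measure `volume`. -/
abbrev Space (N : ℕ) : Type := EuclideanSpace ℝ (Fin N)

/-- `Du` is the weak (distributional) gradient of `u` on `ℝ^N`:
`∫ u ∂ᵢφ = - ∫ (Du)ᵢ φ` for all test functions `φ ∈ C_c^∞(ℝ^N)` and all `i`.
It is only used together with `u ∈ L²` and `Du ∈ L²`, so all these integrals converge. -/
def HasWeakGradient {N : ℕ} (u : Space N → ℝ) (Du : Space N → Space N) : Prop :=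
  ∀ φ : Space N → ℝ, ContDiff ℝ ∞ φ → HasCompactSupport φ → ∀ i : Fin N,
    ∫ x, u x * fderiv ℝ φ x (EuclideanSpace.single i 1) = - ∫ x, Du x i * φ x

/-- `u ∈ H¹(ℝ^N)`, with weak gradient (a representative of) `Du`:
both `u` and `Du` are square integrable. -/
structure IsH1With {N : ℕ} (u : Space N → ℝ) (Du : Space N → Space N) : Prop where
  memLp : MemLp u 2 volume
  memLp_grad : MemLp Du 2 volume
  hasWeakGradient : HasWeakGradient u Du

/-- The Sobolev space `H¹(ℝ^N)`, as a predicate on functions. -/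
def MemH1 {N : ℕ} (u : Space N → ℝ) : Prop :=
  ∃ Du : Space N → Space N, IsH1With u Du

/-- The normalizing constant
`C(N,s) = (∫_{ℝ^N} (1 - cos x₁) / |x|^{N+2s} dx)⁻¹` of the fractional Laplacian. -/
def fracConst (N : ℕ) [NeZero N] (s : ℝ) : ℝ :=
  (∫ x : Space N, (1 - Real.cos (x 0)) / ‖x‖ ^ ((N : ℝ) + 2 * s))⁻¹

/-- The integrand `(u(x)-u(y)) (v(x)-v(y)) / |x-y|^{N+2s}` on `ℝ^N × ℝ^N`. -/
def gagliardoIntegrand {N : ℕ} (s : ℝ) (u v : Space N → ℝ) (p : Space N × Space N) : ℝ :=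
  (u p.1 - u p.2) * (v p.1 - v p.2) / ‖p.1 - p.2‖ ^ ((N : ℝ) + 2 * s)

/-- The bilinear form
`≪u,v≫ = C(N,s)/2 ∬ (u(x)-u(y)) (v(x)-v(y)) / |x-y|^{N+2s} dx dy` of `(-Δ)^s`. -/
def fracForm {N : ℕ} [NeZero N] (s : ℝ) (u v : Space N → ℝ) : ℝ :=
  fracConst N s / 2 * ∫ p : Space N × Space N, gagliardoIntegrand s u v p

/-- The Riesz potential `I_α(x) = A_{N,α} / |x|^{N-α}`, with
`A_{N,α} = Γ((N-α)/2) / (π^{N/2} 2^α Γ(α/2))`. -/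
def rieszKernel {N : ℕ} (α : ℝ) (x : Space N) : ℝ :=
  Real.Gamma (((N : ℝ) - α) / 2) /
      (Real.pi ^ ((N : ℝ) / 2) * (2 : ℝ) ^ α * Real.Gamma (α / 2)) /
    ‖x‖ ^ ((N : ℝ) - α)

/-- The convolution `(I_α ∗ g)(x) = ∫ I_α(x-y) g(y) dy`. -/
def rieszConv {N : ℕ} (α : ℝ) (g : Space N → ℝ) (x : Space N) : ℝ :=
  ∫ y, rieszKernel α (x - y) * g y

/-- `u ∈ H¹(ℝ^N)` is a weak solution of `-Δu + (-Δ)^s u + u = (I_α ∗ F(u)) F'(u)` on `ℝ^N`: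
`∫ ∇u·∇v + ≪u,v≫ + ∫ u v = ∫ (I_α ∗ F(u)) F'(u) v` for every `v ∈ H¹(ℝ^N)`.
The convergence of the integrals that does not follow from `u, v ∈ H¹` by
Cauchy-Schwarz in `L²` is demanded explicitly. -/
def IsWeakSolution {N : ℕ} [NeZero N] (s α : ℝ) (F : ℝ → ℝ) (u : Space N → ℝ) : Prop :=
  ∃ Du : Space N → Space N, IsH1With u Du ∧
    (∀ᵐ x : Space N, Integrable (fun y : Space N => rieszKernel α (x - y) * F (u y))) ∧
    ∀ (v : Space N → ℝ) (Dv : Space N → Space N), IsH1With v Dv →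
      Integrable (gagliardoIntegrand s u v) ∧
      Integrable (fun x => rieszConv α (fun y => F (u y)) x * deriv F (u x) * v x) ∧
      (∫ x, inner ℝ (Du x) (Dv x)) + fracForm s u v + (∫ x, u x * v x) =
        ∫ x, rieszConv α (fun y => F (u y)) x * deriv F (u x) * v x

/-- Growth condition on `f = F'`: there is `C > 0` with
`|t f(t)| ≤ C (|t|^{(N+α)/N} + |t|^{(N+α)/(N-2)})` for all `t`. -/
def CondF1 (N : ℕ) (α : ℝ) (F : ℝ → ℝ) : Prop :=
  ∃ C : ℝ, 0 < C ∧ ∀ t : ℝ,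
    |t * deriv F t| ≤
      C * (|t| ^ (((N : ℝ) + α) / (N : ℝ)) + |t| ^ (((N : ℝ) + α) / ((N : ℝ) - 2)))

/-- Subcriticality: `F(t)/|t|^{(N+α)/N} → 0` as `t → 0` and
`F(t)/|t|^{(N+α)/(N-2)} → 0` as `|t| → ∞`. -/
def CondF2 (N : ℕ) (α : ℝ) (F : ℝ → ℝ) : Prop :=
  Tendsto (fun t : ℝ => F t / |t| ^ (((N : ℝ) + α) / (N : ℝ))) (𝓝[≠] 0) (𝓝 0) ∧
  Tendsto (fun t : ℝ => F t / |t| ^ (((N : ℝ) + α) / ((N : ℝ) - 2))) (cocompact ℝ) (𝓝 0)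

/-- Nontriviality: `F(t₀) ≠ 0` for some `t₀ ≠ 0`. -/
def CondF3 (F : ℝ → ℝ) : Prop :=
  ∃ t₀ : ℝ, t₀ ≠ 0 ∧ F t₀ ≠ 0

end Choquard

end

/-! Write A(u) = ∫|∇u|², B(u) for the fractional form at (u, u), C(u) = ∫u² and D(u) = ∬ I_α(x−y)
F(u(x)) F(u(y)) dx dy. Weak solutions are the critical points of A + B + C − D. Under the dilation u
↦ u(·/R) the four terms are multiplied by R^(N−2), R^(N−2s), R^N and R^(N+α). In the variable τ =
R^(N+α) the functional along the dilations of u is therefore a sum of powers of τ with exponents in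
(0,1) and nonnegative coefficients, minus τ D(u). This function, `fiber`, is concave, and if D(u) >
0 it has a maximum at some τ > 0. The solution minimises this maximum over radial u with D(u) > 0.

The minimum is attained (`exists_minimizer`). Dilating u only reparametrises its fiber, so a
minimising sequence can be normalised to D = 1; the value at τ = 1 then bounds it in H¹. A bounded
sequence of radial functions converges in measure to its weak limit along a subsequence
(`tendsto_measure_of_radial`). By the strict subcriticality (f2) this makes F(u_n) converge strongly
in L^{2N/(N+α)} (`tendsto_eLpNorm_comp`), and there D is continuous by the Hardy–Littlewood–Sobolev
inequality (`hls`). So D = 1 survives in the limit, while A, B, C can only drop. No Palais–Smale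
sequence appears, and no monotonicity or superlinearity of F' is needed.

Let u be a minimiser, dilated so that its fiber is maximal at τ = 1. For u + εv with v radial, the
maximum of the fiber cannot fall below its value at ε = 0. An envelope argument for concave
functions (`nonneg_of_minimal_sup`, `deriv_profile_eq_zero`) then shows that the value at τ = 1 is
stationary at ε = 0, which is the weak equation tested with radial v (`radial_euler_lagrange`).

Arbitrary test functions are reached by symmetric criticality (`euler_lagrange`): the residual of
the equation is a bounded rotation-invariant functional on H¹, its Riesz representer is radial, and
testing with the representer itself shows that it vanishes. -/

namespace Choquard

open scoped ENNReal NNReal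
open Set Metric

/-! ### The Riesz kernel and the Hardy–Littlewood–Sobolev inequality. -/

/-- Polar integration of a nonnegative radial function. -/
theorem lintegral_radial {N : ℕ} (hN : 1 ≤ N) (f : ℝ → ℝ) (hf : ∀ r, 0 ≤ f r)
    (hi : IntegrableOn (fun y : ℝ => y ^ (N - 1) * f y) (Ioi 0)) :
    ∫⁻ x : Space N, ENNReal.ofReal (f ‖x‖) =
      ENNReal.ofReal (N * volume.real (ball (0 : Space N) 1) *
        ∫ y in Ioi (0 : ℝ), y ^ (N - 1) * f y) := by
  have : Nonempty (Fin N) := ⟨⟨0, hN⟩⟩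
  have hint : Integrable (fun x : Space N => f ‖x‖) := by
    refine (integrable_fun_norm_addHaar (μ := (volume : Measure (Space N))) (f := f)).2 ?_
    simpa using hi
  rw [← ofReal_integral_eq_lintegral_ofReal hint (ae_of_all _ fun x => hf _),
    integral_fun_norm_addHaar]
  simp [mul_assoc]

theorem lintegral_norm_rpow_preimage {N : ℕ} (hN : 1 ≤ N) (c : ℝ) {S : Set ℝ}
    (hS : MeasurableSet S) (hi : IntegrableOn (fun y : ℝ => y ^ ((N : ℝ) - 1 + c)) (Ioi 0 ∩ S)) :
    ∫⁻ x in {x : Space N | ‖x‖ ∈ S}, ENNReal.ofReal (‖x‖ ^ c) =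
      ENNReal.ofReal (N * volume.real (ball (0 : Space N) 1) *
        ∫ y in Ioi (0 : ℝ) ∩ S, y ^ ((N : ℝ) - 1 + c)) := by
  have key : ∀ y ∈ Ioi (0 : ℝ), y ^ (N - 1) * S.indicator (fun r => |r| ^ c) y =
      S.indicator (fun r => r ^ ((N : ℝ) - 1 + c)) y := by
    intro y hy
    have hy : 0 < y := hy
    by_cases h : y ∈ S
    · simp only [indicator_of_mem h, abs_of_pos hy]
      rw [← Real.rpow_natCast, ← Real.rpow_add hy]
      push_cast [hN]; rfl
    · simp [indicator_of_notMem h]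
  have h := lintegral_radial hN (S.indicator (fun r => |r| ^ c))
    (fun r => indicator_nonneg (fun _ _ => by positivity) _) (by
      refine (integrableOn_congr_fun key measurableSet_Ioi).2 ?_
      rwa [integrableOn_indicator_iff hS, inter_comm])
  rw [setIntegral_congr_fun measurableSet_Ioi key, setIntegral_indicator hS] at h
  have hm : MeasurableSet {x : Space N | ‖x‖ ∈ S} := measurable_norm hS
  rw [← h, ← lintegral_indicator hm]
  refine lintegral_congr fun x => ?_
  by_cases hx : ‖x‖ ∈ S <;> simp [indicator, hx]

theorem lintegral_ball_norm_rpow {N : ℕ} (hN : 1 ≤ N) {a : ℝ} (ha : 0 < a) :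
    ∃ C : ℝ, 0 ≤ C ∧ ∀ R : ℝ, 0 < R →
      ∫⁻ x in {x : Space N | ‖x‖ < R}, ENNReal.ofReal (‖x‖ ^ (a - N)) =
        ENNReal.ofReal (C * R ^ a) := by
  refine ⟨N * volume.real (ball (0 : Space N) 1) * (1 / a), by positivity, fun R hR => ?_⟩
  have hset : Ioi (0 : ℝ) ∩ Iio R = Ioo 0 R := rfl
  have he : (N : ℝ) - 1 + (a - N) = a - 1 := by ring
  refine (lintegral_norm_rpow_preimage hN (a - N) (measurableSet_Iio (a := R)) ?_).trans ?_
  · rw [he, hset]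
    exact (intervalIntegral.integrableOn_Ioo_rpow_iff hR).2 (by linarith)
  · rw [he, hset, ← integral_Ioc_eq_integral_Ioo, ← intervalIntegral.integral_of_le hR.le,
      integral_rpow (Or.inl (by linarith)), sub_add_cancel, Real.zero_rpow ha.ne']
    congr 1
    ring

theorem lintegral_compl_ball_norm_rpow {N : ℕ} (hN : 1 ≤ N) {a : ℝ} (ha : 0 < a) :
    ∃ C : ℝ, 0 ≤ C ∧ ∀ R : ℝ, 0 < R →
      ∫⁻ x in {x : Space N | R ≤ ‖x‖}, ENNReal.ofReal (‖x‖ ^ (-N - a)) =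
        ENNReal.ofReal (C * R ^ (-a)) := by
  refine ⟨N * volume.real (ball (0 : Space N) 1) * (1 / a), by positivity, fun R hR => ?_⟩
  have hset : Ioi (0 : ℝ) ∩ Ici R = Ici R := by rw [inter_eq_right]; exact Ici_subset_Ioi.2 hR
  have he : (N : ℝ) - 1 + (-N - a) = -a - 1 := by ring
  refine (lintegral_norm_rpow_preimage hN (-N - a) (measurableSet_Ici (a := R)) ?_).trans ?_
  · rw [he, hset, integrableOn_Ici_iff_integrableOn_Ioi]
    exact integrableOn_Ioi_rpow_of_lt (by linarith) hR
  · rw [he, hset, integral_Ici_eq_integral_Ioi, integral_Ioi_rpow_of_lt (by linarith) hR, sub_add_cancel]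
    congr 1
    field_simp

/-- The Riesz potential of `g ≤ t` at a point, for `g` in the unit ball of `L^{2N/(N+α)}`. -/
theorem lintegral_riesz_truncated_le {N : ℕ} (hN : 1 ≤ N) {α : ℝ} (hα : 0 < α) (hαN : α < N) :
    ∃ C : ℝ, 0 ≤ C ∧ ∀ g : Space N → ℝ≥0, Measurable g →
      ∫⁻ y, (g y : ℝ≥0∞) ^ (2 * N / (N + α) : ℝ) ≤ 1 → ∀ (x : Space N) (t : ℝ), 0 < t →
      ∫⁻ y in {y | (g y : ℝ) ≤ t}, ENNReal.ofReal (‖x - y‖ ^ (α - N)) * g y ≤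
        ENNReal.ofReal (C * t ^ ((N - α) / (N + α) : ℝ)) := by
  obtain ⟨C₁, hC₁, h₁⟩ := lintegral_ball_norm_rpow hN hα
  have hNpos : (0 : ℝ) < N := by exact_mod_cast hN
  obtain ⟨C₂, hC₂, h₂⟩ := lintegral_compl_ball_norm_rpow hN hNpos
  refine ⟨C₁ + C₂ ^ ((N - α) / (2 * N) : ℝ), by positivity, fun g hg hg1 x t ht => ?_⟩
  set S : Set (Space N) := {y | (g y : ℝ) ≤ t}
  -- This radius balances the two contributions: t R^α from the near part and R^(−(N−α)/2) from the
  -- far part both equal t^((N−α)/(N+α)).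
  set R : ℝ := t ^ (-2 / (N + α) : ℝ)
  have hR : 0 < R := by positivity
  set k : Space N → ℝ≥0∞ := fun y => ENNReal.ofReal (‖x - y‖ ^ (α - N)) with hk
  have hkm : Measurable k := by fun_prop
  have hSm : MeasurableSet S := measurableSet_le (by fun_prop) measurable_const
  set B : Set (Space N) := {y | ‖x - y‖ < R}
  have hBm : MeasurableSet B := measurableSet_lt (by fun_prop) measurable_const
  have near : ∫⁻ y in S ∩ B, k y * g y ≤ ENNReal.ofReal (C₁ * t ^ ((N - α) / (N + α) : ℝ)) := by
    calc ∫⁻ y in S ∩ B, k y * g y ≤ ∫⁻ y in S ∩ B, k y * ENNReal.ofReal t := by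
          refine setLIntegral_mono (by fun_prop) fun y hy => ?_
          gcongr
          rw [← ENNReal.ofReal_coe_nnreal]
          exact ENNReal.ofReal_le_ofReal hy.1
      _ ≤ ∫⁻ y in B, k y * ENNReal.ofReal t := lintegral_mono_set inter_subset_right
      _ = (∫⁻ y in B, k y) * ENNReal.ofReal t := lintegral_mul_const _ hkm
      _ = (∫⁻ z in {z : Space N | ‖z‖ < R}, ENNReal.ofReal (‖z‖ ^ (α - N))) *
            ENNReal.ofReal t := by
          congr 1
          exact (Measure.measurePreserving_sub_left volume x).setLIntegral_comp_preimage
            (s := {z : Space N | ‖z‖ < R}) (measurableSet_lt (by fun_prop) measurable_const)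
            (f := fun z => ENNReal.ofReal (‖z‖ ^ (α - N))) (by fun_prop)
      _ = ENNReal.ofReal (C₁ * t ^ ((N - α) / (N + α) : ℝ)) := by
          rw [h₁ R hR, ← ENNReal.ofReal_mul (by positivity), mul_assoc]
          congr 2
          rw [← Real.rpow_mul ht.le]
          nth_rw 2 [← Real.rpow_one t]
          rw [← Real.rpow_add ht]
          congr 1
          field_simp
          ring
  -- Hölder with the conjugate exponent 2N/(N−α), which turns the kernel into |z|^(−2N), integrable
  -- away from the origin. The truncation at t plays no role here.
  have far : ∫⁻ y in S ∩ Bᶜ, k y * g y ≤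
      ENNReal.ofReal (C₂ ^ ((N - α) / (2 * N) : ℝ) * t ^ ((N - α) / (N + α) : ℝ)) := by
    have hpq : (2 * N / (N - α) : ℝ).HolderConjugate (2 * N / (N + α) : ℝ) := by
      have h3 : (0 : ℝ) < N - α := by linarith
      rw [Real.holderConjugate_iff]
      constructor
      · rw [lt_div_iff₀ h3]; linarith
      · field_simp; ring
    calc ∫⁻ y in S ∩ Bᶜ, k y * g y ≤ ∫⁻ y in Bᶜ, k y * g y :=
          lintegral_mono_set inter_subset_right
      _ ≤ (∫⁻ y in Bᶜ, k y ^ (2 * N / (N - α) : ℝ)) ^ (1 / (2 * N / (N - α)) : ℝ) *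
          (∫⁻ y in Bᶜ, (g y : ℝ≥0∞) ^ (2 * N / (N + α) : ℝ)) ^ (1 / (2 * N / (N + α)) : ℝ) :=
        ENNReal.lintegral_mul_le_Lp_mul_Lq _ hpq hkm.aemeasurable (by fun_prop)
      _ ≤ (∫⁻ y in Bᶜ, k y ^ (2 * N / (N - α) : ℝ)) ^ (1 / (2 * N / (N - α)) : ℝ) * 1 := by
        gcongr
        refine ENNReal.rpow_le_one ((setLIntegral_le_lintegral _ _).trans hg1) (by positivity)
      _ = _ := by
        have h4 : ∀ y, k y ^ (2 * N / (N - α) : ℝ) = ENNReal.ofReal (‖x - y‖ ^ (-N - N : ℝ)) := by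
          intro y
          have h3 : (0 : ℝ) < N - α := by linarith
          rw [hk, ENNReal.ofReal_rpow_of_nonneg (by positivity) (by positivity),
            ← Real.rpow_mul (norm_nonneg _)]
          congr 2
          field_simp
          ring
        have h5 : ∫⁻ y in Bᶜ, ENNReal.ofReal (‖x - y‖ ^ (-N - N : ℝ)) =
            ∫⁻ z in {z : Space N | R ≤ ‖z‖}, ENNReal.ofReal (‖z‖ ^ (-N - N : ℝ)) := by
          have : Bᶜ = (fun y => x - y) ⁻¹' {z : Space N | R ≤ ‖z‖} := by
            ext y; simp [B]
          rw [this]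
          exact (Measure.measurePreserving_sub_left volume x).setLIntegral_comp_preimage
            (s := {z : Space N | R ≤ ‖z‖}) (measurableSet_le measurable_const (by fun_prop))
            (f := fun z => ENNReal.ofReal (‖z‖ ^ (-N - N : ℝ))) (by fun_prop)
        have h3 : (0 : ℝ) < N - α := by linarith
        rw [lintegral_congr h4, h5, h₂ R hR, mul_one,
          ENNReal.ofReal_rpow_of_nonneg (by positivity) (by positivity),
          Real.mul_rpow (by positivity) (by positivity), ← Real.rpow_mul hR.le,
          ← Real.rpow_mul ht.le]
        congr 3
        · field_simp
        · field_simp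
  calc ∫⁻ y in S, k y * g y = (∫⁻ y in S ∩ B, k y * g y) + ∫⁻ y in S ∩ Bᶜ, k y * g y := by
        rw [← sdiff_eq, lintegral_inter_add_sdiff _ _ hBm]
    _ ≤ _ := add_le_add near far
    _ = _ := by rw [← ENNReal.ofReal_add (by positivity) (by positivity), add_mul]

/-- Hardy–Littlewood–Sobolev inequality in the diagonal case, normalised. -/
theorem hls_normalized {N : ℕ} (hN : 1 ≤ N) {α : ℝ} (hα : 0 < α) (hαN : α < N) :
    ∃ C : ℝ, 0 ≤ C ∧ ∀ f g : Space N → ℝ≥0, Measurable f → Measurable g →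
      ∫⁻ y, (f y : ℝ≥0∞) ^ (2 * N / (N + α) : ℝ) ≤ 1 →
      ∫⁻ y, (g y : ℝ≥0∞) ^ (2 * N / (N + α) : ℝ) ≤ 1 →
      ∫⁻ x, ∫⁻ y, ENNReal.ofReal (‖x - y‖ ^ (α - N)) * f x * g y ≤ ENNReal.ofReal C := by
  obtain ⟨C, hC, h⟩ := lintegral_riesz_truncated_le hN hα hαN
  have hNpos : (0 : ℝ) < N := by exact_mod_cast hN
  -- Where g(y) ≤ f(x), the truncated estimate at level t = f(x) gives f(x) · f(x)^((N−α)/(N+α)) =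
  -- f(x)^(2N/(N+α)), which is integrable. The complementary region is the same one with f and g
  -- exchanged, as the kernel is symmetric.
  have half : ∀ f g : Space N → ℝ≥0, Measurable f → Measurable g →
      ∫⁻ y, (f y : ℝ≥0∞) ^ (2 * N / (N + α) : ℝ) ≤ 1 →
      ∫⁻ y, (g y : ℝ≥0∞) ^ (2 * N / (N + α) : ℝ) ≤ 1 →
      ∫⁻ x, ∫⁻ y in {y | g y ≤ f x}, ENNReal.ofReal (‖x - y‖ ^ (α - N)) * f x * g y ≤
        ENNReal.ofReal C := by
    intro f g hf hg hf1 hg1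
    calc _ ≤ ∫⁻ x, ENNReal.ofReal C * (f x : ℝ≥0∞) ^ (2 * N / (N + α) : ℝ) := by
          refine lintegral_mono fun x => ?_
          rcases eq_or_ne (f x) 0 with h0 | h0
          · simp [h0]
          have hpos : (0 : ℝ) < f x := by positivity
          calc _ = f x * ∫⁻ y in {y | (g y : ℝ) ≤ f x},
                ENNReal.ofReal (‖x - y‖ ^ (α - N)) * g y := by
                rw [← lintegral_const_mul _ (by fun_prop)]
                refine lintegral_congr fun y => by ring
            _ ≤ f x * ENNReal.ofReal (C * (f x : ℝ) ^ ((N - α) / (N + α) : ℝ)) := by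
                gcongr
                exact h g hg hg1 x _ hpos
            _ = _ := by
                rw [← ENNReal.ofReal_coe_nnreal, ← ENNReal.ofReal_mul (by positivity),
                  ENNReal.ofReal_rpow_of_pos hpos, ← ENNReal.ofReal_mul hC]
                congr 1
                nth_rw 1 [← Real.rpow_one (f x : ℝ)]
                rw [mul_left_comm, ← Real.rpow_add hpos]
                congr 2
                field_simp
                ring
      _ = ENNReal.ofReal C * ∫⁻ x, (f x : ℝ≥0∞) ^ (2 * N / (N + α) : ℝ) :=
          lintegral_const_mul _ (by fun_prop)
      _ ≤ ENNReal.ofReal C * 1 := by gcongr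
      _ = _ := mul_one _
  refine ⟨C + C, by positivity, fun f g hf hg hf1 hg1 => ?_⟩
  have hmeas : Measurable fun p : Space N × Space N =>
      ENNReal.ofReal (‖p.1 - p.2‖ ^ (α - N)) * f p.1 * g p.2 := by fun_prop
  have hset : MeasurableSet {p : Space N × Space N | g p.2 ≤ f p.1} :=
    measurableSet_le (by fun_prop) (by fun_prop)
  have hset' : MeasurableSet {p : Space N × Space N | f p.1 ≤ g p.2} :=
    measurableSet_le (by fun_prop) (by fun_prop)
  have h2 : ∫⁻ x, ∫⁻ y in {y | f x ≤ g y}, ENNReal.ofReal (‖x - y‖ ^ (α - N)) * f x * g y ≤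
      ENNReal.ofReal C := by
    refine le_trans (le_of_eq ?_) (half g f hg hf hg1 hf1)
    have e1 : ∀ x, ∫⁻ y in {y | f x ≤ g y}, ENNReal.ofReal (‖x - y‖ ^ (α - N)) * f x * g y =
        ∫⁻ y, {p : Space N × Space N | f p.1 ≤ g p.2}.indicator (fun p =>
          ENNReal.ofReal (‖p.1 - p.2‖ ^ (α - N)) * f p.1 * g p.2) (x, y) := fun x => by
      rw [← lintegral_indicator (measurableSet_le measurable_const hg)]; rfl
    have e2 : ∀ x, ∫⁻ y in {y | f y ≤ g x}, ENNReal.ofReal (‖x - y‖ ^ (α - N)) * g x * f y =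
        ∫⁻ y, {p : Space N × Space N | f p.1 ≤ g p.2}.indicator (fun p =>
          ENNReal.ofReal (‖p.1 - p.2‖ ^ (α - N)) * f p.1 * g p.2) (y, x) := fun x => by
      rw [← lintegral_indicator (measurableSet_le hf measurable_const)]
      refine lintegral_congr fun y => ?_
      simp only [indicator, mem_ofPred_eq]
      rw [norm_sub_rev, mul_right_comm]
    simp_rw [e1, e2]
    exact lintegral_lintegral_swap (hmeas.indicator hset').aemeasurable
  calc _ ≤ ∫⁻ x, ((∫⁻ y in {y | g y ≤ f x}, ENNReal.ofReal (‖x - y‖ ^ (α - N)) * f x * g y) +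
        ∫⁻ y in {y | f x ≤ g y}, ENNReal.ofReal (‖x - y‖ ^ (α - N)) * f x * g y) := by
        refine lintegral_mono fun x => ?_
        have hu : {y | g y ≤ f x} ∪ {y | f x ≤ g y} = univ := by
          ext y; simpa using le_total _ _
        rw [← setLIntegral_univ, ← hu]
        exact lintegral_union_le _ _ _
    _ = _ := lintegral_add_left (by
          simp_rw [← lintegral_indicator (measurableSet_le hg measurable_const)]
          exact (hmeas.indicator hset).lintegral_prod_right') _
    _ ≤ _ := add_le_add (half f g hf hg hf1 hg1) h2
    _ = _ := (ENNReal.ofReal_add hC hC).symm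

end Choquard

/-! ### The bilinear Riesz form of real functions. -/

noncomputable section

namespace Choquard

open scoped ENNReal NNReal
open Set Metric

/-- The exponent `2N/(N+α)` of the diagonal Hardy–Littlewood–Sobolev inequality. -/
def hlsExp (N : ℕ) (α : ℝ) : ℝ≥0∞ := ENNReal.ofReal (2 * N / (N + α))

/-- The bilinear form `∬ I_α(x-y) f(x) g(y) dx dy`. -/
def rieszForm {N : ℕ} (α : ℝ) (f g : Space N → ℝ) : ℝ :=
  ∫ q : Space N × Space N, rieszKernel α (q.1 - q.2) * (f q.1 * g q.2)

theorem rieszKernel_eq {N : ℕ} (α : ℝ) : ∃ A : ℝ, (0 < α → α < N → 0 < A) ∧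
    ∀ x : Space N, rieszKernel α x = A * ‖x‖ ^ (α - N : ℝ) := by
  refine ⟨Real.Gamma (((N : ℝ) - α) / 2) /
      (Real.pi ^ ((N : ℝ) / 2) * (2 : ℝ) ^ α * Real.Gamma (α / 2)), fun h0 h1 => ?_, fun x => ?_⟩
  · have := Real.Gamma_pos_of_pos (show 0 < ((N : ℝ) - α) / 2 by linarith)
    have := Real.Gamma_pos_of_pos (show 0 < α / 2 by linarith)
    positivity
  · rw [rieszKernel, div_eq_mul_inv (Real.Gamma _ / _), ← Real.rpow_neg (norm_nonneg _), neg_sub]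

theorem rieszKernel_nonneg {N : ℕ} {α : ℝ} (h0 : 0 < α) (h1 : α < N) (x : Space N) :
    0 ≤ rieszKernel α x := by
  obtain ⟨A, hA, h⟩ := rieszKernel_eq (N := N) α
  have := hA h0 h1
  rw [h]; positivity

theorem rieszKernel_pos {N : ℕ} {α : ℝ} (h0 : 0 < α) (h1 : α < N) {x : Space N} (hx : x ≠ 0) :
    0 < rieszKernel α x := by
  obtain ⟨A, hA, h⟩ := rieszKernel_eq (N := N) α
  have := hA h0 h1
  have := norm_pos_iff.2 hx
  rw [h]; positivity

theorem rieszKernel_neg {N : ℕ} (α : ℝ) (x : Space N) :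
    rieszKernel α (-x) = rieszKernel α x := by simp [rieszKernel]

theorem rieszKernel_sub_comm {N : ℕ} (α : ℝ) (x y : Space N) :
    rieszKernel α (x - y) = rieszKernel α (y - x) := by rw [← neg_sub, rieszKernel_neg]

@[fun_prop]
theorem measurable_rieszKernel {N : ℕ} (α : ℝ) : Measurable (rieszKernel (N := N) α) := by
  obtain ⟨A, -, h⟩ := rieszKernel_eq (N := N) α
  rw [funext h]; fun_prop

theorem aestronglyMeasurable_riesz {N : ℕ} (α : ℝ) {f g : Space N → ℝ}
    (hf : AEStronglyMeasurable f) (hg : AEStronglyMeasurable g) :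
    AEStronglyMeasurable (fun q : Space N × Space N =>
      rieszKernel α (q.1 - q.2) * (f q.1 * g q.2)) := by
  refine AEStronglyMeasurable.mul ?_ (hf.comp_fst.mul hg.comp_snd)
  exact ((measurable_rieszKernel α).comp (by fun_prop)).aestronglyMeasurable

theorem ae_eq_riesz {N : ℕ} (α : ℝ) {f g f' g' : Space N → ℝ}
    (hf : f =ᵐ[volume] f') (hg : g =ᵐ[volume] g') :
    (fun q : Space N × Space N => rieszKernel α (q.1 - q.2) * (f q.1 * g q.2)) =ᵐ[volume]
      fun q => rieszKernel α (q.1 - q.2) * (f' q.1 * g' q.2) := by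
  have h1 := Measure.quasiMeasurePreserving_fst (μ := (volume : Measure (Space N)))
    (ν := (volume : Measure (Space N))) |>.ae_eq_comp hf
  have h2 := Measure.quasiMeasurePreserving_snd (μ := (volume : Measure (Space N)))
    (ν := (volume : Measure (Space N))) |>.ae_eq_comp hg
  filter_upwards [h1, h2] with q h1 h2
  simp only [Function.comp_apply] at h1 h2
  rw [h1, h2]

/-- Reduces an inequality to its normalised form. Dividing by a positive upper bound of the norm,
not by the norm, leaves no special case for functions that vanish almost everywhere. -/
theorem lintegral_enorm_rpow_le_one {β : Type*} [MeasurableSpace β] {μ : Measure β} {p : ℝ}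
    (hp : 0 < p) {f : β → ℝ} {a : ℝ} (ha : 0 < a)
    (h : eLpNorm f (ENNReal.ofReal p) μ ≤ ENNReal.ofReal a) :
    ∫⁻ y, ((‖f y / a‖₊ : ℝ≥0) : ℝ≥0∞) ^ p ∂μ ≤ 1 := by
  have hf : (fun y => f y / a) = a⁻¹ • f := by ext y; simp [div_eq_inv_mul]
  have h1 : eLpNorm (fun y => f y / a) (ENNReal.ofReal p) μ ≤ 1 := by
    rw [hf, eLpNorm_const_smul]
    grw [h]
    rw [Real.enorm_of_nonneg (by positivity), ← ENNReal.ofReal_mul (by positivity),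
      inv_mul_cancel₀ ha.ne', ENNReal.ofReal_one]
  rw [eLpNorm_eq_lintegral_rpow_enorm_toReal (by simpa using hp) ENNReal.ofReal_ne_top,
    ENNReal.toReal_ofReal hp.le] at h1
  have h2 := ENNReal.rpow_le_rpow h1 hp.le
  rwa [← ENNReal.rpow_mul, one_div_mul_cancel hp.ne', ENNReal.rpow_one, ENNReal.one_rpow] at h2

/-- Hardy–Littlewood–Sobolev inequality in the diagonal case. -/
theorem hls {N : ℕ} (hN : 1 ≤ N) {α : ℝ} (hα : 0 < α) (hαN : α < N) :
    ∃ C : ℝ, 0 ≤ C ∧ ∀ f g : Space N → ℝ, MemLp f (hlsExp N α) → MemLp g (hlsExp N α) →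
      Integrable (fun q : Space N × Space N => rieszKernel α (q.1 - q.2) * (f q.1 * g q.2)) ∧
      ∀ a b : ℝ, 0 < a → 0 < b → eLpNorm f (hlsExp N α) volume ≤ ENNReal.ofReal a →
        eLpNorm g (hlsExp N α) volume ≤ ENNReal.ofReal b → |rieszForm α f g| ≤ C * a * b := by
  obtain ⟨C, hC, h⟩ := hls_normalized hN hα hαN
  obtain ⟨A, hA, hk⟩ := rieszKernel_eq (N := N) α
  replace hA := hA hα hαN
  have hNpos : (0 : ℝ) < N := by exact_mod_cast hN
  have hp : (0 : ℝ) < 2 * N / (N + α) := by positivity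
  have key : ∀ f g : Space N → ℝ, Measurable f → Measurable g → ∀ a b : ℝ, 0 < a → 0 < b →
      eLpNorm f (hlsExp N α) volume ≤ ENNReal.ofReal a →
      eLpNorm g (hlsExp N α) volume ≤ ENNReal.ofReal b →
      ∫⁻ q : Space N × Space N, ‖rieszKernel α (q.1 - q.2) * (f q.1 * g q.2)‖ₑ ≤
        ENNReal.ofReal (A * C * a * b) := by
    intro f g hf hg a b ha hb hfa hgb
    have hm : Measurable fun q : Space N × Space N =>
      ENNReal.ofReal (‖q.1 - q.2‖ ^ (α - N)) * (‖f q.1 / a‖₊ : ℝ≥0) * (‖g q.2 / b‖₊ : ℝ≥0) := by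
      fun_prop
    have h1 := h (fun x => ‖f x / a‖₊) (fun x => ‖g x / b‖₊) (by fun_prop) (by fun_prop)
      (lintegral_enorm_rpow_le_one hp ha hfa) (lintegral_enorm_rpow_le_one hp hb hgb)
    rw [← lintegral_prod _ hm.aemeasurable] at h1
    calc _ = ∫⁻ q : Space N × Space N, ENNReal.ofReal (A * a * b) *
          (ENNReal.ofReal (‖q.1 - q.2‖ ^ (α - N)) * (‖f q.1 / a‖₊ : ℝ≥0) *
            (‖g q.2 / b‖₊ : ℝ≥0)) := by
          refine lintegral_congr fun q => ?_
          rw [← ENNReal.ofReal_coe_nnreal, ← ENNReal.ofReal_coe_nnreal,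
            ← ENNReal.ofReal_mul (by positivity), ← ENNReal.ofReal_mul (by positivity),
            ← ENNReal.ofReal_mul (by positivity), ← ofReal_norm, hk]
          congr 1
          simp only [norm_mul, coe_nnnorm, norm_div, Real.norm_of_nonneg ha.le,
            Real.norm_of_nonneg hb.le, Real.norm_of_nonneg hA.le]
          rw [Real.norm_of_nonneg (by positivity : 0 ≤ ‖q.1 - q.2‖ ^ (α - N : ℝ))]
          field_simp
      _ = ENNReal.ofReal (A * a * b) * ∫⁻ q : Space N × Space N,
          (ENNReal.ofReal (‖q.1 - q.2‖ ^ (α - N)) * (‖f q.1 / a‖₊ : ℝ≥0) *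
            (‖g q.2 / b‖₊ : ℝ≥0)) := lintegral_const_mul _ hm
      _ ≤ ENNReal.ofReal (A * a * b) * ENNReal.ofReal C := mul_le_mul_right h1 _
      _ = _ := by
          rw [← ENNReal.ofReal_mul (by positivity)]; congr 1; ring
  have key' : ∀ f g : Space N → ℝ, MemLp f (hlsExp N α) → MemLp g (hlsExp N α) →
      ∀ a b : ℝ, 0 < a → 0 < b →
      eLpNorm f (hlsExp N α) volume ≤ ENNReal.ofReal a →
      eLpNorm g (hlsExp N α) volume ≤ ENNReal.ofReal b →
      ∫⁻ q : Space N × Space N, ‖rieszKernel α (q.1 - q.2) * (f q.1 * g q.2)‖ₑ ≤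
        ENNReal.ofReal (A * C * a * b) := by
    intro f g hf hg a b ha hb hfa hgb
    obtain ⟨f', hf', hff⟩ := hf.1
    obtain ⟨g', hg', hgg⟩ := hg.1
    rw [eLpNorm_congr_ae hff] at hfa
    rw [eLpNorm_congr_ae hgg] at hgb
    refine le_trans (le_of_eq (lintegral_congr_ae ?_))
      (key f' g' hf'.measurable hg'.measurable a b ha hb hfa hgb)
    filter_upwards [ae_eq_riesz α hff hgg] with q hq
    rw [hq]
  refine ⟨A * C, by positivity, fun f g hf hg => ⟨⟨aestronglyMeasurable_riesz α hf.1 hg.1, ?_⟩,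
    fun a b ha hb hfa hgb => ?_⟩⟩
  -- The summand 1 provides a strictly positive upper bound even when the norm is zero.
  · have h1 : ∀ f : Space N → ℝ, MemLp f (hlsExp N α) → eLpNorm f (hlsExp N α) volume ≤
        ENNReal.ofReal ((eLpNorm f (hlsExp N α) volume).toReal + 1) := fun f hf => by
      rw [← ENNReal.ofReal_toReal hf.2.ne]
      exact ENNReal.ofReal_le_ofReal (by simp)
    exact (key' f g hf hg _ _ (by positivity) (by positivity) (h1 f hf) (h1 g hg)).trans_lt
      ENNReal.ofReal_lt_top
  · rw [← Real.norm_eq_abs]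
    refine (norm_integral_le_lintegral_norm _).trans ?_
    refine ENNReal.toReal_le_of_le_ofReal (by positivity) ?_
    simp_rw [ofReal_norm]
    exact key' f g hf hg a b ha hb hfa hgb

end Choquard

end

/-! ### H¹ functions: smooth approximation, Sobolev inequality, translation estimate. -/

noncomputable section

namespace Choquard

open scoped ENNReal NNReal Convolution
open Set Metric

theorem tendsto_const_div_add_one_zero (c : ℝ) :
    Tendsto (fun k : ℕ => c / ((k : ℝ) + 1)) atTop (𝓝 0) := by
  simpa [div_eq_mul_inv] using (tendsto_one_div_add_atTop_nhds_zero_nat (𝕜 := ℝ)).const_mul c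

/-- Cauchy–Schwarz against the constant 1. -/
theorem sq_lintegral_le {β : Type*} [MeasurableSpace β] {μ : Measure β} [IsProbabilityMeasure μ]
    {f : β → ℝ≥0∞} (hf : AEMeasurable f μ) :
    (∫⁻ y, f y ∂μ) ^ (2 : ℝ) ≤ ∫⁻ y, f y ^ (2 : ℝ) ∂μ := by
  have h := ENNReal.lintegral_mul_le_Lp_mul_Lq μ Real.HolderConjugate.two_two hf
    (aemeasurable_const (b := (1 : ℝ≥0∞)))
  simp only [Pi.mul_apply, mul_one, ENNReal.one_rpow, lintegral_const, measure_univ] at h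
  have h2 := ENNReal.rpow_le_rpow h (by norm_num : (0 : ℝ) ≤ 2)
  rwa [← ENNReal.rpow_mul, one_div_mul_cancel two_ne_zero, ENNReal.rpow_one] at h2

theorem eLpNorm_two_eq {β G : Type*} [MeasurableSpace β] [NormedAddCommGroup G] (μ : Measure β)
    (f : β → G) : eLpNorm f 2 μ = (∫⁻ y, ‖f y‖ₑ ^ (2 : ℝ) ∂μ) ^ (1 / 2 : ℝ) := by
  rw [eLpNorm_eq_lintegral_rpow_enorm_toReal two_ne_zero ENNReal.ofNat_ne_top]
  simp

theorem eLpNorm_two_rpow {β G : Type*} [MeasurableSpace β] [NormedAddCommGroup G] (μ : Measure β)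
    (f : β → G) : eLpNorm f 2 μ ^ (2 : ℝ) = ∫⁻ y, ‖f y‖ₑ ^ (2 : ℝ) ∂μ := by
  rw [eLpNorm_two_eq, ← ENNReal.rpow_mul, one_div_mul_cancel two_ne_zero, ENNReal.rpow_one]

/-- Minkowski's inequality for averages of translates. -/
theorem eLpNorm_le_of_le_translates {N : ℕ} {G G' : Type*} [NormedAddCommGroup G]
    [NormedAddCommGroup G'] {μ : Measure (Space N)}
    [IsProbabilityMeasure μ] {g : Space N → G} (hg : StronglyMeasurable g) {H : Space N → G'}
    {c : ℝ≥0∞} (h : ∀ x, ‖H x‖ₑ ≤ c * ∫⁻ y, ‖g (x - y)‖ₑ ∂μ) :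
    eLpNorm H 2 volume ≤ c * eLpNorm g 2 volume := by
  have hm : Measurable (fun x => ‖g x‖ₑ) := hg.enorm
  have key : ∫⁻ x, ‖H x‖ₑ ^ (2 : ℝ) ≤ c ^ (2 : ℝ) * ∫⁻ x, ‖g x‖ₑ ^ (2 : ℝ) := by
    calc ∫⁻ x, ‖H x‖ₑ ^ (2 : ℝ) ≤ ∫⁻ x, c ^ (2 : ℝ) * ∫⁻ y, ‖g (x - y)‖ₑ ^ (2 : ℝ) ∂μ := by
          refine lintegral_mono fun x => ?_
          grw [h x, ENNReal.mul_rpow_of_nonneg _ _ zero_le_two,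
            sq_lintegral_le ((hm.comp (measurable_const_sub x)).aemeasurable (f := fun y => ‖g (x - y)‖ₑ))]
      _ = c ^ (2 : ℝ) * ∫⁻ x, ∫⁻ y, ‖g (x - y)‖ₑ ^ (2 : ℝ) ∂μ := by
          refine lintegral_const_mul _ ?_
          exact Measurable.lintegral_prod_right'
            (f := fun q : Space N × Space N => ‖g (q.1 - q.2)‖ₑ ^ (2 : ℝ))
            ((hm.comp (by fun_prop)).pow_const _)
      _ = c ^ (2 : ℝ) * ∫⁻ y, (∫⁻ x, ‖g (x - y)‖ₑ ^ (2 : ℝ)) ∂μ := by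
          congr 1
          exact lintegral_lintegral_swap (f := fun x y => ‖g (x - y)‖ₑ ^ (2 : ℝ))
            ((hm.comp (f := fun q : Space N × Space N => q.1 - q.2)
              (by fun_prop)).pow_const _).aemeasurable
      _ = c ^ (2 : ℝ) * ∫⁻ x, ‖g x‖ₑ ^ (2 : ℝ) := by
          congr 1
          simp_rw [lintegral_sub_right_eq_self (fun x => ‖g x‖ₑ ^ (2 : ℝ))]
          simp
  rw [eLpNorm_two_eq, eLpNorm_two_eq]
  grw [key]
  rw [ENNReal.mul_rpow_of_nonneg _ _ (by norm_num), ← ENNReal.rpow_mul]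
  simp

theorem IsH1With.congr {N : ℕ} {u v : Space N → ℝ} {Du Dv : Space N → Space N}
    (h : IsH1With u Du) (h1 : u =ᵐ[volume] v) (h2 : Du =ᵐ[volume] Dv) : IsH1With v Dv := by
  refine ⟨(memLp_congr_ae h1).1 h.memLp, (memLp_congr_ae h2).1 h.memLp_grad,
    fun φ hφ hφc i => ?_⟩
  have e1 : ∫ x, u x * fderiv ℝ φ x (EuclideanSpace.single i 1) =
      ∫ x, v x * fderiv ℝ φ x (EuclideanSpace.single i 1) := by
    refine integral_congr_ae ?_
    filter_upwards [h1] with x hx; rw [hx]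
  have e2 : ∫ x, Du x i * φ x = ∫ x, Dv x i * φ x := by
    refine integral_congr_ae ?_
    filter_upwards [h2] with x hx; rw [hx]
  rw [← e1, ← e2]
  exact h.hasWeakGradient φ hφ hφc i

theorem IsH1With.exists_stronglyMeasurable {N : ℕ} {u : Space N → ℝ} {Du : Space N → Space N}
    (h : IsH1With u Du) : ∃ v Dv, u =ᵐ[volume] v ∧ Du =ᵐ[volume] Dv ∧ StronglyMeasurable v ∧
      StronglyMeasurable Dv ∧ IsH1With v Dv :=
  ⟨_, _, h.memLp.1.ae_eq_mk, h.memLp_grad.1.ae_eq_mk, h.memLp.1.stronglyMeasurable_mk,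
    h.memLp_grad.1.stronglyMeasurable_mk, h.congr h.memLp.1.ae_eq_mk h.memLp_grad.1.ae_eq_mk⟩

section Mollify

variable {N : ℕ} {u : Space N → ℝ} {Du : Space N → Space N}

theorem memLp_coord {Du : Space N → Space N} (h : MemLp Du 2 volume) (i : Fin N) :
    MemLp (fun x => Du x i) 2 volume :=
  (EuclideanSpace.proj i : Space N →L[ℝ] ℝ).comp_memLp' h

/-- The reflected kernel t ↦ ρ(x − t) is itself a test function, so the derivative passes from ρ to
u. The sign from the reflection cancels the sign in the definition of the weak gradient. -/
theorem IsH1With.fderiv_convolution_single (h : IsH1With u Du) {ρ : Space N → ℝ}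
    (hρ : ContDiff ℝ ∞ ρ) (hρc : HasCompactSupport ρ) (x : Space N) (i : Fin N) :
    fderiv ℝ (ρ ⋆[ContinuousLinearMap.lsmul ℝ ℝ, volume] u) x (EuclideanSpace.single i 1) =
      ∫ t, ρ (x - t) * Du t i := by
  have hu : LocallyIntegrable u volume := h.memLp.locallyIntegrable one_le_two
  have hρ1 : Continuous (fderiv ℝ ρ) := hρ.continuous_fderiv (by simp)
  rw [(hρc.hasFDerivAt_convolution_left _ (hρ.of_le (by simp)) hu x).fderiv, convolution_eq_swap,
    ContinuousLinearMap.integral_apply]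
  · have hψ : ContDiff ℝ ∞ fun t => ρ (x - t) := hρ.comp (by fun_prop)
    have hψc : HasCompactSupport fun t => ρ (x - t) :=
      hρc.comp_homeomorph (Homeomorph.subLeft x)
    have hd : ∀ t, fderiv ℝ (fun t => ρ (x - t)) t (EuclideanSpace.single i 1) =
        -fderiv ℝ ρ (x - t) (EuclideanSpace.single i 1) := fun t => by
      have : HasFDerivAt (fun t => ρ (x - t))
          ((fderiv ℝ ρ (x - t)).comp (-ContinuousLinearMap.id ℝ (Space N))) t := by
        refine (hρ.differentiable (by simp) (x - t)).hasFDerivAt.comp t ?_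
        simpa using (hasFDerivAt_id t).const_sub x
      rw [this.fderiv]; simp
    have := h.hasWeakGradient _ hψ hψc i
    simp_rw [hd, mul_neg, integral_neg, neg_inj] at this
    rw [← (integral_congr_ae (ae_of_all _ fun t => mul_comm (Du t i) (ρ (x - t)))), ← this]
    refine integral_congr_ae (ae_of_all _ fun t => ?_)
    simp [mul_comm]
  · have := (hρc.fderiv ℝ).convolutionExists_left
      (ContinuousLinearMap.precompL (Space N) (ContinuousLinearMap.lsmul ℝ ℝ)) hρ1 hu x
    exact this.integrable_swap

theorem integrable_mollifier_smul (h : MemLp Du 2 volume) {ρ : Space N → ℝ}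
    (hρ : Continuous ρ) (hρc : HasCompactSupport ρ) (x : Space N) :
    Integrable fun t => ρ (x - t) • Du t := by
  have := hρc.convolutionExists_left (ContinuousLinearMap.lsmul ℝ ℝ) hρ
    (h.locallyIntegrable one_le_two) x
  exact this.integrable_swap

theorem IsH1With.fderiv_convolution (h : IsH1With u Du) {ρ : Space N → ℝ} (hρ : ContDiff ℝ ∞ ρ)
    (hρc : HasCompactSupport ρ) (x : Space N) :
    fderiv ℝ (ρ ⋆[ContinuousLinearMap.lsmul ℝ ℝ, volume] u) x =
      innerSL ℝ (∫ t, ρ (x - t) • Du t) := by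
  have hi := integrable_mollifier_smul h.memLp_grad hρ.continuous hρc x
  refine ContinuousLinearMap.coe_injective
    ((EuclideanSpace.basisFun (Fin N) ℝ).toBasis.ext fun i => ?_)
  have := (EuclideanSpace.proj i : Space N →L[ℝ] ℝ).integral_comp_comm hi
  simp only [OrthonormalBasis.coe_toBasis, EuclideanSpace.basisFun_apply,
    ContinuousLinearMap.coe_coe, innerSL_apply_apply, EuclideanSpace.inner_single_right]
  rw [h.fderiv_convolution_single hρ hρc]
  simpa using this

/-- The probability measure with density a mollifier. -/
theorem isProbabilityMeasure_normed (φ : ContDiffBump (0 : Space N)) :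
    IsProbabilityMeasure (volume.withDensity fun y => ENNReal.ofReal (φ.normed volume y)) := by
  constructor
  rw [withDensity_apply _ MeasurableSet.univ, setLIntegral_univ,
    ← ofReal_integral_eq_lintegral_ofReal φ.integrable_normed
      (ae_of_all _ fun x => φ.nonneg_normed x), φ.integral_normed, ENNReal.ofReal_one]

/-- Brings mollification into the form required by `eLpNorm_le_of_le_translates`, so that it does
not increase L² norms. -/
theorem enorm_mollifier_le {G : Type*} [NormedAddCommGroup G] [NormedSpace ℝ G]
    (φ : ContDiffBump (0 : Space N)) {g : Space N → G} (hg : StronglyMeasurable g) (x : Space N) :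
    ‖∫ t, φ.normed volume (x - t) • g t‖ₑ ≤
      ∫⁻ y, ‖g (x - y)‖ₑ ∂(volume.withDensity fun y => ENNReal.ofReal (φ.normed volume y)) := by
  have hc : Continuous (φ.normed volume) := φ.continuous_normed
  have hg' : Measurable fun t => ‖g t‖ₑ := hg.enorm
  have hm : Measurable fun t => ‖g (x - t)‖ₑ := hg'.comp (measurable_const_sub x)
  rw [lintegral_withDensity_eq_lintegral_mul _ (by fun_prop) hm]
  refine (enorm_integral_le_lintegral_enorm _).trans (le_of_eq ?_)
  rw [← lintegral_sub_left_eq_self _ x]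
  refine lintegral_congr fun t => ?_
  simp [enorm_smul, Real.enorm_of_nonneg (φ.nonneg_normed _)]

end Mollify

/-- Approximation of `H¹` functions by test functions. -/
theorem IsH1With.exists_smooth_approx {N : ℕ} {u : Space N → ℝ} {Du : Space N → Space N}
    (h : IsH1With u Du) : ∃ φ : ℕ → Space N → ℝ,
      (∀ k, ContDiff ℝ ∞ (φ k)) ∧ (∀ k, HasCompactSupport (φ k)) ∧
      (∀ᵐ x, Tendsto (fun k => φ k x) atTop (𝓝 (u x))) ∧
      ∃ ε : ℕ → ℝ≥0∞, Tendsto ε atTop (𝓝 0) ∧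
        ∀ k, eLpNorm (fderiv ℝ (φ k)) 2 volume ≤ eLpNorm Du 2 volume + ε k := by
  wlog hs : StronglyMeasurable u ∧ StronglyMeasurable Du generalizing u Du
  · obtain ⟨v, Dv, h1, h2, h3, h4, h5⟩ := h.exists_stronglyMeasurable
    obtain ⟨φ, a, b, c, d⟩ := this h5 ⟨h3, h4⟩
    refine ⟨φ, a, b, ?_, ?_⟩
    · filter_upwards [c, h1] with x hx hx'
      rwa [hx']
    · rwa [eLpNorm_congr_ae h2]
  obtain ⟨hus, hDus⟩ := hs
  -- The ratio of outer to inner radius is kept equal to 2, as almost everywhere convergence of the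
  -- mollifications requires a bounded ratio.
  let ρ : ℕ → ContDiffBump (0 : Space N) := fun k =>
    ⟨1 / (k + 1), 2 / (k + 1), by positivity, by gcongr; norm_num⟩
  let m : ℕ → Space N → ℝ := fun k =>
    (ρ k).normed volume ⋆[ContinuousLinearMap.lsmul ℝ ℝ, volume] u
  have hu : LocallyIntegrable u volume := h.memLp.locallyIntegrable one_le_two
  have hm : ∀ k, ContDiff ℝ ∞ (m k) := fun k =>
    (ρ k).hasCompactSupport_normed.contDiff_convolution_left _ (ρ k).contDiff_normed hu
  have hmlim : ∀ᵐ x, Tendsto (fun k => m k x) atTop (𝓝 (u x)) := by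
    refine ContDiffBump.ae_convolution_tendsto_right_of_locallyIntegrable (K := 2) ?_ ?_ hu
    · exact tendsto_const_div_add_one_zero 2
    · filter_upwards with k
      simp only [ρ]
      rw [mul_one_div]
  let η : ContDiffBump (0 : Space N) := ⟨1, 2, by norm_num, by norm_num⟩
  have hη : ContDiff ℝ ∞ η := η.contDiff
  obtain ⟨K, hK⟩ : ∃ K, ∀ x, ‖fderiv ℝ η x‖ ≤ K :=
    (η.hasCompactSupport.fderiv ℝ).exists_bound_of_continuous (hη.continuous_fderiv (by simp))
  have hK0 : 0 ≤ K := (norm_nonneg _).trans (hK 0)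
  -- Cutoffs at scale k + 1. Their gradients are O(1/(k+1)), and the product rule turns this into
  -- the error ε k in the gradient norm.
  let χ : ℕ → Space N → ℝ := fun k x => η ((1 / (k + 1) : ℝ) • x)
  have hχ : ∀ k, ContDiff ℝ ∞ (χ k) := fun k => hη.comp (by fun_prop)
  have hχc : ∀ k, HasCompactSupport (χ k) := fun k =>
    η.hasCompactSupport.comp_smul (by positivity)
  have hχ1 : ∀ k x, ‖fderiv ℝ (χ k) x‖ ≤ K / (k + 1) := fun k x => by
    have hd : HasFDerivAt (χ k) ((fderiv ℝ η ((1 / (k + 1) : ℝ) • x)).comp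
        ((1 / (k + 1) : ℝ) • ContinuousLinearMap.id ℝ (Space N))) x :=
      (hη.differentiable (by simp) _).hasFDerivAt.comp x
        ((hasFDerivAt_id (𝕜 := ℝ) x).const_smul (1 / (k + 1) : ℝ))
    rw [hd.fderiv, ContinuousLinearMap.comp_smul, ContinuousLinearMap.comp_id, norm_smul,
      Real.norm_of_nonneg (by positivity), div_eq_inv_mul K, one_div]
    gcongr
    exact hK _
  have hχle : ∀ k x, ‖χ k x‖ ≤ 1 := fun k x => by
    rw [Real.norm_of_nonneg η.nonneg]; exact η.le_one
  have e1 : ∀ k, eLpNorm (m k) 2 volume ≤ eLpNorm u 2 volume := fun k => by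
    have := isProbabilityMeasure_normed (ρ k)
    have := eLpNorm_le_of_le_translates hus (H := m k) (c := 1)
      (μ := volume.withDensity fun y => ENNReal.ofReal ((ρ k).normed volume y)) (fun x => by
        rw [one_mul]
        refine le_trans (le_of_eq ?_) (enorm_mollifier_le (ρ k) hus x)
        simp only [m, convolution_eq_swap, ContinuousLinearMap.lsmul_apply])
    rwa [one_mul] at this
  have e2 : ∀ k, eLpNorm (fderiv ℝ (m k)) 2 volume ≤ eLpNorm Du 2 volume := fun k => by
    have := isProbabilityMeasure_normed (ρ k)
    have := eLpNorm_le_of_le_translates hDus (H := fderiv ℝ (m k)) (c := 1)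
      (μ := volume.withDensity fun y => ENNReal.ofReal ((ρ k).normed volume y)) (fun x => by
        rw [one_mul]
        refine le_trans (le_of_eq ?_) (enorm_mollifier_le (ρ k) hDus x)
        simp only [m]
        rw [h.fderiv_convolution (ρ k).contDiff_normed (ρ k).hasCompactSupport_normed,
          ← ofReal_norm, innerSL_apply_norm, ofReal_norm])
    rwa [one_mul] at this
  refine ⟨fun k x => χ k x * m k x, fun k => (hχ k).mul (hm k), fun k => (hχc k).mul_right, ?_,
    fun k => ENNReal.ofReal (K / (k + 1)) * eLpNorm u 2 volume, ?_, fun k => ?_⟩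
  · filter_upwards [hmlim] with x hx
    refine hx.congr' ?_
    filter_upwards [eventually_ge_atTop ⌈‖x‖⌉₊] with k hk
    have : χ k x = 1 := by
      refine η.one_of_mem_closedBall ?_
      have h1 : ‖x‖ ≤ k := Nat.ceil_le.1 hk
      rw [mem_closedBall_zero_iff, norm_smul, Real.norm_of_nonneg (by positivity), one_div,
        inv_mul_le_iff₀ (by positivity)]
      simp only [η]; linarith
    rw [this, one_mul]
  · have h1 : Tendsto (fun k : ℕ => K / ((k : ℝ) + 1)) atTop (𝓝 0) :=
      tendsto_const_div_add_one_zero K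
    have h2 := ENNReal.tendsto_ofReal h1
    rw [ENNReal.ofReal_zero] at h2
    simpa using ENNReal.Tendsto.mul_const h2 (Or.inr h.memLp.2.ne)
  · have hf : fderiv ℝ (fun x => χ k x * m k x) =
        (fun x => χ k x • fderiv ℝ (m k) x) + fun x => m k x • fderiv ℝ (χ k) x := by
      ext1 x
      exact fderiv_fun_mul ((hχ k).differentiable (by simp) x) ((hm k).differentiable (by simp) x)
    have c1 : Continuous (fderiv ℝ (m k)) := (hm k).continuous_fderiv (by simp)
    have c2 : Continuous (fderiv ℝ (χ k)) := (hχ k).continuous_fderiv (by simp)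
    rw [hf]
    refine (eLpNorm_add_le ((hχ k).continuous.smul c1).aestronglyMeasurable
      ((hm k).continuous.smul c2).aestronglyMeasurable one_le_two).trans ?_
    gcongr
    · refine (eLpNorm_mono fun x => ?_).trans (e2 k)
      rw [Pi.smul_apply', norm_smul]
      exact mul_le_of_le_one_left (norm_nonneg _) (hχle k x)
    · refine (eLpNorm_le_mul_eLpNorm_of_ae_le_mul (c := K / (k + 1)) (g := m k)
        (ae_of_all _ fun x => ?_) 2).trans (mul_le_mul_right (e1 k) _)
      rw [Pi.smul_apply', norm_smul, mul_comm]
      gcongr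
      exact hχ1 k x

/-- The Sobolev exponent `2N/(N-2)`. -/
def sobExp (N : ℕ) : ℝ≥0∞ := ENNReal.ofReal (2 * N / (N - 2))

/-- The Sobolev inequality. -/
theorem sobolev {N : ℕ} (hN : 3 ≤ N) : ∃ C : ℝ≥0, ∀ (u : Space N → ℝ) (Du : Space N → Space N),
    IsH1With u Du → eLpNorm u (sobExp N) volume ≤ C * eLpNorm Du 2 volume := by
  have hN' : (3 : ℝ) ≤ N := by exact_mod_cast hN
  refine ⟨eLpNormLESNormFDerivOfEqInnerConst (volume : Measure (Space N)) (2 : ℝ≥0), fun u Du h => ?_⟩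
  obtain ⟨φ, h1, h2, h3, ε, hε, h4⟩ := h.exists_smooth_approx
  have hb : ∀ k, eLpNorm (φ k) (sobExp N) volume ≤
      eLpNormLESNormFDerivOfEqInnerConst (volume : Measure (Space N)) (2 : ℝ≥0) *
        (eLpNorm Du 2 volume + ε k) := fun k => by
    refine (eLpNorm_le_eLpNorm_fderiv_of_eq_inner volume ((h1 k).of_le (by simp)) (h2 k)
      (p := 2) (p' := Real.toNNReal (2 * N / (N - 2))) one_le_two (by simp; omega) ?_).trans
      (by gcongr; exact h4 k)
    have : (0 : ℝ) < N - 2 := by linarith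
    rw [Real.coe_toNNReal _ (by positivity)]
    simp
    field_simp
  -- Fatou's lemma: almost everywhere convergence and an upper bound for the gradient norms suffice,
  -- and convergence in H¹ is not needed.
  refine (Lp.eLpNorm_lim_le_liminf_eLpNorm
    (fun k => (h1 k).continuous.aestronglyMeasurable) u h3).trans ?_
  refine (liminf_le_liminf (Eventually.of_forall hb)).trans (le_of_eq ?_)
  have : Tendsto (fun k => (eLpNormLESNormFDerivOfEqInnerConst (volume : Measure (Space N))
      (2 : ℝ≥0) : ℝ≥0∞) * (eLpNorm Du 2 volume + ε k)) atTop
      (𝓝 (eLpNormLESNormFDerivOfEqInnerConst (volume : Measure (Space N)) (2 : ℝ≥0) *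
        (eLpNorm Du 2 volume + 0))) :=
    ENNReal.Tendsto.const_mul (tendsto_const_nhds.add hε) (Or.inr ENNReal.coe_ne_top)
  rw [this.liminf_eq, add_zero]

/-- The increment is an integral of the gradient along the segment from x to x + v. This is an
average of translates of the gradient under the law of −tv with t uniform on (0,1], so Minkowski's
inequality for averages applies. -/
theorem eLpNorm_translate_sub_le_of_smooth {N : ℕ} {φ : Space N → ℝ} (hφ : ContDiff ℝ ∞ φ)
    (v : Space N) : eLpNorm (fun x => φ (x + v) - φ x) 2 volume ≤
      ENNReal.ofReal ‖v‖ * eLpNorm (fderiv ℝ φ) 2 volume := by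
  have hc : Continuous (fderiv ℝ φ) := hφ.continuous_fderiv (by simp)
  have hp : IsProbabilityMeasure (volume.restrict (Ioc (0 : ℝ) 1)) := ⟨by simp⟩
  let μ : Measure (Space N) := (volume.restrict (Ioc (0 : ℝ) 1)).map fun t => -(t • v)
  have hmv : Measurable fun t : ℝ => -(t • v) := by fun_prop
  have : IsProbabilityMeasure μ := Measure.isProbabilityMeasure_map hmv.aemeasurable
  refine eLpNorm_le_of_le_translates (μ := μ) hc.stronglyMeasurable fun x => ?_
  rw [lintegral_map (by fun_prop) hmv]
  have hd : ∀ t ∈ uIcc (0 : ℝ) 1, HasDerivAt (fun t : ℝ => φ (x + t • v))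
      (fderiv ℝ φ (x + t • v) v) t := fun t _ => by
    have := (hφ.differentiable (by simp) (x + t • v)).hasFDerivAt.comp_hasDerivAt t
      (((hasDerivAt_id t).smul_const v).const_add x)
    rw [one_smul] at this
    exact this
  have hi := intervalIntegral.integral_eq_sub_of_hasDerivAt hd
    (Continuous.intervalIntegrable (by fun_prop) _ _)
  rw [one_smul, zero_smul, add_zero] at hi
  rw [← hi, intervalIntegral.integral_of_le zero_le_one,
    ← lintegral_const_mul _ (by fun_prop)]
  refine (enorm_integral_le_lintegral_enorm _).trans (lintegral_mono fun t => ?_)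
  rw [sub_neg_eq_add, mul_comm, ofReal_norm]
  exact ContinuousLinearMap.le_opENorm _ _

/-- Translation estimate in `H¹`. -/
theorem IsH1With.eLpNorm_translate_sub_le {N : ℕ} {u : Space N → ℝ} {Du : Space N → Space N}
    (h : IsH1With u Du) (v : Space N) : eLpNorm (fun x => u (x + v) - u x) 2 volume ≤
      ENNReal.ofReal ‖v‖ * eLpNorm Du 2 volume := by
  obtain ⟨φ, h1, h2, h3, ε, hε, h4⟩ := h.exists_smooth_approx
  have hb : ∀ k, eLpNorm (fun x => φ k (x + v) - φ k x) 2 volume ≤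
      ENNReal.ofReal ‖v‖ * (eLpNorm Du 2 volume + ε k) := fun k =>
    (eLpNorm_translate_sub_le_of_smooth (h1 k) v).trans (by gcongr; exact h4 k)
  have hlim : ∀ᵐ x, Tendsto (fun k => φ k (x + v) - φ k x) atTop (𝓝 (u (x + v) - u x)) := by
    have := (measurePreserving_add_right volume v).quasiMeasurePreserving.ae h3
    filter_upwards [h3, this] with x hx hx'
    exact hx'.sub hx
  refine (Lp.eLpNorm_lim_le_liminf_eLpNorm (fun k => by
    have := (h1 k).continuous
    exact Continuous.aestronglyMeasurable (by fun_prop)) _ hlim).trans ?_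
  refine (liminf_le_liminf (Eventually.of_forall hb)).trans (le_of_eq ?_)
  have : Tendsto (fun k => ENNReal.ofReal ‖v‖ * (eLpNorm Du 2 volume + ε k)) atTop
      (𝓝 (ENNReal.ofReal ‖v‖ * (eLpNorm Du 2 volume + 0))) :=
    ENNReal.Tendsto.const_mul (tendsto_const_nhds.add hε) (Or.inr ENNReal.ofReal_ne_top)
  rw [this.liminf_eq, add_zero]

end Choquard

end

/-! ### The Gagliardo seminorm of H¹ functions. -/

noncomputable section

namespace Choquard

open scoped ENNReal NNReal
open Set Metric

/-- The square root of the Gagliardo integrand. -/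
def gagliardoQuotient {N : ℕ} (s : ℝ) (u : Space N → ℝ) (p : Space N × Space N) : ℝ :=
  (u p.1 - u p.2) / ‖p.1 - p.2‖ ^ (((N : ℝ) + 2 * s) / 2)

theorem gagliardoIntegrand_eq {N : ℕ} (s : ℝ) (u v : Space N → ℝ) (p : Space N × Space N) :
    gagliardoIntegrand s u v p = gagliardoQuotient s u p * gagliardoQuotient s v p := by
  rw [gagliardoIntegrand, gagliardoQuotient, gagliardoQuotient, div_mul_div_comm,
    ← Real.mul_rpow (norm_nonneg _) (norm_nonneg _), ← sq, ← Real.rpow_natCast,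
    ← Real.rpow_mul (norm_nonneg _)]
  congr 2
  push_cast; ring

theorem enorm_gagliardoQuotient_sq {N : ℕ} (s : ℝ) (u : Space N → ℝ) (p : Space N × Space N) :
    ‖gagliardoQuotient s u p‖ₑ ^ (2 : ℝ) =
      ENNReal.ofReal (‖p.1 - p.2‖ ^ (-((N : ℝ) + 2 * s))) * ‖u p.1 - u p.2‖ₑ ^ (2 : ℝ) := by
  rw [← ofReal_norm, ← ofReal_norm, ENNReal.ofReal_rpow_of_nonneg (norm_nonneg _) zero_le_two,
    ENNReal.ofReal_rpow_of_nonneg (norm_nonneg _) zero_le_two, ← ENNReal.ofReal_mul (by positivity),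
    gagliardoQuotient, norm_div, Real.div_rpow (norm_nonneg _) (norm_nonneg _), div_eq_inv_mul,
    Real.norm_of_nonneg (by positivity : 0 ≤ ‖p.1 - p.2‖ ^ (((N : ℝ) + 2 * s) / 2)),
    Real.rpow_neg (norm_nonneg _), ← Real.rpow_mul (norm_nonneg _), div_mul_cancel₀ _ two_ne_zero]

theorem aestronglyMeasurable_gagliardoQuotient {N : ℕ} (s : ℝ) {u : Space N → ℝ}
    (hu : AEStronglyMeasurable u) : AEStronglyMeasurable (gagliardoQuotient s u) := by
  have : Measurable fun p : Space N × Space N => ‖p.1 - p.2‖ ^ (((N : ℝ) + 2 * s) / 2) := by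
    fun_prop
  exact ((hu.comp_fst.sub hu.comp_snd).aemeasurable.div this.aemeasurable).aestronglyMeasurable

theorem gagliardoQuotient_congr {N : ℕ} (s : ℝ) {u v : Space N → ℝ} (h : u =ᵐ[volume] v) :
    gagliardoQuotient s u =ᵐ[volume] gagliardoQuotient s v := by
  have h1 := Measure.quasiMeasurePreserving_fst (μ := (volume : Measure (Space N)))
    (ν := (volume : Measure (Space N))) |>.ae_eq_comp h
  have h2 := Measure.quasiMeasurePreserving_snd (μ := (volume : Measure (Space N)))
    (ν := (volume : Measure (Space N))) |>.ae_eq_comp h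
  filter_upwards [h1, h2] with q h1 h2
  simp only [Function.comp_apply] at h1 h2
  rw [gagliardoQuotient, gagliardoQuotient, h1, h2]

/-- After the substitution x = y + v the double integral is ∫ |v|^(−N−2s) ‖u(·+v) − u‖₂² dv. For |v|
< 1 the norm squared is at most |v|²‖Du‖², and s < 1 gives convergence; for |v| ≥ 1 it is at most
4‖u‖², and s > 0 gives convergence. -/
theorem gagliardo_bound {N : ℕ} (hN : 1 ≤ N) {s : ℝ} (hs : s ∈ Ioo (0 : ℝ) 1) :
    ∃ C : ℝ, 0 ≤ C ∧ ∀ (u : Space N → ℝ) (Du : Space N → Space N), IsH1With u Du →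
      ∫⁻ p, ‖gagliardoQuotient s u p‖ₑ ^ (2 : ℝ) ≤
        ENNReal.ofReal C * (eLpNorm Du 2 volume ^ (2 : ℝ) + eLpNorm u 2 volume ^ (2 : ℝ)) := by
  obtain ⟨C₁, hC₁, h₁⟩ := lintegral_ball_norm_rpow hN (show (0 : ℝ) < 2 - 2 * s by linarith [hs.2])
  obtain ⟨C₂, hC₂, h₂⟩ :=
    lintegral_compl_ball_norm_rpow hN (show (0 : ℝ) < 2 * s by linarith [hs.1])
  refine ⟨C₁ + 4 * C₂, by positivity, fun u Du h => ?_⟩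
  wlog hm : StronglyMeasurable u generalizing u Du
  · obtain ⟨v, Dv, e1, e2, e3, -, e5⟩ := h.exists_stronglyMeasurable
    have := this v Dv e5 e3
    rw [eLpNorm_congr_ae e1, eLpNorm_congr_ae e2]
    refine le_trans (le_of_eq (lintegral_congr_ae ?_)) this
    filter_upwards [gagliardoQuotient_congr s e1] with p hp
    rw [hp]
  have hum : Measurable u := hm.measurable
  set k : Space N → ℝ≥0∞ := fun v => ENNReal.ofReal (‖v‖ ^ (-((N : ℝ) + 2 * s))) with hk
  have hkm : Measurable k := by fun_prop
  set A := eLpNorm Du 2 volume ^ (2 : ℝ)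
  set B := eLpNorm u 2 volume ^ (2 : ℝ)
  have hT : ∀ v, ∫⁻ y, ‖u (y + v) - u y‖ₑ ^ (2 : ℝ) ≤ ENNReal.ofReal (‖v‖ ^ 2) * A := fun v => by
    rw [← eLpNorm_two_rpow]
    refine (ENNReal.rpow_le_rpow (h.eLpNorm_translate_sub_le v) zero_le_two).trans_eq ?_
    rw [ENNReal.mul_rpow_of_nonneg _ _ zero_le_two,
      ENNReal.ofReal_rpow_of_nonneg (norm_nonneg _) zero_le_two, Real.rpow_two]
  have hT' : ∀ v, ∫⁻ y, ‖u (y + v) - u y‖ₑ ^ (2 : ℝ) ≤ 4 * B := fun v => by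
    rw [← eLpNorm_two_rpow]
    have e : eLpNorm (fun x => u (x + v)) 2 volume = eLpNorm u 2 volume :=
      eLpNorm_comp_measurePreserving h.memLp.1 (measurePreserving_add_right volume v)
    have e2 : eLpNorm (fun x => u (x + v) - u x) 2 volume ≤ 2 * eLpNorm u 2 volume := by
      refine (eLpNorm_sub_le (f := fun x => u (x + v)) (hum.comp
        (measurable_add_const v)).aestronglyMeasurable h.memLp.1 one_le_two).trans ?_
      rw [e, two_mul]
    refine (ENNReal.rpow_le_rpow e2 zero_le_two).trans_eq ?_
    rw [ENNReal.mul_rpow_of_nonneg _ _ zero_le_two]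
    congr 1
    norm_num
  calc ∫⁻ p, ‖gagliardoQuotient s u p‖ₑ ^ (2 : ℝ)
      = ∫⁻ y, ∫⁻ x, k (x - y) * ‖u x - u y‖ₑ ^ (2 : ℝ) := by
        simp_rw [enorm_gagliardoQuotient_sq]
        exact lintegral_prod_symm
          (fun p : Space N × Space N => k (p.1 - p.2) * ‖u p.1 - u p.2‖ₑ ^ (2 : ℝ))
          (Measurable.aemeasurable (by fun_prop))
    _ = ∫⁻ y, ∫⁻ v, k v * ‖u (y + v) - u y‖ₑ ^ (2 : ℝ) := by
        refine lintegral_congr fun y => ?_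
        rw [← lintegral_add_left_eq_self _ y]
        simp
    _ = ∫⁻ v, ∫⁻ y, k v * ‖u (y + v) - u y‖ₑ ^ (2 : ℝ) :=
        lintegral_lintegral_swap (Measurable.aemeasurable (by fun_prop))
    _ = ∫⁻ v, k v * ∫⁻ y, ‖u (y + v) - u y‖ₑ ^ (2 : ℝ) := by
        refine lintegral_congr fun v => lintegral_const_mul _ (by fun_prop)
    _ = (∫⁻ v in {v | ‖v‖ < 1}, k v * ∫⁻ y, ‖u (y + v) - u y‖ₑ ^ (2 : ℝ)) +
        ∫⁻ v in {v | ‖v‖ < 1}ᶜ, k v * ∫⁻ y, ‖u (y + v) - u y‖ₑ ^ (2 : ℝ) :=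
        (lintegral_add_compl _ (measurableSet_lt (by fun_prop) measurable_const)).symm
    _ ≤ (∫⁻ v in {v : Space N | ‖v‖ < 1}, ENNReal.ofReal (‖v‖ ^ ((2 - 2 * s) - N : ℝ)) * A) +
        ∫⁻ v in {v : Space N | 1 ≤ ‖v‖}, ENNReal.ofReal (‖v‖ ^ (-N - 2 * s : ℝ)) * (4 * B) := by
        have e : {v : Space N | ‖v‖ < 1}ᶜ = {v | 1 ≤ ‖v‖} := by ext; simp
        rw [e]
        refine add_le_add ?_ ?_
        · refine lintegral_mono fun v => ?_
          rcases eq_or_ne v 0 with rfl | hv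
          · simp
          refine (mul_le_mul_right (hT v) _).trans_eq ?_
          have hv : 0 < ‖v‖ := norm_pos_iff.2 hv
          rw [hk, ← mul_assoc, ← ENNReal.ofReal_mul (by positivity), ← Real.rpow_two,
            ← Real.rpow_add hv]
          congr 3
          ring
        · refine lintegral_mono fun v => (mul_le_mul_right (hT' v) _).trans_eq ?_
          simp only [hk]
          congr 3
          ring
    _ = ENNReal.ofReal C₁ * A + ENNReal.ofReal C₂ * (4 * B) := by
        rw [lintegral_mul_const _ (by fun_prop), lintegral_mul_const _ (by fun_prop),
          h₁ 1 one_pos, h₂ 1 one_pos, Real.one_rpow, Real.one_rpow, mul_one, mul_one]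
    _ ≤ ENNReal.ofReal (C₁ + 4 * C₂) * A + ENNReal.ofReal (C₁ + 4 * C₂) * B := by
        have : (4 : ℝ≥0∞) = ENNReal.ofReal 4 := by simp
        rw [← mul_assoc (ENNReal.ofReal C₂), this, ← ENNReal.ofReal_mul hC₂]
        gcongr <;> linarith
    _ = _ := (mul_add _ _ _).symm

theorem IsH1With.memLp_gagliardoQuotient {N : ℕ} (hN : 1 ≤ N) {s : ℝ} (hs : s ∈ Ioo (0 : ℝ) 1)
    {u : Space N → ℝ} {Du : Space N → Space N} (h : IsH1With u Du) :
    MemLp (gagliardoQuotient s u) 2 volume := by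
  obtain ⟨C, hC, hb⟩ := gagliardo_bound hN hs
  refine ⟨aestronglyMeasurable_gagliardoQuotient s h.memLp.1, ?_⟩
  rw [eLpNorm_two_eq]
  refine ENNReal.rpow_lt_top_of_nonneg (by norm_num) ((hb u Du h).trans_lt ?_).ne
  refine ENNReal.mul_lt_top ENNReal.ofReal_lt_top (ENNReal.add_lt_top.2 ⟨?_, ?_⟩)
  · exact ENNReal.rpow_lt_top_of_nonneg zero_le_two h.memLp_grad.2.ne
  · exact ENNReal.rpow_lt_top_of_nonneg zero_le_two h.memLp.2.ne

theorem IsH1With.integrable_gagliardoIntegrand {N : ℕ} (hN : 1 ≤ N) {s : ℝ}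
    (hs : s ∈ Ioo (0 : ℝ) 1) {u v : Space N → ℝ} {Du Dv : Space N → Space N}
    (hu : IsH1With u Du) (hv : IsH1With v Dv) : Integrable (gagliardoIntegrand s u v) := by
  simp_rw [funext (gagliardoIntegrand_eq s u v)]
  exact (hu.memLp_gagliardoQuotient hN hs).integrable_mul (hv.memLp_gagliardoQuotient hN hs)

end Choquard

end

/-! ### Pointwise estimates for the nonlinearity. -/

noncomputable section

namespace Choquard

open scoped ENNReal NNReal
open Set Metric

/-- The growth function `|t|^{(N+α)/N} + |t|^{(N+α)/(N-2)}`. -/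
def growth (N : ℕ) (α t : ℝ) : ℝ :=
  |t| ^ (((N : ℝ) + α) / (N : ℝ)) + |t| ^ (((N : ℝ) + α) / ((N : ℝ) - 2))

theorem growth_nonneg (N : ℕ) (α t : ℝ) : 0 ≤ growth N α t := by
  unfold growth; positivity

theorem CondF2.map_zero {N : ℕ} (hN : 3 ≤ N) {α : ℝ} (hα : 0 < α) {F : ℝ → ℝ}
    (hF : Continuous F) (h : CondF2 N α F) : F 0 = 0 := by
  have hN' : (3 : ℝ) ≤ N := by exact_mod_cast hN
  have ha : (0 : ℝ) < (N + α) / N := by positivity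
  have h1 : Tendsto (fun t : ℝ => F t / |t| ^ (((N : ℝ) + α) / N) * |t| ^ (((N : ℝ) + α) / N))
      (𝓝[≠] 0) (𝓝 (0 * 0)) := by
    refine h.1.mul ?_
    have : ContinuousAt (fun t : ℝ => |t| ^ (((N : ℝ) + α) / N)) 0 :=
      (continuous_abs.continuousAt).rpow_const (Or.inr ha.le)
    have h2 := this.tendsto.mono_left (nhdsWithin_le_nhds (s := {0}ᶜ))
    simpa [Real.zero_rpow ha.ne'] using h2
  have h2 : Tendsto F (𝓝[≠] 0) (𝓝 0) := by
    rw [mul_zero] at h1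
    refine h1.congr' ?_
    filter_upwards [self_mem_nhdsWithin] with t ht
    have : (0 : ℝ) < |t| := abs_pos.2 ht
    rw [div_mul_cancel₀]
    positivity
  exact tendsto_nhds_unique (hF.tendsto 0 |>.mono_left nhdsWithin_le_nhds) h2

/-- Dividing (f1) by |t| lowers both exponents by one. They stay positive, so the bound extends to t
= 0 by continuity of F'. The separate variables ξ and v serve to dominate F'(u + εv)v uniformly in
ε. -/
theorem CondF1.deriv_bound {N : ℕ} (hN : 3 ≤ N) {α : ℝ} (hα : 0 < α) {F : ℝ → ℝ}
    (hF : ContDiff ℝ 1 F) (h1 : CondF1 N α F) :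
    ∃ C : ℝ, 0 ≤ C ∧ ∀ ξ v r : ℝ, |ξ| ≤ r → |v| ≤ r → |deriv F ξ * v| ≤ C * growth N α r := by
  have hN' : (3 : ℝ) ≤ N := by exact_mod_cast hN
  have hN2 : (0 : ℝ) < N - 2 := by linarith
  obtain ⟨C, hC, hb⟩ := h1
  set a : ℝ := (N + α) / N with ha
  set b : ℝ := (N + α) / (N - 2) with hb'
  have ha1 : 0 < a - 1 := by rw [ha, sub_pos, lt_div_iff₀ (by positivity)]; linarith
  have hb1 : 0 < b - 1 := by rw [hb', sub_pos, lt_div_iff₀ (by positivity)]; linarith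
  have hne : ∀ t : ℝ, t ≠ 0 → |deriv F t| ≤ C * (|t| ^ (a - 1) + |t| ^ (b - 1)) := by
    intro t ht
    have hp : 0 < |t| := abs_pos.2 ht
    have := hb t
    rw [abs_mul] at this
    rw [Real.rpow_sub hp, Real.rpow_sub hp, Real.rpow_one, ← add_div, ← mul_div_assoc,
      le_div_iff₀ hp, mul_comm]
    exact this
  have hall : ∀ t : ℝ, |deriv F t| ≤ C * (|t| ^ (a - 1) + |t| ^ (b - 1)) := by
    have hc : Continuous (deriv F) := hF.continuous_deriv le_rfl
    have hcl : IsClosed {t : ℝ | |deriv F t| ≤ C * (|t| ^ (a - 1) + |t| ^ (b - 1))} := by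
      refine isClosed_le hc.abs (continuous_const.mul (Continuous.add ?_ ?_))
      · exact continuous_abs.rpow_const fun _ => Or.inr ha1.le
      · exact continuous_abs.rpow_const fun _ => Or.inr hb1.le
    intro t
    have hd : Dense ({0}ᶜ : Set ℝ) := dense_compl_singleton 0
    have := (hcl.closure_subset_iff (s := {0}ᶜ)).2 fun t ht => hne t ht
    exact this (hd t)
  refine ⟨C, hC.le, fun ξ v r hξ hv => ?_⟩
  have hr : 0 ≤ r := (abs_nonneg _).trans hξ
  rw [abs_mul, growth, abs_of_nonneg hr]
  have e : ∀ c : ℝ, 0 < c - 1 → r ^ c = r ^ (c - 1) * r := fun c hc => by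
    rcases hr.eq_or_lt with rfl | h
    · rw [Real.zero_rpow (by linarith), mul_zero]
    · rw [← Real.rpow_add_one h.ne', sub_add_cancel]
  rw [e a ha1, e b hb1, ← add_mul, ← mul_assoc]
  refine mul_le_mul ((hall ξ).trans ?_) hv (abs_nonneg _) (by positivity)
  gcongr

/-- Mean value inequality on the interval [−|t|, |t|]. -/
theorem growth_bound {N : ℕ} {α : ℝ} {F : ℝ → ℝ}
    (hF : ContDiff ℝ 1 F) (h0 : F 0 = 0) {C : ℝ}
    (hC : ∀ ξ v r : ℝ, |ξ| ≤ r → |v| ≤ r → |deriv F ξ * v| ≤ C * growth N α r) (t : ℝ) :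
    |F t| ≤ C * growth N α t := by
  rcases eq_or_ne t 0 with rfl | ht
  · rw [h0, abs_zero]
    exact (abs_nonneg _).trans (hC 0 0 0 (by simp) (by simp))
  have hp : 0 < |t| := abs_pos.2 ht
  have := (convex_closedBall (0 : ℝ) |t|).norm_image_sub_le_of_norm_deriv_le (f := F)
    (C := C * growth N α t / |t|)
    (fun x _ => hF.differentiable one_ne_zero x) (fun x hx => ?_)
    (x := 0) (y := t) (by simp) (by simp)
  · rwa [h0, sub_zero, sub_zero, Real.norm_eq_abs, Real.norm_eq_abs,
      div_mul_cancel₀ _ hp.ne'] at this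
  · have := hC x t |t| (by simpa using hx) le_rfl
    rw [abs_mul] at this
    rw [le_div_iff₀ hp]
    simpa [growth] using this

/-- The power 2N/(N+α) turns the two critical exponents of (f2) into 2 and 2N/(N−2). The limits in
(f2) then make the constant as small as desired outside a compact range of |t| in (0, ∞). -/
theorem exists_small_bound {N : ℕ} (hN : 3 ≤ N) {α : ℝ} (hα : 0 < α) {F : ℝ → ℝ}
    (h0 : F 0 = 0) (h : CondF2 N α F) {ε : ℝ} (hε : 0 < ε) :
    ∃ δ K : ℝ, 0 < δ ∧ δ ≤ K ∧ ∀ t : ℝ, |t| < δ ∨ K < |t| →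
      |F t| ^ (2 * N / (N + α) : ℝ) ≤ ε * (t ^ 2 + |t| ^ (2 * N / (N - 2) : ℝ)) := by
  have hN' : (3 : ℝ) ≤ N := by exact_mod_cast hN
  have hN2 : (0 : ℝ) < N - 2 := by linarith
  set P : ℝ := 2 * N / (N + α) with hP
  have hP0 : 0 < P := by positivity
  have hε1 : 0 < ε ^ (1 / P) := by positivity
  obtain ⟨δ, hδ, h1⟩ : ∃ δ > 0, ∀ t : ℝ, t ≠ 0 → |t| < δ →
      |F t| ≤ ε ^ (1 / P) * |t| ^ (((N : ℝ) + α) / N) := by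
    have := h.1.eventually (ball_mem_nhds 0 hε1)
    rw [eventually_nhdsWithin_iff, Metric.eventually_nhds_iff] at this
    obtain ⟨δ, hδ, h⟩ := this
    refine ⟨δ, hδ, fun t ht htδ => ?_⟩
    have := h (by simpa using htδ) ht
    have hp : 0 < |t| := abs_pos.2 ht
    rw [dist_zero_right, norm_div, Real.norm_eq_abs, Real.norm_of_nonneg (by positivity),
      div_lt_iff₀ (by positivity)] at this
    exact this.le
  obtain ⟨K, h2⟩ : ∃ K : ℝ, ∀ t : ℝ, K < |t| →
      |F t| ≤ ε ^ (1 / P) * |t| ^ (((N : ℝ) + α) / (N - 2)) := by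
    have := h.2.eventually (ball_mem_nhds 0 hε1)
    rw [← Metric.cobounded_eq_cocompact, (hasBasis_cobounded_norm).eventually_iff] at this
    obtain ⟨K, -, h⟩ := this
    refine ⟨max K 0, fun t ht => ?_⟩
    have hp : 0 < |t| := (le_max_right _ _).trans_lt ht
    have := h (show K ≤ ‖t‖ from (le_max_left _ _).trans ht.le)
    rw [dist_zero_right, norm_div, Real.norm_eq_abs, Real.norm_of_nonneg (by positivity),
      div_lt_iff₀ (by positivity)] at this
    exact this.le
  refine ⟨δ, max K δ, hδ, le_max_right _ _, fun t ht => ?_⟩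
  have hpow : ∀ c : ℝ, |F t| ≤ ε ^ (1 / P) * |t| ^ c → |F t| ^ P ≤ ε * |t| ^ (c * P) := by
    intro c hc
    refine (Real.rpow_le_rpow (abs_nonneg _) hc hP0.le).trans_eq ?_
    rw [Real.mul_rpow (by positivity) (by positivity), ← Real.rpow_mul hε.le,
      ← Real.rpow_mul (abs_nonneg _), one_div_mul_cancel hP0.ne', Real.rpow_one]
  rcases ht with ht | ht
  · rcases eq_or_ne t 0 with rfl | ht0
    · rw [h0, abs_zero, Real.zero_rpow hP0.ne']
      positivity
    refine (hpow _ (h1 t ht0 ht)).trans ?_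
    gcongr
    have : ((N : ℝ) + α) / N * P = 2 := by rw [hP]; field_simp
    rw [this, Real.rpow_two, sq_abs]
    have : 0 ≤ |t| ^ (2 * N / (N - 2) : ℝ) := by positivity
    linarith
  · refine (hpow _ (h2 t ((le_max_left _ _).trans_lt ht))).trans ?_
    gcongr
    have : ((N : ℝ) + α) / (N - 2) * P = 2 * N / (N - 2) := by rw [hP]; field_simp
    rw [this]
    nlinarith

theorem abs_sub_rpow_le {P : ℝ} (hP : 0 ≤ P) (hP2 : P ≤ 2) (x y : ℝ) :
    |x - y| ^ P ≤ 4 * (|x| ^ P + |y| ^ P) := by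
  have h1 : |x - y| ≤ 2 * max |x| |y| := by
    have := abs_sub x y
    linarith [le_max_left |x| |y|, le_max_right |x| |y|]
  have h2 : (2 : ℝ) ^ P ≤ 4 := by
    calc (2 : ℝ) ^ P ≤ 2 ^ (2 : ℝ) := Real.rpow_le_rpow_of_exponent_le one_le_two hP2
      _ = 4 := by norm_num
  have h3 : (max |x| |y|) ^ P ≤ |x| ^ P + |y| ^ P := by
    rcases max_cases |x| |y| with ⟨h, -⟩ | ⟨h, -⟩ <;> rw [h]
    · linarith [Real.rpow_nonneg (abs_nonneg y) P]
    · linarith [Real.rpow_nonneg (abs_nonneg x) P]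
  calc |x - y| ^ P ≤ (2 * max |x| |y|) ^ P := Real.rpow_le_rpow (abs_nonneg _) h1 hP
    _ = 2 ^ P * (max |x| |y|) ^ P := Real.mul_rpow (by positivity) (by positivity)
    _ ≤ 4 * (|x| ^ P + |y| ^ P) := by gcongr

/-- The pointwise form of subcritical compactness. Very small and very large values are absorbed by
(f2), and intermediate values by uniform continuity. Only a jump of size at least η costs the
constant M, later paid on a set of small measure. -/
theorem exists_diff_bound {N : ℕ} (hN : 3 ≤ N) {α : ℝ} (hα : 0 < α) {F : ℝ → ℝ}
    (hF : Continuous F) (h0 : F 0 = 0) (h : CondF2 N α F) {ε : ℝ} (hε : 0 < ε) :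
    ∃ η M : ℝ, 0 < η ∧ 0 ≤ M ∧ ∀ a b : ℝ,
      |F a - F b| ^ (2 * N / (N + α) : ℝ) ≤
        ε * (a ^ 2 + |a| ^ (2 * N / (N - 2) : ℝ)) + ε * (b ^ 2 + |b| ^ (2 * N / (N - 2) : ℝ)) +
          if η ≤ |a - b| then M else 0 := by
  have hN' : (3 : ℝ) ≤ N := by exact_mod_cast hN
  have hN2 : (0 : ℝ) < N - 2 := by linarith
  -- The quarter offsets the factor 4 in `abs_sub_rpow_le`.
  obtain ⟨δ, K, hδ, hδK, hb⟩ := exists_small_bound hN hα h0 h (show 0 < ε / 4 by positivity)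
  set P : ℝ := 2 * N / (N + α) with hP
  have hP0 : 0 < P := by positivity
  have hP2 : P ≤ 2 := by rw [hP, div_le_iff₀ (by positivity)]; linarith
  set g : ℝ → ℝ := fun t => t ^ 2 + |t| ^ (2 * N / (N - 2) : ℝ) with hg
  have hg0 : ∀ t, 0 ≤ g t := fun t => by simp only [hg]; positivity
  have hsplit := fun a b => abs_sub_rpow_le hP0.le hP2 (F a) (F b)
  obtain ⟨M, hM⟩ : ∃ M, ∀ t ∈ Icc (-K) K, |F t| ^ P ≤ M := by
    obtain ⟨M, hM⟩ := (isCompact_Icc (a := -K) (b := K)).exists_bound_of_continuousOn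
      hF.continuousOn
    exact ⟨M ^ P, fun t ht => Real.rpow_le_rpow (abs_nonneg _) (hM t ht) hP0.le⟩
  have hM0 : 0 ≤ M := le_trans (by positivity) (hM 0 ⟨by linarith, by linarith⟩)
  have hglob : ∀ t, |F t| ^ P ≤ ε / 4 * g t + M := fun t => by
    by_cases ht : |t| ≤ K
    · have := hM t (abs_le.1 ht)
      have := hg0 t
      have : 0 ≤ ε / 4 * g t := by positivity
      linarith
    · linarith [hb t (Or.inr (not_le.1 ht))]
  -- The margin 1 keeps b in the compact interval when |a| ≤ K and |a − b| < 1. The tolerance is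
  -- chosen so that its 2N/(N+α)-th power is εδ², hence at most εa² once |a| ≥ δ.
  obtain ⟨η₀, hη₀, hu⟩ : ∃ η > 0, ∀ a ∈ Icc (-(K + 1)) (K + 1), ∀ b ∈ Icc (-(K + 1)) (K + 1),
      |a - b| < η → |F a - F b| < (ε * δ ^ 2) ^ (1 / P) := by
    have := (isCompact_Icc (a := -(K + 1)) (b := K + 1)).uniformContinuousOn_of_continuous
      hF.continuousOn
    rw [Metric.uniformContinuousOn_iff] at this
    simpa [Real.dist_eq] using this ((ε * δ ^ 2) ^ (1 / P)) (by positivity)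
  have hmid : ∀ a b, δ ≤ |a| → |a| ≤ K → |a - b| < min η₀ 1 →
      |F a - F b| ^ P ≤ ε * g a := by
    intro a b h1 h2 h3
    have h4 := abs_le.1 h2
    have h5 := abs_lt.1 (h3.trans_le (min_le_right _ _))
    have h6 := hu a ⟨by linarith, by linarith⟩ b ⟨by linarith, by linarith⟩
      (h3.trans_le (min_le_left _ _))
    calc |F a - F b| ^ P ≤ ((ε * δ ^ 2) ^ (1 / P)) ^ P :=
          Real.rpow_le_rpow (abs_nonneg _) h6.le hP0.le
      _ = ε * δ ^ 2 := by
          rw [← Real.rpow_mul (by positivity), one_div_mul_cancel hP0.ne', Real.rpow_one]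
      _ ≤ ε * a ^ 2 := by
          rw [← sq_abs a]; gcongr
      _ ≤ ε * g a := by
          gcongr; simp only [hg]
          have : 0 ≤ |a| ^ (2 * N / (N - 2) : ℝ) := by positivity
          linarith
  refine ⟨min η₀ 1, 8 * M, by positivity, by positivity, fun a b => ?_⟩
  have ha0 : 0 ≤ ε * g a := mul_nonneg hε.le (hg0 a)
  have hb0 : 0 ≤ ε * g b := mul_nonneg hε.le (hg0 b)
  split_ifs with hab
  · linarith [hsplit a b, hglob a, hglob b]
  · rw [not_le] at hab
    by_cases h1 : |a| < δ ∨ K < |a|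
    · by_cases h2 : |b| < δ ∨ K < |b|
      · linarith [hsplit a b, hb a h1, hb b h2]
      · push Not at h2
        rw [abs_sub_comm] at hab ⊢
        linarith [hmid b a h2.1 h2.2 hab]
    · push Not at h1
      linarith [hmid a b h1.1 h1.2 hab]

end Choquard

end

/-! ### The nonlocal term: integrability, differentiability and continuity. -/

noncomputable section

namespace Choquard

open scoped ENNReal NNReal
open Set Metric

/-- `u ∈ L² ∩ L^{2N/(N-2)}`. -/
def MemL2Sob {N : ℕ} (u : Space N → ℝ) : Prop :=
  MemLp u 2 volume ∧ MemLp u (sobExp N) volume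

theorem IsH1With.memL2Sob {N : ℕ} (hN : 3 ≤ N) {u : Space N → ℝ} {Du : Space N → Space N}
    (h : IsH1With u Du) : MemL2Sob u := by
  obtain ⟨C, hC⟩ := sobolev hN
  exact ⟨h.memLp, h.memLp.1, (hC u Du h).trans_lt
    (ENNReal.mul_lt_top ENNReal.coe_lt_top h.memLp_grad.2)⟩

theorem MemL2Sob.add {N : ℕ} {u v : Space N → ℝ} (hu : MemL2Sob u) (hv : MemL2Sob v) :
    MemL2Sob (fun x => u x + v x) := ⟨hu.1.add hv.1, hu.2.add hv.2⟩

theorem MemL2Sob.const_mul {N : ℕ} {u : Space N → ℝ} (hu : MemL2Sob u) (c : ℝ) :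
    MemL2Sob (fun x => c * u x) := ⟨hu.1.const_mul c, hu.2.const_mul c⟩

theorem MemL2Sob.abs {N : ℕ} {u : Space N → ℝ} (hu : MemL2Sob u) :
    MemL2Sob (fun x => |u x|) := ⟨hu.1.abs, hu.2.abs⟩

/-- The `L^{2N/(N+α)}` bound for `growth ∘ u`. -/
def growthNorm {N : ℕ} (α : ℝ) (u : Space N → ℝ) : ℝ≥0∞ :=
  eLpNorm u 2 volume ^ (((N : ℝ) + α) / N) +
    eLpNorm u (sobExp N) volume ^ (((N : ℝ) + α) / (N - 2))

theorem hlsExp_one_le {N : ℕ} {α : ℝ} (hα : 0 < α) (hαN : α < N) : 1 ≤ hlsExp N α := by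
  have : (0 : ℝ) < N := hα.trans hαN
  rw [hlsExp, ENNReal.one_le_ofReal, one_le_div (by positivity)]
  linarith

/-- The exponents match: 2N/(N+α) times (N+α)/N is 2, and times (N+α)/(N−2) it is the Sobolev
exponent. -/
theorem eLpNorm_growth_le {N : ℕ} (hN : 3 ≤ N) {α : ℝ} (hα : 0 < α) (hαN : α < N)
    {u : Space N → ℝ} (hu : AEStronglyMeasurable u) :
    eLpNorm (fun x => growth N α (u x)) (hlsExp N α) volume ≤ growthNorm α u := by
  have hN' : (3 : ℝ) ≤ N := by exact_mod_cast hN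
  have hN2 : (0 : ℝ) < N - 2 := by linarith
  have ha : (0 : ℝ) < (N + α) / N := by positivity
  have hb : (0 : ℝ) < (N + α) / (N - 2) := by positivity
  have hm := hu.aemeasurable
  have e1 := eLpNorm_norm_rpow (p := hlsExp N α) (μ := (volume : Measure (Space N))) u ha
  have e2 := eLpNorm_norm_rpow (p := hlsExp N α) (μ := (volume : Measure (Space N))) u hb
  have e3 : hlsExp N α * ENNReal.ofReal ((N + α) / N) = 2 := by
    rw [hlsExp, ← ENNReal.ofReal_mul (by positivity)]
    have : (2 * N / (N + α) * ((N + α) / N) : ℝ) = 2 := by field_simp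
    rw [this]; simp
  have e4 : hlsExp N α * ENNReal.ofReal ((N + α) / (N - 2)) = sobExp N := by
    rw [hlsExp, ← ENNReal.ofReal_mul (by positivity), sobExp]
    congr 1
    field_simp
  rw [e3] at e1
  rw [e4] at e2
  rw [growthNorm, ← e1, ← e2]
  exact eLpNorm_add_le (hm.norm.pow_const _).aestronglyMeasurable
    (hm.norm.pow_const _).aestronglyMeasurable (hlsExp_one_le hα hαN)

theorem MemL2Sob.growthNorm_lt_top {N : ℕ} (hN : 3 ≤ N) {α : ℝ} (hα : 0 < α)
    {u : Space N → ℝ} (hu : MemL2Sob u) : growthNorm α u < ⊤ := by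
  have hN' : (3 : ℝ) ≤ N := by exact_mod_cast hN
  have hN2 : (0 : ℝ) < N - 2 := by linarith
  exact ENNReal.add_lt_top.2 ⟨ENNReal.rpow_lt_top_of_nonneg (by positivity) hu.1.2.ne,
    ENNReal.rpow_lt_top_of_nonneg (by positivity) hu.2.2.ne⟩

theorem eLpNorm_le_of_growth {N : ℕ} (hN : 3 ≤ N) {α : ℝ} (hα : 0 < α) (hαN : α < N)
    {u : Space N → ℝ} (hu : AEStronglyMeasurable u) {G : Space N → ℝ} {C : ℝ}
    (h : ∀ x, |G x| ≤ C * growth N α (u x)) :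
    eLpNorm G (hlsExp N α) volume ≤ ENNReal.ofReal C * growthNorm α u := by
  refine (eLpNorm_le_mul_eLpNorm_of_ae_le_mul (g := fun x => growth N α (u x))
    (ae_of_all _ fun x => ?_) _).trans (mul_le_mul_right (eLpNorm_growth_le hN hα hαN hu) _)
  rw [Real.norm_of_nonneg (growth_nonneg _ _ _)]
  exact h x

theorem MemL2Sob.memLp_of_growth {N : ℕ} (hN : 3 ≤ N) {α : ℝ} (hα : 0 < α) (hαN : α < N)
    {u : Space N → ℝ} (hu : MemL2Sob u) {G : Space N → ℝ} (hG : AEStronglyMeasurable G) {C : ℝ}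
    (h : ∀ x, |G x| ≤ C * growth N α (u x)) : MemLp G (hlsExp N α) volume :=
  ⟨hG, (eLpNorm_le_of_growth hN hα hαN hu.1.1 h).trans_lt
    (ENNReal.mul_lt_top ENNReal.ofReal_lt_top (hu.growthNorm_lt_top hN hα))⟩

theorem rieszForm_comm {N : ℕ} (α : ℝ) (f g : Space N → ℝ) :
    rieszForm α f g = rieszForm α g f := by
  rw [rieszForm, rieszForm, Measure.volume_eq_prod, ← integral_prod_swap]
  refine integral_congr_ae (ae_of_all _ fun q => ?_)
  simp only [Prod.fst_swap, Prod.snd_swap]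
  rw [rieszKernel_sub_comm, mul_comm (f _)]

theorem rieszForm_congr {N : ℕ} (α : ℝ) {f g f' g' : Space N → ℝ}
    (hf : f =ᵐ[volume] f') (hg : g =ᵐ[volume] g') : rieszForm α f g = rieszForm α f' g' :=
  integral_congr_ae (ae_eq_riesz α hf hg)

/-- A nonlinearity with the growth needed to make the Choquard energy well defined. -/
structure GrowthBound (N : ℕ) (α : ℝ) (F : ℝ → ℝ) (C : ℝ) : Prop where
  contDiff : ContDiff ℝ 1 F
  nonneg : 0 ≤ C
  bound : ∀ t, |F t| ≤ C * growth N α t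
  deriv_bound : ∀ ξ v r : ℝ, |ξ| ≤ r → |v| ≤ r → |deriv F ξ * v| ≤ C * growth N α r

theorem exists_growthBound {N : ℕ} (hN : 3 ≤ N) {α : ℝ} (hα : 0 < α) {F : ℝ → ℝ}
    (hF : ContDiff ℝ 1 F) (h1 : CondF1 N α F) (h2 : CondF2 N α F) :
    ∃ C, GrowthBound N α F C := by
  obtain ⟨C, h0, hC⟩ := h1.deriv_bound hN hα hF
  exact ⟨C, hF, h0, growth_bound hF (h2.map_zero hN hα hF.continuous) hC, hC⟩

namespace GrowthBound

variable {N : ℕ} {α C : ℝ} {F : ℝ → ℝ}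

theorem continuous (h : GrowthBound N α F C) : Continuous F := h.contDiff.continuous

theorem continuous_deriv (h : GrowthBound N α F C) : Continuous (deriv F) :=
  h.contDiff.continuous_deriv le_rfl

theorem aesm (h : GrowthBound N α F C) {u : Space N → ℝ} (hu : AEStronglyMeasurable u) :
    AEStronglyMeasurable (fun x => F (u x)) := h.continuous.comp_aestronglyMeasurable hu

theorem aesm_deriv (h : GrowthBound N α F C) {u v : Space N → ℝ} (hu : AEStronglyMeasurable u)
    (hv : AEStronglyMeasurable v) : AEStronglyMeasurable (fun x => deriv F (u x) * v x) :=
  (h.continuous_deriv.comp_aestronglyMeasurable hu).mul hv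

theorem memLp (h : GrowthBound N α F C) (hN : 3 ≤ N) (hα : 0 < α) (hαN : α < N)
    {u : Space N → ℝ} (hu : MemL2Sob u) : MemLp (fun x => F (u x)) (hlsExp N α) volume :=
  hu.memLp_of_growth hN hα hαN (h.aesm hu.1.1) fun _ => h.bound _

theorem deriv_bound_add (h : GrowthBound N α F C) {u v : Space N → ℝ} (x : Space N) :
    |deriv F (u x) * v x| ≤ C * growth N α (|u x| + |v x|) :=
  h.deriv_bound _ _ _ (by linarith [abs_nonneg (v x)]) (by linarith [abs_nonneg (u x)])

theorem memLp_deriv (h : GrowthBound N α F C) (hN : 3 ≤ N) (hα : 0 < α) (hαN : α < N)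
    {u v : Space N → ℝ} (hu : MemL2Sob u) (hv : MemL2Sob v) :
    MemLp (fun x => deriv F (u x) * v x) (hlsExp N α) volume :=
  (hu.abs.add hv.abs).memLp_of_growth hN hα hαN (h.aesm_deriv hu.1.1 hv.1.1)
    fun _ => h.deriv_bound_add _

theorem growth_mono {N : ℕ} (hN : 3 ≤ N) {α : ℝ} (hα : 0 < α) {t r : ℝ} (h : |t| ≤ r) :
    growth N α t ≤ growth N α r := by
  have hN' : (3 : ℝ) ≤ N := by exact_mod_cast hN
  have hN2 : (0 : ℝ) < N - 2 := by linarith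
  have : |t| ≤ |r| := h.trans (le_abs_self r)
  unfold growth
  gcongr

/-- Differentiation under the integral. For |ε| < 1 all factors are dominated by the growth function
at |u| + |v|, and the Hardy–Littlewood–Sobolev inequality makes the resulting majorant integrable.
The factor 2 comes from the symmetry of the form. -/
theorem hasDerivAt_rieszForm (h : GrowthBound N α F C) (hN : 3 ≤ N) (hα : 0 < α) (hαN : α < N)
    {u v : Space N → ℝ} (hu : MemL2Sob u) (hv : MemL2Sob v) :
    HasDerivAt (fun ε : ℝ => rieszForm α (fun x => F (u x + ε * v x)) fun x => F (u x + ε * v x))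
      (2 * rieszForm α (fun x => deriv F (u x) * v x) fun x => F (u x)) 0 := by
  obtain ⟨C', -, hls⟩ := hls (show 1 ≤ N by omega) hα hαN
  set w : Space N → ℝ := fun x => |u x| + |v x|
  have hw : MemL2Sob w := hu.abs.add hv.abs
  have hG : MemLp (fun x => C * growth N α (w x)) (hlsExp N α) volume := by
    refine hw.memLp_of_growth hN hα hαN (C := C) ?_ fun x => ?_
    · have := hw.1.1.aemeasurable
      refine AEMeasurable.aestronglyMeasurable ?_
      unfold growth
      exact ((this.abs.pow_const _).add (this.abs.pow_const _)).const_mul _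
    · rw [abs_of_nonneg (mul_nonneg h.nonneg (growth_nonneg _ _ _))]
  have hmem : ∀ ε : ℝ, MemL2Sob fun x => u x + ε * v x := fun ε => hu.add (hv.const_mul ε)
  have hle : ∀ ε ∈ ball (0 : ℝ) 1, ∀ x, |u x + ε * v x| ≤ w x := fun ε hε x => by
    have : |ε| ≤ 1 := by simpa using (mem_ball_zero_iff.1 hε).le
    calc |u x + ε * v x| ≤ |u x| + |ε| * |v x| := by rw [← abs_mul]; exact abs_add_le _ _
      _ ≤ |u x| + 1 * |v x| := by gcongr
      _ = w x := by simp [w]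
  have hFb : ∀ ε ∈ ball (0 : ℝ) 1, ∀ x, |F (u x + ε * v x)| ≤ C * growth N α (w x) :=
    fun ε hε x => (h.bound _).trans
      (mul_le_mul_of_nonneg_left (growth_mono hN hα (hle ε hε x)) h.nonneg)
  have hfb : ∀ ε ∈ ball (0 : ℝ) 1, ∀ x, |deriv F (u x + ε * v x) * v x| ≤ C * growth N α (w x) :=
    fun ε hε x => h.deriv_bound _ _ _ (hle ε hε x) (by simp only [w]; linarith [abs_nonneg (u x)])
  have hi1 := (hls _ _ hG hG).1
  have hfu := h.memLp_deriv hN hα hαN hu hv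
  have hFu := h.memLp hN hα hαN hu
  have key := hasDerivAt_integral_of_dominated_loc_of_deriv_le
    (μ := (volume : Measure (Space N × Space N)))
    (F := fun (ε : ℝ) q => rieszKernel α (q.1 - q.2) *
      (F (u q.1 + ε * v q.1) * F (u q.2 + ε * v q.2)))
    (F' := fun (ε : ℝ) q => rieszKernel α (q.1 - q.2) *
      ((deriv F (u q.1 + ε * v q.1) * v q.1) * F (u q.2 + ε * v q.2)) +
      rieszKernel α (q.1 - q.2) *
      (F (u q.1 + ε * v q.1) * (deriv F (u q.2 + ε * v q.2) * v q.2)))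
    (bound := fun q => rieszKernel α (q.1 - q.2) *
      (C * growth N α (w q.1) * (C * growth N α (w q.2))) + rieszKernel α (q.1 - q.2) *
      (C * growth N α (w q.1) * (C * growth N α (w q.2))))
    (x₀ := 0) (ball_mem_nhds _ one_pos)
    (Eventually.of_forall fun ε => aestronglyMeasurable_riesz α (h.aesm (hmem ε).1.1)
      (h.aesm (hmem ε).1.1))
    ((hls _ _ (h.memLp hN hα hαN (hmem 0)) (h.memLp hN hα hαN (hmem 0))).1)
    ((aestronglyMeasurable_riesz α (h.aesm_deriv (hmem 0).1.1 hv.1.1) (h.aesm (hmem 0).1.1)).add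
      (aestronglyMeasurable_riesz α (h.aesm (hmem 0).1.1) (h.aesm_deriv (hmem 0).1.1 hv.1.1)))
    (ae_of_all _ fun q ε hε => ?_) (hi1.add hi1) (ae_of_all _ fun q ε hε => ?_)
  · have e := key.2
    convert! e using 1
    simp only [zero_mul, add_zero]
    rw [integral_add (hls _ _ hfu hFu).1 (hls _ _ hFu hfu).1]
    change _ = rieszForm α (fun x => deriv F (u x) * v x) (fun x => F (u x)) +
      rieszForm α (fun x => F (u x)) (fun x => deriv F (u x) * v x)
    rw [rieszForm_comm α (fun x => F (u x))]
    ring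
  · have hk := rieszKernel_nonneg hα hαN (q.1 - q.2)
    refine (norm_add_le _ _).trans ?_
    simp only [norm_mul (rieszKernel _ _), Real.norm_of_nonneg hk]
    gcongr
    · rw [norm_mul]
      exact mul_le_mul (hfb ε hε _) (hFb ε hε _) (norm_nonneg _)
        (mul_nonneg h.nonneg (growth_nonneg _ _ _))
    · rw [norm_mul]
      exact mul_le_mul (hFb ε hε _) (hfb ε hε _) (norm_nonneg _)
        (mul_nonneg h.nonneg (growth_nonneg _ _ _))
  · have hd : ∀ x, HasDerivAt (fun ε : ℝ => F (u x + ε * v x))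
        (deriv F (u x + ε * v x) * v x) ε := fun x => by
      have h1 : HasDerivAt (fun ε : ℝ => u x + ε * v x) (v x) ε := by
        simpa using ((hasDerivAt_id ε).mul_const (v x)).const_add (u x)
      exact (h.contDiff.differentiable one_ne_zero _).hasDerivAt.comp ε h1
    have := ((hd q.1).mul (hd q.2)).const_mul (rieszKernel α (q.1 - q.2))
    rwa [mul_add] at this

end GrowthBound

section Riesz

variable {N : ℕ} {α : ℝ}

/-- Pairing g with the indicators of the balls of radius n gives integrable functions on the
product; Fubini then yields integrability in y for almost every x of each ball. -/
theorem ae_integrable_rieszConv (hN : 1 ≤ N) (hα : 0 < α) (hαN : α < N) {g : Space N → ℝ}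
    (hg : MemLp g (hlsExp N α) volume) :
    ∀ᵐ x : Space N, Integrable fun y => rieszKernel α (x - y) * g y := by
  obtain ⟨C, -, hls⟩ := hls hN hα hαN
  have h : ∀ n : ℕ, ∀ᵐ x : Space N, x ∈ ball (0 : Space N) n →
      Integrable fun y => rieszKernel α (x - y) * g y := fun n => by
    have hm : MemLp ((ball (0 : Space N) n).indicator fun _ => (1 : ℝ)) (hlsExp N α) volume :=
      memLp_indicator_const _ measurableSet_ball 1 (Or.inr measure_ball_lt_top.ne)
    filter_upwards [(hls _ _ hm hg).1.prod_right_ae] with x hx hxn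
    simpa [indicator_of_mem hxn] using hx
  filter_upwards [ae_all_iff.2 h] with x hx
  obtain ⟨n, hn⟩ := exists_nat_gt ‖x‖
  exact hx n (by simpa using hn)

theorem integrable_mul_rieszConv (hN : 1 ≤ N) (hα : 0 < α) (hαN : α < N) {f g : Space N → ℝ}
    (hf : MemLp f (hlsExp N α) volume) (hg : MemLp g (hlsExp N α) volume) :
    Integrable (fun x => f x * rieszConv α g x) ∧
      ∫ x, f x * rieszConv α g x = rieszForm α f g := by
  obtain ⟨C, -, hls⟩ := hls hN hα hαN
  have e : ∀ x, ∫ y, rieszKernel α (x - y) * (f x * g y) = f x * rieszConv α g x := fun x => by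
    rw [rieszConv, ← integral_const_mul]
    congr 1; ext y; ring
  have hi := (hls f g hf hg).1
  refine ⟨?_, ?_⟩
  · have := hi.integral_prod_left
    simpa only [e] using this
  · rw [rieszForm, Measure.volume_eq_prod, integral_prod _ hi]
    simp only [e]

/-- A difference of two squares: the mixed terms cancel by symmetry. -/
theorem rieszForm_sub_self (hN : 1 ≤ N) (hα : 0 < α) (hαN : α < N) {f g : Space N → ℝ}
    (hf : MemLp f (hlsExp N α) volume) (hg : MemLp g (hlsExp N α) volume) :
    rieszForm α f f - rieszForm α g g = rieszForm α (f - g) (f + g) := by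
  obtain ⟨C, -, hls⟩ := hls hN hα hαN
  have e : rieszForm α (f - g) (f + g) = (rieszForm α f f + rieszForm α f g) -
      (rieszForm α g f + rieszForm α g g) := by
    unfold rieszForm
    rw [← integral_add (hls f f hf hf).1 (hls f g hf hg).1,
      ← integral_add (hls g f hg hf).1 (hls g g hg hg).1]
    refine Eq.trans ?_ (integral_sub ((hls f f hf hf).1.add (hls f g hf hg).1)
        ((hls g f hg hf).1.add (hls g g hg hg).1))
    congr 1; ext q
    simp only [Pi.sub_apply, Pi.add_apply]
    ring
  rw [e, rieszForm_comm α g f]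
  ring

theorem tendsto_rieszForm (hN : 1 ≤ N) (hα : 0 < α) (hαN : α < N) {f : ℕ → Space N → ℝ}
    {g : Space N → ℝ} (hf : ∀ n, MemLp (f n) (hlsExp N α) volume)
    (hg : MemLp g (hlsExp N α) volume)
    (h : Tendsto (fun n => eLpNorm (f n - g) (hlsExp N α) volume) atTop (𝓝 0)) :
    Tendsto (fun n => rieszForm α (f n) (f n)) atTop (𝓝 (rieszForm α g g)) := by
  obtain ⟨C, hC, hls⟩ := hls hN hα hαN
  set A : ℝ := (eLpNorm g (hlsExp N α) volume).toReal
  have hA : eLpNorm g (hlsExp N α) volume = ENNReal.ofReal A := (ENNReal.ofReal_toReal hg.2.ne).symm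
  have hA0 : 0 ≤ A := ENNReal.toReal_nonneg
  rw [Metric.tendsto_atTop]
  intro ε hε
  -- With δ ≤ 1 the sum f n + g has norm at most 2A + 1, and the second entry makes the product at
  -- most ε/2. The C + 1 avoids dividing by zero.
  set δ : ℝ := min 1 (ε / (2 * (C + 1) * (2 * A + 1)))
  have hδ : 0 < δ := by positivity
  obtain ⟨n₀, hn₀⟩ := eventually_atTop.1
    (h.eventually (gt_mem_nhds (ENNReal.ofReal_pos.2 hδ)))
  refine ⟨n₀, fun n hn => ?_⟩
  have h1 := hn₀ n hn
  rw [Real.dist_eq, rieszForm_sub_self hN hα hαN (hf n) hg]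
  have h2 : eLpNorm (f n + g) (hlsExp N α) volume ≤ ENNReal.ofReal (2 * A + 1) := by
    have e : f n + g = (f n - g) + (g + g) := by ext x; simp
    rw [e]
    refine (eLpNorm_add_le ((hf n).1.sub hg.1) (hg.1.add hg.1) (hlsExp_one_le hα hαN)).trans ?_
    grw [eLpNorm_add_le hg.1 hg.1 (hlsExp_one_le hα hαN), h1, hA]
    rw [← ENNReal.ofReal_add hA0 hA0, ← ENNReal.ofReal_add hδ.le (by positivity)]
    refine ENNReal.ofReal_le_ofReal ?_
    linarith [min_le_left 1 (ε / (2 * (C + 1) * (2 * A + 1)))]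
  calc _ ≤ C * δ * (2 * A + 1) := (hls _ _ ((hf n).sub hg) ((hf n).add hg)).2 _ _ hδ
        (by positivity) h1.le h2
    _ ≤ (C + 1) * (ε / (2 * (C + 1) * (2 * A + 1))) * (2 * A + 1) := by
        gcongr
        · linarith
        · exact min_le_right _ _
    _ = ε / 2 := by field_simp
    _ < ε := by linarith

end Riesz

/-- Convergence in measure and boundedness in `L² ∩ L^{2N/(N-2)}` imply convergence of the
subcritical nonlinearity in `L^{2N/(N+α)}`. -/
theorem tendsto_eLpNorm_comp {N : ℕ} (hN : 3 ≤ N) {α : ℝ} (hα : 0 < α)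
    {F : ℝ → ℝ} (hF : Continuous F) (h0 : F 0 = 0) (h : CondF2 N α F)
    {u : ℕ → Space N → ℝ} {v : Space N → ℝ} (hu : ∀ n, MemL2Sob (u n)) (hv : MemL2Sob v)
    {B : ℝ≥0} (hB2 : ∀ n, eLpNorm (u n) 2 volume ≤ B)
    (hBs : ∀ n, eLpNorm (u n) (sobExp N) volume ≤ B)
    (hBv2 : eLpNorm v 2 volume ≤ B) (hBvs : eLpNorm v (sobExp N) volume ≤ B)
    (hm : ∀ η : ℝ, 0 < η → Tendsto (fun n => volume {x | η ≤ |u n x - v x|}) atTop (𝓝 0)) :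
    Tendsto (fun n => eLpNorm ((fun x => F (u n x)) - fun x => F (v x)) (hlsExp N α) volume)
      atTop (𝓝 0) := by
  have hN' : (3 : ℝ) ≤ N := by exact_mod_cast hN
  have hN2 : (0 : ℝ) < N - 2 := by linarith
  set P : ℝ := 2 * N / (N + α) with hP
  have hP0 : 0 < P := by positivity
  set q : ℝ := 2 * N / (N - 2) with hq
  have hq0 : 0 < q := by positivity
  have hint : ∀ w : Space N → ℝ, MemL2Sob w → eLpNorm w 2 volume ≤ B → eLpNorm w (sobExp N) volume ≤ B →
      ∫⁻ x, (‖w x‖ₑ ^ (2 : ℝ) + ‖w x‖ₑ ^ q) ≤ (B : ℝ≥0∞) ^ (2 : ℝ) + (B : ℝ≥0∞) ^ q := by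
    intro w hw h2 hs
    rw [lintegral_add_left' (hw.1.1.enorm.pow_const _), ← eLpNorm_two_rpow]
    gcongr
    rw [sobExp, eLpNorm_eq_lintegral_rpow_enorm_toReal (by simpa using hq0) ENNReal.ofReal_ne_top,
      ENNReal.toReal_ofReal hq0.le] at hs
    have := ENNReal.rpow_le_rpow hs hq0.le
    rwa [← ENNReal.rpow_mul, one_div_mul_cancel hq0.ne', ENNReal.rpow_one] at this
  set D : ℝ≥0∞ := (B : ℝ≥0∞) ^ (2 : ℝ) + (B : ℝ≥0∞) ^ q
  have hD : D ≠ ⊤ := by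
    refine ENNReal.add_ne_top.2 ⟨?_, ?_⟩ <;>
    exact (ENNReal.rpow_lt_top_of_nonneg (by positivity) ENNReal.coe_ne_top).ne
  have key : Tendsto (fun n => ∫⁻ x, ‖F (u n x) - F (v x)‖ₑ ^ P) atTop (𝓝 0) := by
    rw [ENNReal.tendsto_nhds_zero]
    intro ε hε
    obtain ⟨r, hr, hrε⟩ := ENNReal.lt_iff_exists_nnreal_btwn.1 hε
    have hr : (0 : ℝ) < r := by exact_mod_cast hr
    -- The terms for u n and v cost at most r/4 each, which leaves r/2 for the set where they differ
    -- by at least η.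
    set e : ℝ := r / (4 * (D.toReal + 1))
    have he : 0 < e := by positivity
    obtain ⟨η, M, hη, hM, hb⟩ := exists_diff_bound hN hα hF h0 h he
    have hmM : Tendsto (fun n => ENNReal.ofReal M * volume {x | η ≤ |u n x - v x|}) atTop
        (𝓝 (ENNReal.ofReal M * 0)) :=
      ENNReal.Tendsto.const_mul (hm η hη) (Or.inr ENNReal.ofReal_ne_top)
    rw [mul_zero] at hmM
    filter_upwards [hmM.eventually (gt_mem_nhds (ENNReal.ofReal_pos.2 (half_pos hr)))] with n hn
    have hS : NullMeasurableSet {x | η ≤ |u n x - v x|} volume :=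
      nullMeasurableSet_le aemeasurable_const ((hu n).1.1.sub hv.1.1).norm.aemeasurable
    have hpt : ∀ x, ‖F (u n x) - F (v x)‖ₑ ^ P ≤
        ENNReal.ofReal e * (‖u n x‖ₑ ^ (2 : ℝ) + ‖u n x‖ₑ ^ q) +
        ENNReal.ofReal e * (‖v x‖ₑ ^ (2 : ℝ) + ‖v x‖ₑ ^ q) +
        {x | η ≤ |u n x - v x|}.indicator (fun _ => ENNReal.ofReal M) x := by
      intro x
      have h1 : {x | η ≤ |u n x - v x|}.indicator (fun _ => ENNReal.ofReal M) x =
          ENNReal.ofReal (if η ≤ |u n x - v x| then M else 0) := by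
        simp only [indicator, mem_ofPred_eq]
        split_ifs <;> simp
      have h2 : 0 ≤ if η ≤ |u n x - v x| then M else 0 := by split_ifs <;> simp [hM]
      rw [h1]
      simp only [← ofReal_norm]
      simp only [ENNReal.ofReal_rpow_of_nonneg (norm_nonneg _) hP0.le,
        ENNReal.ofReal_rpow_of_nonneg (norm_nonneg _) hq0.le,
        ENNReal.ofReal_rpow_of_nonneg (norm_nonneg _) zero_le_two]
      rw [← ENNReal.ofReal_add (by positivity) (by positivity),
        ← ENNReal.ofReal_add (by positivity) (by positivity),
        ← ENNReal.ofReal_mul he.le, ← ENNReal.ofReal_mul he.le,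
        ← ENNReal.ofReal_add (by positivity) (by positivity),
        ← ENNReal.ofReal_add (by positivity) h2]
      refine ENNReal.ofReal_le_ofReal ?_
      simpa [Real.norm_eq_abs, hP, hq] using hb (u n x) (v x)
    calc ∫⁻ x, ‖F (u n x) - F (v x)‖ₑ ^ P
        ≤ _ := lintegral_mono hpt
      _ = ENNReal.ofReal e * (∫⁻ x, (‖u n x‖ₑ ^ (2 : ℝ) + ‖u n x‖ₑ ^ q)) +
          ENNReal.ofReal e * (∫⁻ x, (‖v x‖ₑ ^ (2 : ℝ) + ‖v x‖ₑ ^ q)) +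
          ENNReal.ofReal M * volume {x | η ≤ |u n x - v x|} := by
          have m1 := (hu n).1.1.enorm
          have m2 := hv.1.1.enorm
          have m3 : AEMeasurable fun x => ENNReal.ofReal e * (‖u n x‖ₑ ^ (2 : ℝ) + ‖u n x‖ₑ ^ q) :=
            ((m1.pow_const (2 : ℝ)).add (m1.pow_const q)).const_mul (ENNReal.ofReal e)
          have m4 : AEMeasurable fun x => ENNReal.ofReal e * (‖v x‖ₑ ^ (2 : ℝ) + ‖v x‖ₑ ^ q) :=
            ((m2.pow_const (2 : ℝ)).add (m2.pow_const q)).const_mul (ENNReal.ofReal e)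
          rw [lintegral_add_left' (by exact m3.add m4), lintegral_add_left' m3,
            lintegral_const_mul' _ _ ENNReal.ofReal_ne_top,
            lintegral_const_mul' _ _ ENNReal.ofReal_ne_top, lintegral_indicator_const₀ hS]
      _ ≤ ENNReal.ofReal e * D + ENNReal.ofReal e * D + ENNReal.ofReal (r / 2) := by
          gcongr
          · exact hint _ (hu n) (hB2 n) (hBs n)
          · exact hint _ hv hBv2 hBvs
      _ ≤ ENNReal.ofReal r := by
          rw [← ENNReal.ofReal_toReal hD, ← ENNReal.ofReal_mul he.le,
            ← ENNReal.ofReal_add (by positivity) (by positivity),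
            ← ENNReal.ofReal_add (by positivity) (by positivity)]
          refine ENNReal.ofReal_le_ofReal ?_
          have h1 : e * D.toReal ≤ r / 4 := by
            calc e * D.toReal ≤ e * (D.toReal + 1) := by gcongr; linarith
              _ = r / 4 := by simp only [e]; field_simp
          linarith
      _ ≤ ε := by rw [ENNReal.ofReal_coe_nnreal]; exact hrε.le
  have := (ENNReal.continuous_rpow_const (y := 1 / P)).tendsto 0 |>.comp key
  rw [ENNReal.zero_rpow_of_pos (by positivity)] at this
  refine this.congr fun n => ?_
  rw [hlsExp, eLpNorm_eq_lintegral_rpow_enorm_toReal (by simpa using hP0) ENNReal.ofReal_ne_top,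
    ENNReal.toReal_ofReal hP0.le]
  rfl

end Choquard

end

/-! ### Dilations and linear isometries acting on H¹ and on the energy. -/

noncomputable section

namespace Choquard

open scoped ENNReal NNReal
open Set Metric

section Scaling

variable {N : ℕ}

/-- The dilation `x ↦ u(x/r)`. -/
def dilate (r : ℝ) (u : Space N → ℝ) (x : Space N) : ℝ := u (r⁻¹ • x)

/-- The gradient of a dilation. -/
def dilateGrad (r : ℝ) (Du : Space N → Space N) (x : Space N) : Space N := r⁻¹ • Du (r⁻¹ • x)

theorem integral_dilate {r : ℝ} (hr : 0 < r) (f : Space N → ℝ) :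
    ∫ x, f (r⁻¹ • x) = r ^ (N : ℝ) * ∫ x, f x := by
  rw [Measure.integral_comp_smul]
  simp [abs_of_pos hr]

theorem integral_dilate_prod {r : ℝ} (hr : 0 < r) (f : Space N × Space N → ℝ) :
    ∫ p : Space N × Space N, f (r⁻¹ • p) = r ^ (2 * N : ℝ) * ∫ p, f p := by
  have : r ^ (2 * N : ℝ) = r ^ (N + N : ℕ) := by
    rw [← Real.rpow_natCast]; push_cast; ring_nf
  have hv : (volume : Measure (Space N × Space N)).IsAddHaarMeasure :=
    Measure.prod.instIsAddHaarMeasure _ _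
  rw [Measure.integral_comp_smul, this]
  simp [abs_of_pos hr]

theorem quasiMeasurePreserving_smul {r : ℝ} (hr : r ≠ 0) :
    Measure.QuasiMeasurePreserving (fun x : Space N => r • x) volume volume := by
  refine ⟨measurable_const_smul r, ?_⟩
  rw [Measure.map_addHaar_smul _ hr]
  exact Measure.smul_absolutelyContinuous

theorem memLp_two_comp_smul {G : Type*} [NormedAddCommGroup G] {f : Space N → G} {r : ℝ}
    (hr : r ≠ 0) (hf : MemLp f 2 volume) : MemLp (fun x => f (r • x)) 2 volume := by
  have h : MeasurePreserving (fun x : Space N => r • x) volume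
      (ENNReal.ofReal |(r ^ Module.finrank ℝ (Space N))⁻¹| • volume) :=
    ⟨measurable_const_smul r, Measure.map_addHaar_smul _ hr⟩
  exact (hf.smul_measure ENNReal.ofReal_ne_top).comp_measurePreserving h

theorem IsH1With.dilate {u : Space N → ℝ} {Du : Space N → Space N} (h : IsH1With u Du) {r : ℝ}
    (hr : 0 < r) : IsH1With (dilate r u) (dilateGrad r Du) := by
  have hr' : r⁻¹ ≠ 0 := by positivity
  refine ⟨memLp_two_comp_smul hr' h.memLp, (memLp_two_comp_smul hr' h.memLp_grad).const_smul r⁻¹,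
    fun φ hφ hφc i => ?_⟩
  have hψ : ContDiff ℝ ∞ fun x => φ (r • x) := hφ.comp (by fun_prop)
  have hψc : HasCompactSupport fun x => φ (r • x) := hφc.comp_smul hr.ne'
  have hd : ∀ x, fderiv ℝ (fun x => φ (r • x)) x = r • fderiv ℝ φ (r • x) := fun x =>
    fderiv_comp_smul r
  have key := h.hasWeakGradient _ hψ hψc i
  have e1 : ∀ x, r • r⁻¹ • x = x := fun x : Space N => by rw [smul_smul, mul_inv_cancel₀ hr.ne', one_smul]
  have s1 := integral_dilate hr fun x => u x * fderiv ℝ (fun x => φ (r • x)) x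
    (EuclideanSpace.single i 1)
  have s2 := integral_dilate hr fun x => Du x i * φ (r • x)
  rw [key] at s1
  simp only [hd, e1] at s1 s2
  have s3 : ∫ x, u (r⁻¹ • x) * ((r • fderiv ℝ φ x) (EuclideanSpace.single i 1)) =
      r * ∫ x, Choquard.dilate r u x * fderiv ℝ φ x (EuclideanSpace.single i 1) := by
    rw [← integral_const_mul]
    congr 1; ext x
    simp [Choquard.dilate]; ring
  have s4 : ∫ x, dilateGrad r Du x i * φ x = r⁻¹ * ∫ x, Du (r⁻¹ • x) i * φ x := by
    rw [← integral_const_mul]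
    congr 1; ext x
    simp [dilateGrad]; ring
  rw [s4, s2]
  rw [s3] at s1
  field_simp
  linarith

theorem integral_dilateGrad_sq {r : ℝ} (hr : 0 < r) (Du : Space N → Space N) :
    ∫ x, inner ℝ (dilateGrad r Du x) (dilateGrad r Du x) =
      r ^ ((N : ℝ) - 2) * ∫ x, inner ℝ (Du x) (Du x) := by
  simp only [dilateGrad, inner_smul_left, inner_smul_right]
  simp only [conj_trivial]
  rw [integral_const_mul, integral_const_mul,
    integral_dilate hr fun x => inner ℝ (Du x) (Du x), Real.rpow_sub hr, Real.rpow_two]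
  field_simp

theorem integral_dilate_sq {r : ℝ} (hr : 0 < r) (u : Space N → ℝ) :
    ∫ x, dilate r u x * dilate r u x = r ^ (N : ℝ) * ∫ x, u x * u x :=
  integral_dilate hr fun x => u x * u x

theorem fracForm_dilate [NeZero N] {r : ℝ} (hr : 0 < r) (s : ℝ) (u : Space N → ℝ) :
    fracForm s (dilate r u) (dilate r u) = r ^ ((N : ℝ) - 2 * s) * fracForm s u u := by
  have e : ∀ p : Space N × Space N, gagliardoIntegrand s (dilate r u) (dilate r u) p =
      r ^ (-((N : ℝ) + 2 * s)) * gagliardoIntegrand s u u (r⁻¹ • p) := fun p => by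
    simp only [gagliardoIntegrand, dilate, Prod.smul_fst, Prod.smul_snd]
    rw [← smul_sub, norm_smul, norm_inv, Real.norm_of_nonneg hr.le,
      Real.mul_rpow (by positivity) (norm_nonneg _), Real.inv_rpow hr.le, Real.rpow_neg hr.le]
    have : r ^ ((N : ℝ) + 2 * s) ≠ 0 := by positivity
    field_simp
  simp only [fracForm, e]
  rw [integral_const_mul, integral_dilate_prod hr (gagliardoIntegrand s u u),
    ← mul_assoc (r ^ (-((N : ℝ) + 2 * s))), ← Real.rpow_add hr]
  have : -((N : ℝ) + 2 * s) + 2 * N = N - 2 * s := by ring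
  rw [this]; ring

theorem rieszForm_dilate {r : ℝ} (hr : 0 < r) (α : ℝ) (f : Space N → ℝ) :
    rieszForm α (dilate r f) (dilate r f) = r ^ ((N : ℝ) + α) * rieszForm α f f := by
  obtain ⟨A, -, hA⟩ := rieszKernel_eq (N := N) α
  have e : ∀ p : Space N × Space N, rieszKernel α (p.1 - p.2) * (dilate r f p.1 * dilate r f p.2) =
      r ^ (α - (N : ℝ)) * (rieszKernel α ((r⁻¹ • p).1 - (r⁻¹ • p).2) *
        (f (r⁻¹ • p).1 * f (r⁻¹ • p).2)) := fun p => by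
    simp only [dilate, Prod.smul_fst, Prod.smul_snd, hA]
    rw [← smul_sub, norm_smul, norm_inv, Real.norm_of_nonneg hr.le,
      Real.mul_rpow (by positivity) (norm_nonneg _), Real.inv_rpow hr.le]
    have : r ^ (α - (N : ℝ)) ≠ 0 := by positivity
    field_simp
  simp only [rieszForm, e]
  rw [integral_const_mul, integral_dilate_prod hr
    (fun p => rieszKernel α (p.1 - p.2) * (f p.1 * f p.2)), ← mul_assoc, ← Real.rpow_add hr]
  congr 2
  ring

end Scaling

section Isometry

variable {N : ℕ}

/-- `u` is (almost everywhere) invariant under all linear isometries. -/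
def Radial (u : Space N → ℝ) : Prop :=
  ∀ g : Space N ≃ₗᵢ[ℝ] Space N, (fun x => u (g x)) =ᵐ[volume] u

theorem Radial.congr {u v : Space N → ℝ} (hu : Radial u) (h : u =ᵐ[volume] v) : Radial v :=
  fun g => by
    have := g.measurePreserving.quasiMeasurePreserving.ae_eq_comp h
    filter_upwards [this, hu g, h] with x h1 h2 h3
    simp only [Function.comp_apply] at h1
    rw [← h1, h2, h3]

theorem Radial.add {u v : Space N → ℝ} (hu : Radial u) (hv : Radial v) :
    Radial (fun x => u x + v x) := fun g => by
  filter_upwards [hu g, hv g] with x h1 h2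
  rw [h1, h2]

theorem Radial.const_mul {u : Space N → ℝ} (hu : Radial u) (c : ℝ) :
    Radial (fun x => c * u x) := fun g => by
  filter_upwards [hu g] with x h1
  rw [h1]

theorem Radial.dilate {u : Space N → ℝ} (hu : Radial u) {r : ℝ} (hr : 0 < r) :
    Radial (dilate r u) := fun g => by
  have := (quasiMeasurePreserving_smul (N := N) (inv_ne_zero hr.ne')).ae_eq_comp (hu g)
  filter_upwards [this] with x hx
  simp only [Function.comp_apply] at hx
  rw [Choquard.dilate, Choquard.dilate, ← hx, map_smul]

/-- A rotation sends coordinate directions to arbitrary ones, so integration by parts is needed in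
every direction. -/
theorem IsH1With.weakGradient_inner {u : Space N → ℝ} {Du : Space N → Space N}
    (h : IsH1With u Du) {φ : Space N → ℝ} (hφ : ContDiff ℝ ∞ φ) (hφc : HasCompactSupport φ)
    (v : Space N) : ∫ x, u x * fderiv ℝ φ x v = -∫ x, inner ℝ (Du x) v * φ x := by
  have hd : Continuous (fderiv ℝ φ) := hφ.continuous_fderiv (by simp)
  have hv : v = ∑ i, v i • EuclideanSpace.single i (1 : ℝ) := by
    simpa using ((EuclideanSpace.basisFun (Fin N) ℝ).sum_repr v).symm
  have e1 : ∀ x, u x * fderiv ℝ φ x v =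
      ∑ i, v i * (u x * fderiv ℝ φ x (EuclideanSpace.single i 1)) := fun x => by
    conv_lhs => rw [hv, map_sum, Finset.mul_sum]
    refine Finset.sum_congr rfl fun i _ => ?_
    rw [map_smul, smul_eq_mul]; ring
  have e2 : ∀ x, inner ℝ (Du x) v * φ x = ∑ i, v i * (Du x i * φ x) := fun x => by
    rw [PiLp.inner_apply, Finset.sum_mul]
    refine Finset.sum_congr rfl fun i _ => ?_
    simp; ring
  have i1 : ∀ i : Fin N, Integrable fun x => u x * fderiv ℝ φ x (EuclideanSpace.single i 1) :=
    fun i => h.memLp.integrable_mul (Continuous.memLp_of_hasCompactSupport (p := 2) (by fun_prop)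
      ((hφc.fderiv ℝ).comp_left (g := fun L : Space N →L[ℝ] ℝ => L (EuclideanSpace.single i 1))
        rfl))
  have i2 : ∀ i : Fin N, Integrable fun x => Du x i * φ x :=
    fun i => (memLp_coord h.memLp_grad i).integrable_mul
      (hφ.continuous.memLp_of_hasCompactSupport (p := 2) hφc)
  simp_rw [e1, e2]
  rw [integral_finsetSum _ fun i _ => (i1 i).const_mul _,
    integral_finsetSum _ fun i _ => (i2 i).const_mul _, ← Finset.sum_neg_distrib]
  refine Finset.sum_congr rfl fun i _ => ?_
  rw [integral_const_mul, integral_const_mul, h.hasWeakGradient φ hφ hφc i, mul_neg]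

theorem integral_comp_isometry (g : Space N ≃ₗᵢ[ℝ] Space N) (f : Space N → ℝ) :
    ∫ x, f (g x) = ∫ x, f x :=
  g.measurePreserving.integral_comp g.toHomeomorph.measurableEmbedding f

/-- The gradient of a rotated function. -/
def rotGrad (g : Space N ≃ₗᵢ[ℝ] Space N) (Du : Space N → Space N) (x : Space N) : Space N :=
  g.symm (Du (g x))

theorem IsH1With.comp_isometry {u : Space N → ℝ} {Du : Space N → Space N} (h : IsH1With u Du)
    (g : Space N ≃ₗᵢ[ℝ] Space N) : IsH1With (fun x => u (g x)) (rotGrad g Du) := by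
  refine ⟨h.memLp.comp_measurePreserving g.measurePreserving,
    (h.memLp_grad.comp_measurePreserving g.measurePreserving).continuousLinearMap_comp
      (g.symm.toContinuousLinearEquiv : Space N →L[ℝ] Space N), fun φ hφ hφc i => ?_⟩
  have hψ : ContDiff ℝ ∞ fun x => φ (g.symm x) := hφ.comp g.symm.contDiff
  have hψc : HasCompactSupport fun x => φ (g.symm x) :=
    hφc.comp_homeomorph g.symm.toHomeomorph
  have key := h.weakGradient_inner hψ hψc (g (EuclideanSpace.single i 1))
  have hd : ∀ x, fderiv ℝ (fun x => φ (g.symm x)) x (g (EuclideanSpace.single i 1)) =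
      fderiv ℝ φ (g.symm x) (EuclideanSpace.single i 1) := fun x => by
    have : HasFDerivAt (fun x => φ (g.symm x)) ((fderiv ℝ φ (g.symm x)).comp
        (g.symm.toContinuousLinearEquiv : Space N →L[ℝ] Space N)) x :=
      (hφ.differentiable (by simp) _).hasFDerivAt.comp x
        (g.symm.toContinuousLinearEquiv : Space N →L[ℝ] Space N).hasFDerivAt
    rw [this.fderiv]
    simp
  rw [← integral_comp_isometry g fun x => u x * _,
    ← integral_comp_isometry g fun x => inner ℝ (Du x) _ * _] at key
  simp only [hd, LinearIsometryEquiv.symm_apply_apply] at key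
  rw [key]
  congr 2
  ext x
  congr 1
  rw [← g.symm.inner_map_map, LinearIsometryEquiv.symm_apply_apply,
    EuclideanSpace.inner_single_right]
  simp [rotGrad]

theorem integral_prod_comp_isometry (g : Space N ≃ₗᵢ[ℝ] Space N) (f : Space N × Space N → ℝ) :
    ∫ p : Space N × Space N, f (g p.1, g p.2) = ∫ p, f p :=
  (g.measurePreserving.prod g.measurePreserving).integral_comp
    (g.toHomeomorph.prodCongr g.toHomeomorph).measurableEmbedding f

theorem fracForm_comp_isometry [NeZero N] (s : ℝ) (g : Space N ≃ₗᵢ[ℝ] Space N)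
    (u v : Space N → ℝ) :
    fracForm s (fun x => u (g x)) (fun x => v (g x)) = fracForm s u v := by
  rw [fracForm, fracForm, ← integral_prod_comp_isometry g (gagliardoIntegrand s u v)]
  congr 2; ext p
  simp only [gagliardoIntegrand, ← map_sub, LinearIsometryEquiv.norm_map]

theorem rieszForm_comp_isometry (α : ℝ) (g : Space N ≃ₗᵢ[ℝ] Space N) (u v : Space N → ℝ) :
    rieszForm α (fun x => u (g x)) (fun x => v (g x)) = rieszForm α u v := by
  rw [rieszForm, rieszForm, ← integral_prod_comp_isometry g
    fun q => rieszKernel α (q.1 - q.2) * (u q.1 * v q.2)]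
  congr 1; ext p
  simp only [rieszKernel, ← map_sub, LinearIsometryEquiv.norm_map]

theorem fracForm_congr [NeZero N] (s : ℝ) {u v u' v' : Space N → ℝ} (hu : u =ᵐ[volume] u')
    (hv : v =ᵐ[volume] v') : fracForm s u v = fracForm s u' v' := by
  rw [fracForm, fracForm]
  congr 1
  refine integral_congr_ae ?_
  filter_upwards [gagliardoQuotient_congr s hu, gagliardoQuotient_congr s hv] with p h1 h2
  rw [gagliardoIntegrand_eq, gagliardoIntegrand_eq, h1, h2]

end Isometry

end Choquard

end

/-! ### Compactness of bounded radial sequences. -/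

noncomputable section

namespace Choquard

open scoped ENNReal NNReal
open Set Metric

variable {N : ℕ}

theorem exists_isometry_map_eq {x y : Space N} (h : ‖x‖ = ‖y‖) :
    ∃ g : Space N ≃ₗᵢ[ℝ] Space N, g x = y := by
  exact ⟨_, Submodule.reflection_sub h⟩

/-- From dimension two on, the unit sphere is connected with more than one point, hence infinite. On
the line it has only two points. -/
theorem exists_unit_vectors (hN : 2 ≤ N) (k : ℕ) :
    ∃ T : Finset (Space N), T.card = k ∧ ∀ e ∈ T, ‖e‖ = 1 := by
  have hr : 1 < Module.rank ℝ (Space N) := by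
    rw [← Module.finrank_eq_rank]
    simp only [finrank_euclideanSpace, Fintype.card_fin]
    exact_mod_cast hN
  have hc := isPreconnected_sphere hr (0 : Space N) 1
  have hn : (sphere (0 : Space N) 1).Nontrivial := by
    refine ⟨EuclideanSpace.single ⟨0, by omega⟩ 1, by simp, -EuclideanSpace.single ⟨0, by omega⟩ 1,
      by simp, fun h => ?_⟩
    have := congrArg (fun v : Space N => v ⟨0, by omega⟩) h
    norm_num at this
  obtain ⟨T, hT, hk⟩ := (hc.infinite_of_nontrivial hn).exists_subset_card_eq k
  exact ⟨T, hk, fun e he => by simpa using hT he⟩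

/-- The mass of a radial function in a ball far from the origin is small. -/
theorem Radial.mul_lintegral_ball_le (hN : 2 ≤ N) (k : ℕ) (ε : ℝ) :
    ∃ R : ℝ, ∀ x : Space N, R ≤ ‖x‖ → ∀ u : Space N → ℝ, Radial u →
      k * ∫⁻ y in ball x ε, ‖u y‖ₑ ^ (2 : ℝ) ≤ ∫⁻ y, ‖u y‖ₑ ^ (2 : ℝ) := by
  obtain ⟨T, hT, hT1⟩ := exists_unit_vectors hN k
  -- Far from the origin, the ball around x has k pairwise disjoint rotated copies, all carrying the
  -- same mass of u.
  have hev : ∀ᶠ R : ℝ in atTop, ∀ p ∈ T.offDiag, 2 * ε ≤ R * ‖p.1 - p.2‖ := by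
    rw [Finset.eventually_all]
    intro p hp
    have : 0 < ‖p.1 - p.2‖ := norm_pos_iff.2 (sub_ne_zero.2 (Finset.mem_offDiag.1 hp).2.2)
    exact (tendsto_id.atTop_mul_const this).eventually_ge_atTop _
  obtain ⟨R, hR⟩ := eventually_atTop.1 hev
  refine ⟨max R 0, fun x hx u hu => ?_⟩
  have hball : ∀ e ∈ T, ∫⁻ y in ball (‖x‖ • e) ε, ‖u y‖ₑ ^ (2 : ℝ) =
      ∫⁻ y in ball x ε, ‖u y‖ₑ ^ (2 : ℝ) := by
    intro e he
    obtain ⟨g, hg⟩ := exists_isometry_map_eq (x := x) (y := ‖x‖ • e)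
      (by rw [norm_smul, hT1 e he, norm_norm, mul_one])
    have h1 : g ⁻¹' ball (‖x‖ • e) ε = ball x ε := by
      rw [← hg]; ext y; simp
    rw [← g.measurePreserving.setLIntegral_comp_preimage_emb
      g.toHomeomorph.measurableEmbedding, h1]
    refine lintegral_congr_ae (ae_restrict_of_ae ?_)
    filter_upwards [hu g] with y hy
    rw [hy]
  calc (k : ℝ≥0∞) * ∫⁻ y in ball x ε, ‖u y‖ₑ ^ (2 : ℝ)
      = ∑ e ∈ T, ∫⁻ y in ball (‖x‖ • e) ε, ‖u y‖ₑ ^ (2 : ℝ) := by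
        rw [Finset.sum_congr rfl hball, Finset.sum_const, hT, nsmul_eq_mul]
    _ = ∫⁻ y in ⋃ e ∈ T, ball (‖x‖ • e) ε, ‖u y‖ₑ ^ (2 : ℝ) := by
        rw [lintegral_biUnion_finset]
        · intro e he e' he' hne
          refine ball_disjoint_ball ?_
          rw [dist_eq_norm, ← smul_sub, norm_smul, norm_norm, ← two_mul]
          exact hR ‖x‖ ((le_max_left _ _).trans hx) (e, e') (Finset.mem_offDiag.2 ⟨he, he', hne⟩)
        · exact fun _ _ => measurableSet_ball
    _ ≤ _ := setLIntegral_le_lintegral _ _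

/-- The uniform probability measure on the ball of radius `ε`. -/
def ballMeasure (N : ℕ) (ε : ℝ) : Measure (Space N) :=
  (volume (ball (0 : Space N) ε))⁻¹ • volume.restrict (ball 0 ε)

theorem isProbabilityMeasure_ballMeasure {ε : ℝ} (hε : 0 < ε) :
    IsProbabilityMeasure (ballMeasure N ε) := by
  constructor
  have h1 : volume (ball (0 : Space N) ε) ≠ 0 := (measure_ball_pos _ _ hε).ne'
  simp [ballMeasure, ENNReal.inv_mul_cancel h1 measure_ball_lt_top.ne]

/-- The average of `w` over balls of radius `ε`. -/
def ballAverage (ε : ℝ) (w : Space N → ℝ) (x : Space N) : ℝ := ∫ y, w (x - y) ∂ballMeasure N ε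

theorem stronglyMeasurable_ballAverage {ε : ℝ} (hε : 0 < ε) {w : Space N → ℝ}
    (hw : StronglyMeasurable w) : StronglyMeasurable (ballAverage ε w) := by
  have := isProbabilityMeasure_ballMeasure (N := N) hε
  exact StronglyMeasurable.integral_prod_right
    (f := fun x y => w (x - y)) (hw.comp_measurable (by fun_prop))

theorem setLIntegral_ball_comp_sub (ε : ℝ) (x : Space N) (f : Space N → ℝ≥0∞) :
    ∫⁻ y in ball (0 : Space N) ε, f (x - y) = ∫⁻ y in ball x ε, f y := by
  have h : (fun y => x - y) ⁻¹' ball x ε = ball (0 : Space N) ε := by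
    ext y; simp [dist_eq_norm]
  rw [← h]
  exact (Measure.measurePreserving_sub_left volume x).setLIntegral_comp_preimage_emb
    (Homeomorph.subLeft x).measurableEmbedding f _

/-- The average at x is a pairing with a fixed L² function, so weak convergence makes averages
converge pointwise. -/
theorem ballAverage_eq {ε : ℝ} (w : Space N → ℝ) (x : Space N) :
    ballAverage ε w x = (volume (ball (0 : Space N) ε))⁻¹.toReal *
      ∫ y, w y * (ball x ε).indicator (fun _ => (1 : ℝ)) y := by
  have h : (fun y => x - y) ⁻¹' ball x ε = ball (0 : Space N) ε := by
    ext y; simp [dist_eq_norm]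
  rw [ballAverage, ballMeasure, integral_smul_measure, smul_eq_mul]
  congr 1
  have := (Measure.measurePreserving_sub_left volume x).setIntegral_preimage_emb
    (Homeomorph.subLeft x).measurableEmbedding w (ball x ε)
  rw [h] at this
  refine this.trans ?_
  rw [← integral_indicator measurableSet_ball]
  congr 1; ext y
  simp [indicator]

theorem enorm_ballAverage_sq_le {ε : ℝ} (hε : 0 < ε) {w : Space N → ℝ}
    (hw : StronglyMeasurable w) (x : Space N) :
    ‖ballAverage ε w x‖ₑ ^ (2 : ℝ) ≤
      (volume (ball (0 : Space N) ε))⁻¹ * ∫⁻ y in ball x ε, ‖w y‖ₑ ^ (2 : ℝ) := by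
  have := isProbabilityMeasure_ballMeasure (N := N) hε
  have hm : Measurable fun y => ‖w (x - y)‖ₑ := hw.enorm.comp (measurable_const_sub x)
  calc ‖ballAverage ε w x‖ₑ ^ (2 : ℝ) ≤ (∫⁻ y, ‖w (x - y)‖ₑ ∂ballMeasure N ε) ^ (2 : ℝ) :=
        ENNReal.rpow_le_rpow (enorm_integral_le_lintegral_enorm _) zero_le_two
    _ ≤ ∫⁻ y, ‖w (x - y)‖ₑ ^ (2 : ℝ) ∂ballMeasure N ε := sq_lintegral_le hm.aemeasurable
    _ = _ := by
      rw [ballMeasure, lintegral_smul_measure, smul_eq_mul,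
        setLIntegral_ball_comp_sub ε x fun y => ‖w y‖ₑ ^ (2 : ℝ)]

/-- The difference averages w(x) − w(x − y) over |y| < ε; Cauchy–Schwarz, Fubini and the translation
estimate bound its norm. -/
theorem IsH1With.eLpNorm_sub_ballAverage_le {ε : ℝ} (hε : 0 < ε) {w : Space N → ℝ}
    {Dw : Space N → Space N} (h : IsH1With w Dw) (hw : StronglyMeasurable w) :
    eLpNorm (fun x => w x - ballAverage ε w x) 2 volume ≤
      ENNReal.ofReal ε * eLpNorm Dw 2 volume := by
  have hp := isProbabilityMeasure_ballMeasure (N := N) hε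
  have hm := hw.measurable
  have hint : ∀ x, Integrable (fun y => w (x - y)) (ballMeasure N ε) := fun x => by
    have h1 : MemLp (fun y => w (x - y)) 2 (volume.restrict (ball 0 ε)) :=
      (h.memLp.comp_measurePreserving (Measure.measurePreserving_sub_left volume x)).restrict _
    have h2 : MemLp (fun y => w (x - y)) 2 (ballMeasure N ε) :=
      h1.smul_measure (ENNReal.inv_ne_top.2 (measure_ball_pos _ _ hε).ne')
    exact h2.integrable one_le_two
  have hsq : ∫⁻ x, ‖w x - ballAverage ε w x‖ₑ ^ (2 : ℝ) ≤
      (ENNReal.ofReal ε * eLpNorm Dw 2 volume) ^ (2 : ℝ) := by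
    calc _ ≤ ∫⁻ x, ∫⁻ y, ‖w (x - y) - w x‖ₑ ^ (2 : ℝ) ∂ballMeasure N ε := by
          refine lintegral_mono fun x => ?_
          have e : w x - ballAverage ε w x = ∫ y, (w x - w (x - y)) ∂ballMeasure N ε := by
            rw [integral_sub (integrable_const _) (hint x), integral_const]
            simp [ballAverage]
          have hm' : Measurable fun y => ‖w x - w (x - y)‖ₑ := by fun_prop
          rw [e]
          refine (ENNReal.rpow_le_rpow (enorm_integral_le_lintegral_enorm _) zero_le_two).trans ?_
          refine (sq_lintegral_le hm'.aemeasurable).trans (le_of_eq ?_)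
          refine lintegral_congr fun y => ?_
          rw [enorm_sub_rev]
      _ = ∫⁻ y, (∫⁻ x, ‖w (x - y) - w x‖ₑ ^ (2 : ℝ)) ∂ballMeasure N ε :=
          lintegral_lintegral_swap (Measurable.aemeasurable (by fun_prop))
      _ ≤ ∫⁻ y, (ENNReal.ofReal ε * eLpNorm Dw 2 volume) ^ (2 : ℝ) ∂ballMeasure N ε := by
          refine lintegral_mono_ae ?_
          have : ∀ᵐ y ∂ballMeasure N ε, y ∈ ball (0 : Space N) ε :=
            (Measure.smul_absolutelyContinuous (c := (volume (ball (0 : Space N) ε))⁻¹)).ae_le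
              (ae_restrict_mem measurableSet_ball)
          filter_upwards [this] with y hy
          rw [← eLpNorm_two_rpow]
          refine ENNReal.rpow_le_rpow ?_ zero_le_two
          have := h.eLpNorm_translate_sub_le (-y)
          simp only [← sub_eq_add_neg] at this
          refine this.trans ?_
          gcongr
          simpa using (mem_ball_zero_iff.1 hy).le
      _ = _ := by simp
  rw [← eLpNorm_two_rpow] at hsq
  exact (ENNReal.rpow_le_rpow_iff zero_lt_two).1 hsq

/-- A bounded sequence of radial `H¹` functions converging weakly to zero in `L²` converges to zero
in measure. -/
theorem tendsto_measure_of_radial (hN : 2 ≤ N) {w : ℕ → Space N → ℝ} {Dw : ℕ → Space N → Space N}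
    (h : ∀ n, IsH1With (w n) (Dw n)) (hr : ∀ n, Radial (w n)) {B : ℝ≥0}
    (hB : ∀ n, eLpNorm (w n) 2 volume ≤ B) (hDB : ∀ n, eLpNorm (Dw n) 2 volume ≤ B)
    (hweak : ∀ φ : Space N → ℝ, MemLp φ 2 volume →
      Tendsto (fun n => ∫ x, w n x * φ x) atTop (𝓝 0)) {δ : ℝ} (hδ : 0 < δ) :
    Tendsto (fun n => volume {x | δ ≤ |w n x|}) atTop (𝓝 0) := by
  wlog hs : ∀ n, StronglyMeasurable (w n) generalizing w Dw
  · choose v Dv e1 e2 e3 e4 e5 using fun n => (h n).exists_stronglyMeasurable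
    have := this e5 (fun n => (hr n).congr (e1 n)) (fun n => by rw [← eLpNorm_congr_ae (e1 n)]; exact hB n)
      (fun n => by rw [← eLpNorm_congr_ae (e2 n)]; exact hDB n) (fun φ hφ => by
        refine (hweak φ hφ).congr fun n => integral_congr_ae ?_
        filter_upwards [e1 n] with x hx; rw [hx]) e3
    refine this.congr fun n => measure_congr ?_
    filter_upwards [e1 n] with x hx
    change (δ ≤ |v n x|) = (δ ≤ |w n x|)
    rw [hx]
  -- Compare w n with its average over balls of radius ε. The difference is small in L², uniformly
  -- in n, and is controlled by Chebyshev. Far from the origin radiality makes the average uniformly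
  -- small. On the remaining bounded ball the average tends to zero pointwise, hence in measure.
  rw [ENNReal.tendsto_nhds_zero]
  intro θ hθ
  obtain ⟨r, hr0, hrθ⟩ := ENNReal.lt_iff_exists_nnreal_btwn.1 hθ
  have hr0 : (0 : ℝ) < r := by exact_mod_cast hr0
  -- the averaging scale
  obtain ⟨ε, hε, hεr⟩ : ∃ ε : ℝ, 0 < ε ∧ (2 * ε * B / δ) ^ 2 ≤ r / 2 := by
    have hc : Tendsto (fun ε : ℝ => (2 * ε * B / δ) ^ 2) (𝓝[>] 0) (𝓝 ((2 * 0 * B / δ) ^ 2)) :=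
      (Continuous.tendsto (by fun_prop) 0).mono_left nhdsWithin_le_nhds
    have h0 : (2 * 0 * (B : ℝ) / δ) ^ 2 < r / 2 := by
      simpa using hr0
    obtain ⟨ε, h1, h2⟩ := ((hc.eventually (gt_mem_nhds h0)).and self_mem_nhdsWithin).exists
    exact ⟨ε, h2, h1.le⟩
  set c : ℝ≥0∞ := (volume (ball (0 : Space N) ε))⁻¹ with hc
  have hctop : c ≠ ⊤ := ENNReal.inv_ne_top.2 (measure_ball_pos _ _ hε).ne'
  -- An average of size at least δ/2 at a far point would repeat on k disjoint balls and force
  -- k(δ/2)² ≤ cB².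
  obtain ⟨k, hk⟩ : ∃ k : ℕ, c.toReal * (B : ℝ) ^ 2 / (δ / 2) ^ 2 < k := exists_nat_gt _
  obtain ⟨R, hR⟩ := Radial.mul_lintegral_ball_le hN k ε
  have hfar : ∀ n x, R ≤ ‖x‖ → |ballAverage ε (w n) x| < δ / 2 := by
    intro n x hx
    by_contra hcon
    rw [not_lt] at hcon
    have h1 : ENNReal.ofReal ((δ / 2) ^ 2) ≤ c * ∫⁻ y in ball x ε, ‖w n y‖ₑ ^ (2 : ℝ) := by
      refine le_trans ?_ (enorm_ballAverage_sq_le hε (hs n) x)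
      rw [← ofReal_norm, ENNReal.ofReal_rpow_of_nonneg (norm_nonneg _) zero_le_two, Real.rpow_two]
      gcongr
      exact hcon
    have h2 : ENNReal.ofReal (k * (δ / 2) ^ 2) ≤ ENNReal.ofReal (c.toReal * B ^ 2) := by
      calc ENNReal.ofReal (k * (δ / 2) ^ 2) = k * ENNReal.ofReal ((δ / 2) ^ 2) := by
            rw [ENNReal.ofReal_mul (by positivity), ENNReal.ofReal_natCast]
        _ ≤ k * (c * ∫⁻ y in ball x ε, ‖w n y‖ₑ ^ (2 : ℝ)) := mul_le_mul_right h1 _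
        _ = c * (k * ∫⁻ y in ball x ε, ‖w n y‖ₑ ^ (2 : ℝ)) := by ring
        _ ≤ c * ∫⁻ y, ‖w n y‖ₑ ^ (2 : ℝ) := mul_le_mul_right (hR x hx _ (hr n)) _
        _ ≤ c * (B : ℝ≥0∞) ^ (2 : ℝ) := by
            rw [← eLpNorm_two_rpow]
            exact mul_le_mul_right (ENNReal.rpow_le_rpow (hB n) zero_le_two) _
        _ = _ := by
            rw [ENNReal.ofReal_mul ENNReal.toReal_nonneg, ENNReal.ofReal_toReal hctop,
              ENNReal.ofReal_pow (by positivity), ENNReal.ofReal_coe_nnreal, ENNReal.rpow_two]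
    rw [ENNReal.ofReal_le_ofReal_iff (by positivity)] at h2
    rw [div_lt_iff₀ (by positivity)] at hk
    linarith
  have hpt : ∀ x, Tendsto (fun n => ballAverage ε (w n) x) atTop (𝓝 0) := fun x => by
    have hm : MemLp ((ball x ε).indicator fun _ => (1 : ℝ)) 2 volume :=
      memLp_indicator_const _ measurableSet_ball 1 (Or.inr measure_ball_lt_top.ne)
    have := (hweak _ hm).const_mul c.toReal
    rw [mul_zero] at this
    simpa only [ballAverage_eq] using this
  have hin : Tendsto (fun n => volume.restrict (ball (0 : Space N) R)
      {x | δ / 2 ≤ |ballAverage ε (w n) x|}) atTop (𝓝 0) := by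
    have : IsFiniteMeasure (volume.restrict (ball (0 : Space N) R)) :=
      ⟨by simpa using measure_ball_lt_top⟩
    have := tendstoInMeasure_of_tendsto_ae (μ := volume.restrict (ball (0 : Space N) R))
      (fun n => (stronglyMeasurable_ballAverage hε (hs n)).aestronglyMeasurable)
      (ae_of_all _ hpt)
    rw [tendstoInMeasure_iff_norm] at this
    simpa using this (δ / 2) (by positivity)
  filter_upwards [hin.eventually (gt_mem_nhds (ENNReal.ofReal_pos.2 (half_pos hr0)))] with n hn
  have hsub : {x | δ ≤ |w n x|} ⊆ {x | δ / 2 ≤ |w n x - ballAverage ε (w n) x|} ∪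
      ({x | δ / 2 ≤ |ballAverage ε (w n) x|} ∩ ball 0 R) := by
    intro x hx
    by_cases h1 : δ / 2 ≤ |ballAverage ε (w n) x|
    · refine Or.inr ⟨h1, ?_⟩
      rw [mem_ball_zero_iff]
      by_contra h2
      exact absurd (hfar n x (not_lt.1 h2)) (not_lt.2 h1)
    · left
      have hx : δ ≤ |w n x| := hx
      have := abs_sub_abs_le_abs_sub (w n x) (ballAverage ε (w n) x)
      change δ / 2 ≤ _
      linarith
  have hcheb : volume {x | δ / 2 ≤ |w n x - ballAverage ε (w n) x|} ≤ ENNReal.ofReal (r / 2) := by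
    have h1 := mul_meas_ge_le_pow_eLpNorm' (p := 2) volume two_ne_zero ENNReal.ofNat_ne_top
      ((hs n).sub (stronglyMeasurable_ballAverage hε (hs n))).aestronglyMeasurable
      (ENNReal.ofReal (δ / 2))
    have h2 : {x | ENNReal.ofReal (δ / 2) ≤ ‖(w n - ballAverage ε (w n)) x‖ₑ} =
        {x | δ / 2 ≤ |w n x - ballAverage ε (w n) x|} := by
      ext x
      simp only [mem_ofPred_eq, Pi.sub_apply]
      rw [← ofReal_norm, ENNReal.ofReal_le_ofReal_iff (norm_nonneg _), Real.norm_eq_abs]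
    have h3 : eLpNorm (w n - ballAverage ε (w n)) 2 volume ≤ ENNReal.ofReal (ε * B) := by
      refine ((h n).eLpNorm_sub_ballAverage_le hε (hs n)).trans ?_
      grw [hDB n]
      rw [ENNReal.ofReal_mul hε.le, ENNReal.ofReal_coe_nnreal]
    grw [h2, h3] at h1
    rw [ENNReal.toReal_ofNat, ENNReal.ofReal_rpow_of_nonneg (by positivity) zero_le_two,
      ENNReal.ofReal_rpow_of_nonneg (by positivity) zero_le_two, mul_comm,
      ← ENNReal.le_div_iff_mul_le (by left; simpa using hδ.ne') (by left; simp),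
      ← ENNReal.ofReal_div_of_pos (by positivity), ← Real.div_rpow (by positivity) (by positivity),
      Real.rpow_two] at h1
    refine h1.trans (ENNReal.ofReal_le_ofReal (le_trans (le_of_eq ?_) hεr))
    congr 1
    field_simp
  calc volume {x | δ ≤ |w n x|} ≤ _ := measure_mono hsub
    _ ≤ _ := measure_union_le _ _
    _ ≤ ENNReal.ofReal (r / 2) + ENNReal.ofReal (r / 2) := by
        refine add_le_add hcheb ?_
        rw [Measure.restrict_apply' measurableSet_ball] at hn
        exact hn.le
    _ = r := by
        rw [← ENNReal.ofReal_add (by positivity) (by positivity), add_halves,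
          ENNReal.ofReal_coe_nnreal]
    _ ≤ θ := hrθ.le

end Choquard

end

/-! ### H¹ as a Hilbert space: weak limits and Riesz representation. -/

noncomputable section

namespace Choquard

open scoped ENNReal NNReal
open Set Metric

/-- Sequential Banach–Alaoglu in the dual, transported by the Riesz isomorphism. -/
theorem exists_weakly_convergent_subseq {H : Type*} [NormedAddCommGroup H] [InnerProductSpace ℝ H]
    [CompleteSpace H] [TopologicalSpace.SeparableSpace H] {U : ℕ → H} {B : ℝ}
    (hU : ∀ n, ‖U n‖ ≤ B) : ∃ (U₀ : H) (k : ℕ → ℕ), StrictMono k ∧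
      ∀ V : H, Tendsto (fun n => inner ℝ (U (k n)) V) atTop (𝓝 (inner ℝ U₀ V)) := by
  let x : ℕ → WeakDual ℝ H := fun n => StrongDual.toWeakDual (InnerProductSpace.toDual ℝ H (U n))
  have hx : ∀ n, x n ∈ WeakDual.toStrongDual ⁻¹' closedBall (0 : StrongDual ℝ H) B := fun n => by
    simpa [x] using hU n
  obtain ⟨f, -, k, hk, hlim⟩ := WeakDual.isSeqCompact_closedBall ℝ H 0 B hx
  refine ⟨(InnerProductSpace.toDual ℝ H).symm (WeakDual.toStrongDual f), k, hk, fun V => ?_⟩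
  have := ((WeakDual.eval_continuous V).tendsto f).comp hlim
  rw [InnerProductSpace.toDual_symm_apply]
  exact this

variable {N : ℕ}

/-- The Hilbert space `L²(ℝ^N) × L²(ℝ^N; ℝ^N)`. -/
abbrev PairL2 (N : ℕ) : Type :=
  WithLp 2 (Lp ℝ 2 (volume : Measure (Space N)) × Lp (Space N) 2 (volume : Measure (Space N)))

/-- The element of `PairL2` given by two square integrable functions. -/
def pairL2 {u : Space N → ℝ} {Du : Space N → Space N} (hu : MemLp u 2 volume)
    (hDu : MemLp Du 2 volume) : PairL2 N := WithLp.toLp 2 (hu.toLp u, hDu.toLp Du)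

theorem inner_pairL2 (U V : PairL2 N) : inner ℝ U V =
    (∫ x, inner ℝ (U.snd x) (V.snd x)) + ∫ x, U.fst x * V.fst x := by
  rw [WithLp.prod_inner_apply, L2.inner_def, L2.inner_def, add_comm]
  congr 2
  ext x
  rw [RCLike.inner_apply, conj_trivial, mul_comm]
  rfl

theorem inner_pairL2_mk {u v : Space N → ℝ} {Du Dv : Space N → Space N} (hu : MemLp u 2 volume)
    (hDu : MemLp Du 2 volume) (hv : MemLp v 2 volume) (hDv : MemLp Dv 2 volume) :
    inner ℝ (pairL2 hu hDu) (pairL2 hv hDv) =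
      (∫ x, inner ℝ (Du x) (Dv x)) + ∫ x, u x * v x := by
  rw [inner_pairL2]
  congr 1 <;> refine integral_congr_ae ?_
  · filter_upwards [hDu.coeFn_toLp, hDv.coeFn_toLp] with x h1 h2
    simp only [pairL2, WithLp.toLp_snd] at *
    rw [h1, h2]
  · filter_upwards [hu.coeFn_toLp, hv.coeFn_toLp] with x h1 h2
    simp only [pairL2, WithLp.toLp_fst] at *
    rw [h1, h2]

theorem memLp_test_deriv {φ : Space N → ℝ} (hφ : ContDiff ℝ ∞ φ) (hφc : HasCompactSupport φ)
    (v : Space N) : MemLp (fun x => fderiv ℝ φ x v) 2 volume := by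
  have hd : Continuous (fderiv ℝ φ) := hφ.continuous_fderiv (by simp)
  exact Continuous.memLp_of_hasCompactSupport (by fun_prop)
    ((hφc.fderiv ℝ).comp_left (g := fun L : Space N →L[ℝ] ℝ => L v) rfl)

theorem memLp_test_smul {φ : Space N → ℝ} (hφ : ContDiff ℝ ∞ φ) (hφc : HasCompactSupport φ)
    (v : Space N) : MemLp (fun x => φ x • v) 2 volume := by
  have := hφ.continuous
  exact Continuous.memLp_of_hasCompactSupport (by fun_prop) hφc.smul_right

/-- The pairs whose orthogonal complement is the graph of the weak gradient. -/
def testPairs (N : ℕ) : Set (PairL2 N) :=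
  {V | ∃ (φ : Space N → ℝ) (hφ : ContDiff ℝ ∞ φ) (hφc : HasCompactSupport φ) (i : Fin N),
    V = pairL2 (memLp_test_deriv hφ hφc (EuclideanSpace.single i 1))
      (memLp_test_smul hφ hφc (EuclideanSpace.single i 1))}

/-- The Sobolev space `H¹` as a closed subspace of `L² × L²`. -/
def sobolevSpace (N : ℕ) : Submodule ℝ (PairL2 N) := (Submodule.span ℝ (testPairs N))ᗮ

/-- Orthogonality to the pair (∂ᵢφ, φeᵢ) is exactly the defining integration by parts. Being an
orthogonal complement, H¹ is complete and weakly closed at no further cost. -/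
theorem pairL2_mem_iff {u : Space N → ℝ} {Du : Space N → Space N} (hu : MemLp u 2 volume)
    (hDu : MemLp Du 2 volume) : pairL2 hu hDu ∈ sobolevSpace N ↔ IsH1With u Du := by
  rw [sobolevSpace, Submodule.mem_orthogonal]
  have key : ∀ φ : Space N → ℝ, ∀ hφ : ContDiff ℝ ∞ φ, ∀ hφc : HasCompactSupport φ, ∀ i : Fin N,
      inner ℝ (pairL2 (memLp_test_deriv hφ hφc (EuclideanSpace.single i 1))
        (memLp_test_smul hφ hφc (EuclideanSpace.single i 1))) (pairL2 hu hDu) =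
      (∫ x, Du x i * φ x) + ∫ x, u x * fderiv ℝ φ x (EuclideanSpace.single i 1) := by
    intro φ hφ hφc i
    rw [inner_pairL2_mk]
    congr 2 <;> ext x
    · simp [inner_smul_left, mul_comm, EuclideanSpace.inner_single_left]
    · ring
  constructor
  · intro h
    refine ⟨hu, hDu, fun φ hφ hφc i => ?_⟩
    have := h _ (Submodule.subset_span ⟨φ, hφ, hφc, i, rfl⟩)
    rw [key φ hφ hφc i] at this
    linarith
  · intro h V hV
    induction hV using Submodule.span_induction with
    | mem V hV =>
      obtain ⟨φ, hφ, hφc, i, rfl⟩ := hV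
      rw [key φ hφ hφc i, h.hasWeakGradient φ hφ hφc i]
      ring
    | zero => simp
    | add x y _ _ hx hy => rw [inner_add_left, hx, hy, add_zero]
    | smul c x _ hx => rw [inner_smul_left, hx, mul_zero]

theorem pairL2_coe (U : PairL2 N) : pairL2 (Lp.memLp U.fst) (Lp.memLp U.snd) = U := by
  rw [pairL2, Lp.toLp_coeFn, Lp.toLp_coeFn]
  rfl

theorem isH1With_of_mem {U : PairL2 N} (hU : U ∈ sobolevSpace N) : IsH1With U.fst U.snd := by
  rw [← pairL2_mem_iff (Lp.memLp U.fst) (Lp.memLp U.snd), pairL2_coe]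
  exact hU

/-- Riesz representation in `H¹`. -/
theorem exists_riesz_representer (ℓ : (Space N → ℝ) → (Space N → Space N) → ℝ)
    (hcongr : ∀ u v Du Dv, IsH1With u Du → u =ᵐ[volume] v → Du =ᵐ[volume] Dv → ℓ u Du = ℓ v Dv)
    (hadd : ∀ u v Du Dv, IsH1With u Du → IsH1With v Dv →
      ℓ (fun x => u x + v x) (fun x => Du x + Dv x) = ℓ u Du + ℓ v Dv)
    (hsmul : ∀ (c : ℝ) u Du, IsH1With u Du →
      ℓ (fun x => c * u x) (fun x => c • Du x) = c * ℓ u Du)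
    {K : ℝ} (hK : ∀ u Du, IsH1With u Du → eLpNorm u 2 volume ≤ 1 → eLpNorm Du 2 volume ≤ 1 →
      |ℓ u Du| ≤ K) :
    ∃ w Dw, IsH1With w Dw ∧ ∀ v Dv, IsH1With v Dv →
      ℓ v Dv = (∫ x, inner ℝ (Dw x) (Dv x)) + ∫ x, w x * v x := by
  have hfst : ∀ U : PairL2 N, ‖U.fst‖ ≤ ‖U‖ := fun U => WithLp.norm_fst_le _ _
  have hsnd : ∀ U : PairL2 N, ‖U.snd‖ ≤ ‖U‖ := fun U => WithLp.norm_snd_le _ _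
  let L : sobolevSpace N →ₗ[ℝ] ℝ :=
    { toFun := fun U => ℓ U.1.fst U.1.snd
      map_add' := fun U V => by
        rw [← hadd _ _ _ _ (isH1With_of_mem U.2) (isH1With_of_mem V.2)]
        exact hcongr _ _ _ _ (isH1With_of_mem (U + V).2) (Lp.coeFn_add _ _) (Lp.coeFn_add _ _)
      map_smul' := fun c U => by
        rw [RingHom.id_apply, smul_eq_mul, ← hsmul c _ _ (isH1With_of_mem U.2)]
        exact hcongr _ _ _ _ (isH1With_of_mem (c • U).2) (Lp.coeFn_smul _ _) (Lp.coeFn_smul _ _) }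
  have hbd : ∀ U : sobolevSpace N, ‖L U‖ ≤ K * ‖U‖ := by
    intro U
    rcases eq_or_ne U 0 with rfl | hU
    · simp
    have hn : 0 < ‖U‖ := norm_pos_iff.2 hU
    set V : sobolevSpace N := ‖U‖⁻¹ • U
    have hV : ‖V.1‖ = 1 := by
      change ‖V‖ = 1
      rw [norm_smul, norm_inv, norm_norm, inv_mul_cancel₀ hn.ne']
    have e : ∀ {G : Type} [NormedAddCommGroup G] (f : Lp G 2 (volume : Measure (Space N))),
        ‖f‖ ≤ 1 → eLpNorm f 2 volume ≤ 1 := fun f hf => by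
      rw [← Lp.enorm_def, ← ofReal_norm]
      exact ENNReal.ofReal_le_one.2 hf
    have h1 : |L V| ≤ K := hK _ _ (isH1With_of_mem V.2) (e _ ((hfst _).trans_eq hV))
      (e _ ((hsnd _).trans_eq hV))
    have h2 : U = ‖U‖ • V := by
      simp only [V]
      rw [smul_smul, mul_inv_cancel₀ hn.ne', one_smul]
    rw [h2, map_smul, norm_smul, norm_norm, norm_smul, norm_norm]
    have : ‖V‖ = 1 := hV
    rw [this, mul_one, mul_comm]
    gcongr
    exact h1
  let L' : StrongDual ℝ (sobolevSpace N) := L.mkContinuous K hbd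
  have : CompleteSpace (sobolevSpace N) := by
    unfold sobolevSpace; infer_instance
  set W : sobolevSpace N := (InnerProductSpace.toDual ℝ (sobolevSpace N)).symm L'
  refine ⟨W.1.fst, W.1.snd, isH1With_of_mem W.2, fun v Dv hv => ?_⟩
  let V : sobolevSpace N := ⟨pairL2 hv.memLp hv.memLp_grad, (pairL2_mem_iff _ _).2 hv⟩
  have h1 : L' V = inner ℝ W V := (InnerProductSpace.toDual_symm_apply).symm
  have h2 : L' V = ℓ v Dv :=
    hcongr _ _ _ _ (isH1With_of_mem V.2) hv.memLp.coeFn_toLp hv.memLp_grad.coeFn_toLp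
  rw [← h2, h1, Submodule.coe_inner, ← inner_pairL2_mk (Lp.memLp W.1.fst) (Lp.memLp W.1.snd)
    hv.memLp hv.memLp_grad, pairL2_coe]

theorem IsH1With.add {u v : Space N → ℝ} {Du Dv : Space N → Space N} (hu : IsH1With u Du)
    (hv : IsH1With v Dv) : IsH1With (fun x => u x + v x) (fun x => Du x + Dv x) := by
  have h := (sobolevSpace N).add_mem ((pairL2_mem_iff hu.memLp hu.memLp_grad).2 hu)
    ((pairL2_mem_iff hv.memLp hv.memLp_grad).2 hv)
  exact (pairL2_mem_iff (hu.memLp.add hv.memLp) (hu.memLp_grad.add hv.memLp_grad)).1 h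

theorem IsH1With.const_smul {u : Space N → ℝ} {Du : Space N → Space N} (hu : IsH1With u Du)
    (c : ℝ) : IsH1With (fun x => c * u x) (fun x => c • Du x) := by
  have h := (sobolevSpace N).smul_mem c ((pairL2_mem_iff hu.memLp hu.memLp_grad).2 hu)
  exact (pairL2_mem_iff (hu.memLp.const_mul c) (hu.memLp_grad.const_smul c)).1 h

theorem IsH1With.sub {u v : Space N → ℝ} {Du Dv : Space N → Space N} (hu : IsH1With u Du)
    (hv : IsH1With v Dv) : IsH1With (fun x => u x - v x) (fun x => Du x - Dv x) := by
  refine (hu.add (hv.const_smul (-1))).congr ?_ ?_ <;> refine ae_of_all _ fun x => ?_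
  · simp only; ring
  · simp [sub_eq_add_neg]

theorem exists_weak_limit {u : ℕ → Space N → ℝ} {Du : ℕ → Space N → Space N}
    (h : ∀ n, IsH1With (u n) (Du n)) {B : ℝ≥0} (hB : ∀ n, eLpNorm (u n) 2 volume ≤ B)
    (hDB : ∀ n, eLpNorm (Du n) 2 volume ≤ B) :
    ∃ (v : Space N → ℝ) (Dv : Space N → Space N) (k : ℕ → ℕ), StrictMono k ∧ IsH1With v Dv ∧
      (∀ φ : Space N → ℝ, MemLp φ 2 volume →
        Tendsto (fun n => ∫ x, u (k n) x * φ x) atTop (𝓝 (∫ x, v x * φ x))) ∧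
      ∀ Φ : Space N → Space N, MemLp Φ 2 volume →
        Tendsto (fun n => ∫ x, inner ℝ (Du (k n) x) (Φ x)) atTop
          (𝓝 (∫ x, inner ℝ (Dv x) (Φ x))) := by
  let U : ℕ → PairL2 N := fun n => pairL2 (h n).memLp (h n).memLp_grad
  have hU : ∀ n, ‖U n‖ ≤ B + B := fun n => by
    have e1 : ‖(U n).fst‖ ≤ B := by
      refine (Lp.norm_toLp _ (h n).memLp).trans_le (ENNReal.toReal_le_coe_of_le_coe (hB n))
    have e2 : ‖(U n).snd‖ ≤ B := by
      refine (Lp.norm_toLp _ (h n).memLp_grad).trans_le (ENNReal.toReal_le_coe_of_le_coe (hDB n))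
    have := WithLp.prod_norm_sq_eq_of_L2 (U n)
    refine abs_le_of_sq_le_sq' ?_ (by positivity) |>.2
    nlinarith [norm_nonneg (U n).fst, norm_nonneg (U n).snd]
  have : Fact ((2 : ℝ≥0∞) ≠ ⊤) := ⟨by simp⟩
  have : SecondCountableTopology (Lp ℝ 2 (volume : Measure (Space N))) := inferInstance
  have : SecondCountableTopology (Lp (Space N) 2 (volume : Measure (Space N))) := inferInstance
  have : SecondCountableTopology (PairL2 N) := WithLp.secondCountableTopology 2 _ _
  obtain ⟨V, k, hk, hlim⟩ := exists_weakly_convergent_subseq hU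
  have hV : V ∈ sobolevSpace N := by
    rw [sobolevSpace, Submodule.mem_orthogonal]
    intro W hW
    have h0 : ∀ n, inner ℝ (U (k n)) W = 0 := fun n => by
      rw [real_inner_comm]
      exact (Submodule.mem_orthogonal _ _).1
        ((pairL2_mem_iff (h (k n)).memLp (h (k n)).memLp_grad).2 (h (k n))) W hW
    have := hlim W
    simp only [h0] at this
    rw [real_inner_comm]
    exact tendsto_nhds_unique this tendsto_const_nhds
  have hlim' : ∀ (φ : Space N → ℝ) (Φ : Space N → Space N) (hφ : MemLp φ 2 volume)
      (hΦ : MemLp Φ 2 volume), Tendsto (fun n => (∫ x, inner ℝ (Du (k n) x) (Φ x)) +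
        ∫ x, u (k n) x * φ x) atTop (𝓝 ((∫ x, inner ℝ (V.snd x) (Φ x)) +
        ∫ x, V.fst x * φ x)) := by
    intro φ Φ hφ hΦ
    have := hlim (pairL2 hφ hΦ)
    rw [← pairL2_coe V, inner_pairL2_mk] at this
    simpa only [U, inner_pairL2_mk] using this
  refine ⟨V.fst, V.snd, k, hk, isH1With_of_mem hV, fun φ hφ => ?_, fun Φ hΦ => ?_⟩
  · simpa using hlim' φ (fun _ => 0) hφ (MemLp.zero' (p := 2))
  · simpa using hlim' (fun _ => 0) Φ (MemLp.zero' (p := 2)) hΦ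

/-- Both v ∘ g and v have the same pairing with every L² function; pairing with their difference
gives equality. -/
theorem Radial.of_weak_limit {u : ℕ → Space N → ℝ} {v : Space N → ℝ} (hu : ∀ n, Radial (u n))
    (hv : MemLp v 2 volume)
    (h : ∀ φ : Space N → ℝ, MemLp φ 2 volume →
      Tendsto (fun n => ∫ x, u n x * φ x) atTop (𝓝 (∫ x, v x * φ x))) : Radial v := by
  intro g
  have hvg : MemLp (fun x => v (g x)) 2 volume := hv.comp_measurePreserving g.measurePreserving
  have key : ∀ φ : Space N → ℝ, MemLp φ 2 volume → ∫ x, v (g x) * φ x = ∫ x, v x * φ x := by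
    intro φ hφ
    have hφg : MemLp (fun x => φ (g.symm x)) 2 volume :=
      hφ.comp_measurePreserving g.symm.measurePreserving
    have e : ∀ w : Space N → ℝ, ∫ x, w (g x) * φ x = ∫ x, w x * φ (g.symm x) := fun w => by
      rw [← integral_comp_isometry g fun x => w x * φ (g.symm x)]
      simp
    rw [e]
    refine tendsto_nhds_unique (h _ hφg) ((h φ hφ).congr fun n => ?_)
    rw [← e]
    refine integral_congr_ae ?_
    filter_upwards [hu n g] with x hx
    rw [hx]
  have hd := hvg.sub hv
  have h0 : ∫ x, (v (g x) - v x) * (v (g x) - v x) = 0 := by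
    have i1 := hvg.integrable_mul hd
    have i2 := hv.integrable_mul hd
    have := sub_eq_zero.2 (key _ hd)
    refine Eq.trans ?_ ((integral_sub i1 i2).trans this)
    congr 1; ext x
    simp only [Pi.sub_apply, Pi.mul_apply]; ring
  have := (integral_eq_zero_iff_of_nonneg (fun x => mul_self_nonneg _)
    (hd.integrable_mul hd)).1 h0
  filter_upwards [this] with x hx
  exact sub_eq_zero.1 (mul_self_eq_zero.1 hx)

end Choquard

end

/-! ### Quadratic forms: expansion, lower semicontinuity, weak continuity. -/

noncomputable section

namespace Choquard

open scoped ENNReal NNReal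
open Set Metric

section FracForm

variable {N : ℕ} [NeZero N]

theorem fracConst_nonneg (N : ℕ) [NeZero N] (s : ℝ) : 0 ≤ fracConst N s :=
  inv_nonneg.2 (integral_nonneg fun _ =>
    div_nonneg (sub_nonneg.2 (Real.cos_le_one _)) (Real.rpow_nonneg (norm_nonneg _) _))

theorem fracForm_comm (s : ℝ) (u v : Space N → ℝ) : fracForm s u v = fracForm s v u := by
  simp only [fracForm, gagliardoIntegrand, mul_comm (u _ - u _)]

theorem fracForm_self_nonneg (s : ℝ) (u : Space N → ℝ) : 0 ≤ fracForm s u u := by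
  refine mul_nonneg (by have := fracConst_nonneg N s; positivity) (integral_nonneg fun p => ?_)
  rw [gagliardoIntegrand_eq]
  exact mul_self_nonneg _

theorem fracForm_smul_right (s c : ℝ) (u v : Space N → ℝ) :
    fracForm s u (fun x => c * v x) = c * fracForm s u v := by
  have : ∀ p, gagliardoIntegrand s u (fun x => c * v x) p = c * gagliardoIntegrand s u v p :=
    fun p => by simp only [gagliardoIntegrand]; ring
  simp only [fracForm, this, integral_const_mul]
  ring

theorem fracForm_add_right (hN : 1 ≤ N) {s : ℝ} (hs : s ∈ Ioo (0 : ℝ) 1) {u v w : Space N → ℝ}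
    {Du Dv Dw : Space N → Space N} (hu : IsH1With u Du) (hv : IsH1With v Dv)
    (hw : IsH1With w Dw) :
    fracForm s u (fun x => v x + w x) = fracForm s u v + fracForm s u w := by
  rw [fracForm, fracForm, fracForm, ← mul_add, ← integral_add
    (hu.integrable_gagliardoIntegrand hN hs hv) (hu.integrable_gagliardoIntegrand hN hs hw)]
  congr 2; ext p
  simp only [gagliardoIntegrand]; ring

theorem fracForm_add_smul_self (hN : 1 ≤ N) {s : ℝ} (hs : s ∈ Ioo (0 : ℝ) 1) {u v : Space N → ℝ}
    {Du Dv : Space N → Space N} (hu : IsH1With u Du) (hv : IsH1With v Dv) (ε : ℝ) :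
    fracForm s (fun x => u x + ε * v x) (fun x => u x + ε * v x) =
      fracForm s u u + 2 * ε * fracForm s u v + ε ^ 2 * fracForm s v v := by
  rw [fracForm_add_right hN hs (hu.add (hv.const_smul ε)) hu (hv.const_smul ε),
    fracForm_smul_right, fracForm_comm, fracForm_comm s _ v,
    fracForm_add_right hN hs hu hu (hv.const_smul ε),
    fracForm_add_right hN hs hv hu (hv.const_smul ε), fracForm_smul_right, fracForm_smul_right,
    fracForm_comm s v u]
  ring

/-- The form is nonnegative at u − v. The left side is affine in u and passes to weak limits, so
this inequality does the work of weak lower semicontinuity. -/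
theorem fracForm_two_mul_sub_le (hN : 1 ≤ N) {s : ℝ} (hs : s ∈ Ioo (0 : ℝ) 1)
    {u v : Space N → ℝ} {Du Dv : Space N → Space N} (hu : IsH1With u Du) (hv : IsH1With v Dv) :
    2 * fracForm s u v - fracForm s v v ≤ fracForm s u u := by
  have h := fracForm_add_smul_self hN hs hu hv (-1)
  have := fracForm_self_nonneg s fun x => u x + -1 * v x
  linarith

theorem exists_abs_fracForm_le (hN : 1 ≤ N) {s : ℝ} (hs : s ∈ Ioo (0 : ℝ) 1) {u : Space N → ℝ}
    {Du : Space N → Space N} (hu : IsH1With u Du) : ∃ K : ℝ, ∀ v Dv, IsH1With v Dv →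
      eLpNorm v 2 volume ≤ 1 → eLpNorm Dv 2 volume ≤ 1 → |fracForm s u v| ≤ K := by
  obtain ⟨C, hC, hb⟩ := gagliardo_bound hN hs
  set Q : ℝ := ∫ p, gagliardoQuotient s u p * gagliardoQuotient s u p
  refine ⟨fracConst N s / 2 * (Q + C * 2), fun v Dv hv h1 h2 => ?_⟩
  have hc := fracConst_nonneg N s
  rw [fracForm, abs_mul, abs_of_nonneg (by positivity)]
  refine mul_le_mul_of_nonneg_left ?_ (by positivity)
  have mu := hu.memLp_gagliardoQuotient hN hs
  have mv := hv.memLp_gagliardoQuotient hN hs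
  have iu : Integrable fun p => gagliardoQuotient s u p * gagliardoQuotient s u p :=
    mu.integrable_mul mu
  have iv : Integrable fun p => gagliardoQuotient s v p * gagliardoQuotient s v p :=
    mv.integrable_mul mv
  have hQv : ∫ p, gagliardoQuotient s v p * gagliardoQuotient s v p ≤ C * 2 := by
    rw [integral_eq_lintegral_of_nonneg_ae (ae_of_all _ fun p => mul_self_nonneg _) iv.1]
    refine ENNReal.toReal_le_of_le_ofReal (by positivity) ?_
    have e : ∀ p, ENNReal.ofReal (gagliardoQuotient s v p * gagliardoQuotient s v p) =
        ‖gagliardoQuotient s v p‖ₑ ^ (2 : ℝ) := fun p => by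
      rw [← ofReal_norm, ENNReal.ofReal_rpow_of_nonneg (norm_nonneg _) zero_le_two, Real.rpow_two,
        Real.norm_eq_abs, sq_abs, sq]
    simp only [e]
    refine (hb v Dv hv).trans ?_
    rw [ENNReal.ofReal_mul hC]
    refine mul_le_mul_right ?_ _
    calc _ ≤ (1 : ℝ≥0∞) ^ (2 : ℝ) + 1 ^ (2 : ℝ) := by gcongr
      _ = _ := by simp [one_add_one_eq_two]
  calc |∫ p, gagliardoIntegrand s u v p| ≤ ∫ p, |gagliardoIntegrand s u v p| :=
        abs_integral_le_integral_abs
    _ ≤ ∫ p, (gagliardoQuotient s u p * gagliardoQuotient s u p +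
          gagliardoQuotient s v p * gagliardoQuotient s v p) := by
        refine integral_mono_of_nonneg (ae_of_all _ fun p => abs_nonneg _) (iu.add iv)
          (ae_of_all _ fun p => ?_)
        simp only [gagliardoIntegrand_eq]
        rw [abs_le]
        constructor <;>
          nlinarith [sq_nonneg (gagliardoQuotient s u p + gagliardoQuotient s v p),
            sq_nonneg (gagliardoQuotient s u p - gagliardoQuotient s v p)]
    _ = Q + ∫ p, gagliardoQuotient s v p * gagliardoQuotient s v p := integral_add iu iv
    _ ≤ _ := by linarith

/-- The fractional form is continuous along weakly convergent sequences. -/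
theorem tendsto_fracForm (hN : 1 ≤ N) {s : ℝ} (hs : s ∈ Ioo (0 : ℝ) 1) {u : ℕ → Space N → ℝ}
    {Du : ℕ → Space N → Space N} {v w : Space N → ℝ} {Dv Dw : Space N → Space N}
    (hu : ∀ n, IsH1With (u n) (Du n)) (hv : IsH1With v Dv) (hw : IsH1With w Dw)
    (h : ∀ φ : Space N → ℝ, MemLp φ 2 volume →
      Tendsto (fun n => ∫ x, u n x * φ x) atTop (𝓝 (∫ x, v x * φ x)))
    (hD : ∀ Φ : Space N → Space N, MemLp Φ 2 volume →
      Tendsto (fun n => ∫ x, inner ℝ (Du n x) (Φ x)) atTop (𝓝 (∫ x, inner ℝ (Dv x) (Φ x)))) :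
    Tendsto (fun n => fracForm s (u n) w) atTop (𝓝 (fracForm s v w)) := by
  obtain ⟨K, hK⟩ := exists_abs_fracForm_le hN hs hw
  -- Representing the pairing with w by an element of H¹ reduces the claim to the assumed weak
  -- convergence of functions and gradients.
  obtain ⟨z, Dz, hz, hrep⟩ := exists_riesz_representer (fun v _ => fracForm s w v)
    (fun _ _ _ _ _ huv _ => fracForm_congr s EventuallyEq.rfl huv)
    (fun _ _ _ _ h1 h2 => fracForm_add_right hN hs hw h1 h2)
    (fun c _ _ _ => fracForm_smul_right s c w _) hK
  have e : ∀ v Dv, IsH1With v Dv →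
      fracForm s v w = (∫ x, inner ℝ (Dv x) (Dz x)) + ∫ x, v x * z x := fun v Dv hv => by
    rw [fracForm_comm, hrep v Dv hv]
    simp only [real_inner_comm, mul_comm]
  rw [e v Dv hv]
  simp only [fun n => e _ _ (hu n)]
  exact (hD _ hz.memLp_grad).add (h _ hz.memLp)

end FracForm

section Quadratic

variable {X : Type*} [MeasurableSpace X] {μ : Measure X} {G : Type*} [NormedAddCommGroup G]
  [InnerProductSpace ℝ G]

theorem integrable_inner_of_memLp {f g : X → G} (hf : MemLp f 2 μ) (hg : MemLp g 2 μ) :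
    Integrable (fun x => inner ℝ (f x) (g x)) μ := by
  refine Integrable.mono' (hf.norm.integrable_mul hg.norm) (hf.1.inner hg.1) (ae_of_all _ fun x => ?_)
  exact norm_inner_le_norm _ _

theorem integral_inner_add_smul_self {f g : X → G} (hf : MemLp f 2 μ) (hg : MemLp g 2 μ) (ε : ℝ) :
    ∫ x, inner ℝ (f x + ε • g x) (f x + ε • g x) ∂μ =
      (∫ x, inner ℝ (f x) (f x) ∂μ) + 2 * ε * (∫ x, inner ℝ (f x) (g x) ∂μ) +
        ε ^ 2 * ∫ x, inner ℝ (g x) (g x) ∂μ := by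
  have i1 := integrable_inner_of_memLp hf hf
  have i2 := (integrable_inner_of_memLp hf hg).const_mul (2 * ε)
  have i3 := (integrable_inner_of_memLp hg hg).const_mul (ε ^ 2)
  rw [← integral_const_mul, ← integral_const_mul, ← integral_add i1 i2]
  refine Eq.trans ?_ (integral_add (i1.add i2) i3)
  congr 1; ext x
  simp only [inner_add_left, inner_add_right, inner_smul_left, inner_smul_right, conj_trivial]
  rw [real_inner_comm (f x) (g x)]
  ring

theorem integral_inner_two_mul_sub_le {f g : X → G} (hf : MemLp f 2 μ) (hg : MemLp g 2 μ) :
    2 * (∫ x, inner ℝ (f x) (g x) ∂μ) - (∫ x, inner ℝ (g x) (g x) ∂μ) ≤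
      ∫ x, inner ℝ (f x) (f x) ∂μ := by
  have h := integral_inner_add_smul_self hf hg (-1)
  have : 0 ≤ ∫ x, inner ℝ (f x + (-1 : ℝ) • g x) (f x + (-1 : ℝ) • g x) ∂μ :=
    integral_nonneg fun x => real_inner_self_nonneg
  linarith

/-- Square roots are avoided through B ≤ (B + 1)². -/
theorem eLpNorm_two_le_of_integral_inner_le {f : X → G} (hf : MemLp f 2 μ) {B : ℝ≥0}
    (h : ∫ x, inner ℝ (f x) (f x) ∂μ ≤ B) : eLpNorm f 2 μ ≤ (B + 1 : ℝ≥0) := by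
  have h2 : eLpNorm f 2 μ ^ (2 : ℝ) = ENNReal.ofReal (∫ x, inner ℝ (f x) (f x) ∂μ) := by
    rw [eLpNorm_two_rpow, ofReal_integral_eq_lintegral_ofReal (integrable_inner_of_memLp hf hf)
      (ae_of_all _ fun x => real_inner_self_nonneg)]
    congr 1; ext x
    rw [← ofReal_norm, ENNReal.ofReal_rpow_of_nonneg (norm_nonneg _) zero_le_two, Real.rpow_two,
      real_inner_self_eq_norm_sq]
  rw [← ENNReal.rpow_le_rpow_iff zero_lt_two, h2]
  refine (ENNReal.ofReal_le_ofReal h).trans ?_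
  rw [ENNReal.ofReal_coe_nnreal, ENNReal.rpow_two]
  norm_cast
  nlinarith [B.2]

end Quadratic

end Choquard

end

/-! ### One-variable calculus of the fibers and the envelope argument. -/

noncomputable section

namespace Choquard

open scoped ENNReal NNReal
open Set Metric

/-- A lower bound for the derivative of a minimal value function. -/
theorem nonneg_of_minimal_sup {H : ℝ → ℝ → ℝ} {κ : ℝ → ℝ} {G κ' : ℝ}
    (hconc : ∀ᶠ ε in 𝓝 0, ConcaveOn ℝ (Ioi 0) (H ε))
    (hstrict : ∀ τ, 0 < τ → τ ≠ 1 → H 0 τ < H 0 1)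
    (hcont : ∀ τ, 0 < τ → ContinuousAt (fun ε => H ε τ) 0)
    (hκ : HasDerivAt κ κ' 0) (hκ0 : κ 0 = 0)
    (htan : ∀ᶠ ε in 𝓝 0, ∀ τ, 0 < τ → H ε τ ≤ H ε 1 + κ ε * (τ - 1))
    (hG : HasDerivAt (fun ε => H ε 1) G 0)
    (hmin : ∀ᶠ ε in 𝓝 0, ∀ r, (∀ τ, 0 < τ → H ε τ ≤ r) → H 0 1 ≤ r) : 0 ≤ G := by
  -- If G < 0, then for small ε > 0 the supremum of H ε falls below H 0 1, against minimality. Near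
  -- τ = 1 the tangent bound loses only O(εη), because its slope κ vanishes at ε = 0. Away from 1,
  -- concavity together with H ε (1 ± η) < H ε 1 forces H ε τ ≤ H ε 1.
  by_contra! hneg
  set K : ℝ := |κ'| + 1
  have hK : 0 < K := by positivity
  -- The slope term then costs at most ε|G|/4 in the window |τ − 1| ≤ η. The first-order error of H
  -- ε 1 costs another ε|G|/4, and a net decrease of ε|G|/2 remains.
  set η : ℝ := min (1 / 2) (-G / (4 * K))
  have hη : 0 < η := by
    have : 0 < -G / (4 * K) := div_pos (by linarith) (by positivity)
    positivity
  have hη1 : η ≤ 1 / 2 := min_le_left _ _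
  have hη2 : η * K ≤ -G / 4 := by
    calc η * K ≤ -G / (4 * K) * K := by gcongr; exact min_le_right _ _
      _ = _ := by field_simp
  have e1 : ∀ᶠ ε in 𝓝 (0 : ℝ), |κ ε| ≤ K * |ε| := by
    have := hκ.isLittleO.def (c := 1) one_pos
    filter_upwards [this] with ε hε
    simp only [hκ0, sub_zero, smul_eq_mul, Real.norm_eq_abs, one_mul] at hε
    have := abs_sub_abs_le_abs_sub (κ ε) (ε * κ')
    rw [abs_mul] at this
    nlinarith
  have e2 : ∀ᶠ ε in 𝓝 (0 : ℝ), |H ε 1 - H 0 1 - ε * G| ≤ -G / 4 * |ε| := by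
    have := hG.isLittleO.def (c := -G / 4) (by linarith)
    filter_upwards [this] with ε hε
    simpa only [sub_zero, smul_eq_mul, Real.norm_eq_abs] using hε
  have e3 : ∀ᶠ ε in 𝓝 (0 : ℝ), H ε (1 + η) < H ε 1 :=
    (hcont _ (by linarith)).eventually_lt (hcont 1 one_pos) (hstrict _ (by linarith) (by linarith))
  have e4 : ∀ᶠ ε in 𝓝 (0 : ℝ), H ε (1 - η) < H ε 1 :=
    (hcont _ (by linarith)).eventually_lt (hcont 1 one_pos) (hstrict _ (by linarith) (by linarith))
  have ev := (hconc.and (htan.and (hmin.and (e1.and (e2.and (e3.and e4))))))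
  have ev' := ((ev.filter_mono nhdsWithin_le_nhds).and
    (self_mem_nhdsWithin : Ioi (0 : ℝ) ∈ 𝓝[>] 0)).exists
  obtain ⟨ε, ⟨hcv, ht, hm, h1, h2, h3, h4⟩, hε⟩ := ev'
  have hε' : (0 : ℝ) < ε := hε
  rw [abs_of_pos hε'] at h1 h2
  have hH1 : H ε 1 ≤ H 0 1 + ε * (3 / 4 * G) := by
    have := (abs_le.1 h2).2
    nlinarith
  have hbd : ∀ τ, 0 < τ → H ε τ ≤ H 0 1 + ε * (1 / 2 * G) := by
    intro τ hτ
    have hGε : 0 < ε * (-G) := mul_pos hε' (by linarith)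
    rcases lt_or_ge τ (1 - η) with hlt | hge
    · have := hcv.2 (show τ ∈ Ioi 0 from hτ) (mem_Ioi.2 one_pos)
        (show 0 ≤ η / (1 - τ) by apply div_nonneg <;> linarith)
        (show 0 ≤ 1 - η / (1 - τ) by rw [sub_nonneg, div_le_one (by linarith)]; linarith) (by ring)
      have hne : 1 - τ ≠ 0 := by linarith
      have hp : 0 < η / (1 - τ) := div_pos hη (by linarith)
      have e : (η / (1 - τ)) • τ + (1 - η / (1 - τ)) • (1 : ℝ) = 1 - η := by
        simp only [smul_eq_mul]; field_simp; ring
      rw [e] at this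
      simp only [smul_eq_mul] at this
      have : H ε τ ≤ H ε 1 := by
        by_contra! hcon
        nlinarith
      nlinarith
    rcases le_or_gt τ (1 + η) with hle | hgt
    · have h5 : |κ ε * (τ - 1)| ≤ K * ε * η := by
        rw [abs_mul]
        gcongr
        rw [abs_le]; constructor <;> linarith
      have := ht τ hτ
      have := le_abs_self (κ ε * (τ - 1))
      nlinarith
    · have := hcv.2 (show τ ∈ Ioi 0 from hτ) (mem_Ioi.2 one_pos)
        (show 0 ≤ η / (τ - 1) by apply div_nonneg <;> linarith)
        (show 0 ≤ 1 - η / (τ - 1) by rw [sub_nonneg, div_le_one (by linarith)]; linarith) (by ring)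
      have hne : τ - 1 ≠ 0 := by linarith
      have hp : 0 < η / (τ - 1) := div_pos hη (by linarith)
      have e : (η / (τ - 1)) • τ + (1 - η / (τ - 1)) • (1 : ℝ) = 1 + η := by
        simp only [smul_eq_mul]; field_simp; ring
      rw [e] at this
      simp only [smul_eq_mul] at this
      have : H ε τ ≤ H ε 1 := by
        by_contra! hcon
        nlinarith
      nlinarith
  have := hm _ hbd
  nlinarith

/-- The function `a τ^p + b τ^q + c τ^r - d τ`. -/
def profile (p q r a b c d τ : ℝ) : ℝ := τ ^ p * a + τ ^ q * b + τ ^ r * c - τ * d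

variable {p q r : ℝ}

/-- Since r < 1 and c > 0, the term cτ^r beats dτ near zero and the profile is positive there. Since
all exponents are below 1 and d > 0, it is nonpositive beyond some T. Its maximum on [0, T] is
therefore global and not at 0. -/
theorem exists_max_profile (hp : p ∈ Ioo (0 : ℝ) 1) (hq : q ∈ Ioo (0 : ℝ) 1)
    (hr : r ∈ Ioo (0 : ℝ) 1) {a b c d : ℝ} (ha : 0 ≤ a) (hb : 0 ≤ b) (hc : 0 < c) (hd : 0 < d) :
    ∃ σ, 0 < σ ∧ ∀ τ, 0 < τ → profile p q r a b c d τ ≤ profile p q r a b c d σ := by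
  set f := profile p q r a b c d
  have hcont : Continuous f := by
    have h1 : Continuous fun τ : ℝ => τ ^ p := Real.continuous_rpow_const hp.1.le
    have h2 : Continuous fun τ : ℝ => τ ^ q := Real.continuous_rpow_const hq.1.le
    have h3 : Continuous fun τ : ℝ => τ ^ r := Real.continuous_rpow_const hr.1.le
    unfold f profile
    fun_prop
  have hfac : ∀ τ : ℝ, 0 < τ →
      f τ = τ * (τ ^ (-(1 - p)) * a + τ ^ (-(1 - q)) * b + τ ^ (-(1 - r)) * c - d) := by
    intro τ hτ
    have e : ∀ p : ℝ, τ ^ p = τ * τ ^ (-(1 - p)) := fun p => by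
      conv_rhs => rw [← Real.rpow_one τ, ← Real.rpow_mul hτ.le, ← Real.rpow_add hτ]
      congr 1; ring
    simp only [f, profile]
    rw [e p, e q, e r]
    ring
  have hlim : Tendsto (fun τ : ℝ => τ ^ (-(1 - p)) * a + τ ^ (-(1 - q)) * b +
      τ ^ (-(1 - r)) * c - d) atTop (𝓝 (0 * a + 0 * b + 0 * c - d)) := by
    refine ((((tendsto_rpow_neg_atTop (by linarith [hp.2])).mul_const a).add
      ((tendsto_rpow_neg_atTop (by linarith [hq.2])).mul_const b)).add
      ((tendsto_rpow_neg_atTop (by linarith [hr.2])).mul_const c)).sub_const d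
  obtain ⟨T, hT⟩ := ((hlim.eventually (gt_mem_nhds (show (0 * a + 0 * b + 0 * c - d : ℝ) < 0 by
    linarith))).and (eventually_gt_atTop 0)).exists_forall_of_atTop
  have hTpos : 0 < T := (hT T le_rfl).2
  obtain ⟨σ₀, hσ₀, hpos⟩ : ∃ σ, 0 < σ ∧ 0 < f σ := by
    have hlim : Tendsto (fun τ : ℝ => τ ^ (1 - r)) (𝓝[>] 0) (𝓝 0) := by
      have := (Real.continuous_rpow_const (q := 1 - r) (by linarith [hr.2])).tendsto 0
      rw [Real.zero_rpow (by linarith [hr.2])] at this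
      exact this.mono_left nhdsWithin_le_nhds
    obtain ⟨σ, hσ, hσ0⟩ := ((hlim.eventually (gt_mem_nhds (show 0 < c / d by positivity))).and
      self_mem_nhdsWithin).exists
    have hσ0 : 0 < σ := hσ0
    refine ⟨σ, hσ0, ?_⟩
    have e : σ = σ ^ r * σ ^ (1 - r) := by
      rw [← Real.rpow_add hσ0]; simp
    have h1 : σ * d < σ ^ r * c := by
      rw [lt_div_iff₀ hd] at hσ
      calc σ * d = σ ^ r * (σ ^ (1 - r) * d) := by rw [← mul_assoc, ← e]
        _ < _ := by gcongr
    have h2 : 0 ≤ σ ^ p * a := by positivity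
    have h3 : 0 ≤ σ ^ q * b := by positivity
    simp only [f, profile]
    linarith
  have hle : ∀ τ, T ≤ τ → f τ ≤ 0 := fun τ hτ => by
    rw [hfac τ (hT τ hτ).2]
    exact mul_nonpos_of_nonneg_of_nonpos (hT τ hτ).2.le (hT τ hτ).1.le
  obtain ⟨σ, hσ, hmax⟩ := (isCompact_Icc (a := (0 : ℝ)) (b := T)).exists_isMaxOn
    ⟨0, by simp [hTpos.le]⟩ hcont.continuousOn
  have hσ₀T : σ₀ ≤ T := by
    by_contra! h
    linarith [hle _ h.le]
  have hfσ : 0 < f σ := hpos.trans_le (hmax ⟨hσ₀.le, hσ₀T⟩)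
  refine ⟨σ, hσ.1.lt_of_ne ?_, fun τ hτ => ?_⟩
  · rintro rfl
    simp [f, profile, Real.zero_rpow hp.1.ne', Real.zero_rpow hq.1.ne', Real.zero_rpow hr.1.ne']
      at hfσ
  · rcases le_total τ T with h | h
    · exact hmax ⟨hτ.le, h⟩
    · exact (hle τ h).trans hfσ.le

theorem rpow_le_tangent (hp : p ∈ Ioo (0 : ℝ) 1) {τ : ℝ} (hτ : 0 < τ) :
    τ ^ p ≤ 1 + p * (τ - 1) := by
  simpa using rpow_one_add_le_one_add_mul_self (s := τ - 1) (by linarith) hp.1.le hp.2.le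

theorem rpow_lt_tangent (hp : p ∈ Ioo (0 : ℝ) 1) {τ : ℝ} (hτ : 0 < τ) (h : τ ≠ 1) :
    τ ^ p < 1 + p * (τ - 1) := by
  simpa using rpow_one_add_lt_one_add_mul_self (s := τ - 1) (by linarith)
    (sub_ne_zero.2 h) hp.1 hp.2

theorem profile_le_tangent (hp : p ∈ Ioo (0 : ℝ) 1) (hq : q ∈ Ioo (0 : ℝ) 1)
    (hr : r ∈ Ioo (0 : ℝ) 1) {a b c d : ℝ} (ha : 0 ≤ a) (hb : 0 ≤ b) (hc : 0 ≤ c) {τ : ℝ}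
    (hτ : 0 < τ) :
    profile p q r a b c d τ ≤
      profile p q r a b c d 1 + (p * a + q * b + r * c - d) * (τ - 1) := by
  have h1 := mul_le_mul_of_nonneg_right (rpow_le_tangent hp hτ) ha
  have h2 := mul_le_mul_of_nonneg_right (rpow_le_tangent hq hτ) hb
  have h3 := mul_le_mul_of_nonneg_right (rpow_le_tangent hr hτ) hc
  simp only [profile, Real.one_rpow]
  linarith

theorem profile_lt_tangent (hp : p ∈ Ioo (0 : ℝ) 1) (hq : q ∈ Ioo (0 : ℝ) 1)
    (hr : r ∈ Ioo (0 : ℝ) 1) {a b c d : ℝ} (ha : 0 ≤ a) (hb : 0 ≤ b) (hc : 0 < c) {τ : ℝ}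
    (hτ : 0 < τ) (hτ1 : τ ≠ 1) :
    profile p q r a b c d τ <
      profile p q r a b c d 1 + (p * a + q * b + r * c - d) * (τ - 1) := by
  have h1 := mul_le_mul_of_nonneg_right (rpow_le_tangent hp hτ) ha
  have h2 := mul_le_mul_of_nonneg_right (rpow_le_tangent hq hτ) hb
  have h3 := mul_lt_mul_of_pos_right (rpow_lt_tangent hr hτ hτ1) hc
  simp only [profile, Real.one_rpow]
  linarith

theorem concaveOn_profile (hp : p ∈ Ioo (0 : ℝ) 1) (hq : q ∈ Ioo (0 : ℝ) 1)
    (hr : r ∈ Ioo (0 : ℝ) 1) {a b c d : ℝ} (ha : 0 ≤ a) (hb : 0 ≤ b) (hc : 0 ≤ c) :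
    ConcaveOn ℝ (Ioi 0) (profile p q r a b c d) := by
  have key : ∀ {p : ℝ}, p ∈ Ioo (0 : ℝ) 1 → ∀ {a : ℝ}, 0 ≤ a →
      ConcaveOn ℝ (Ioi 0) fun τ : ℝ => τ ^ p * a := fun hp a ha => by
    have := (((Real.strictConcaveOn_rpow hp.1 hp.2).concaveOn).subset Ioi_subset_Ici_self
      (convex_Ioi 0)).smul ha
    simpa only [smul_eq_mul, mul_comm] using this
  refine (((key hp ha).add (key hq hb)).add (key hr hc)).sub ⟨convex_Ioi 0, ?_⟩
  intro x _ y _ t t' _ _ _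
  simp only [smul_eq_mul]
  linarith

/-- For the fiber of u this is the Pohozaev identity. It supplies the hypothesis κ 0 = 0 of
`nonneg_of_minimal_sup`. -/
theorem slope_eq_zero_of_max {a b c d : ℝ}
    (h : ∀ τ, 0 < τ → profile p q r a b c d τ ≤ profile p q r a b c d 1) :
    p * a + q * b + r * c - d = 0 := by
  have hd : ∀ p : ℝ, HasDerivAt (fun τ : ℝ => τ ^ p) p 1 := fun p => by
    simpa using Real.hasDerivAt_rpow_const (x := 1) (p := p) (Or.inl one_ne_zero)
  have hd' : HasDerivAt (profile p q r a b c d) (p * a + q * b + r * c - 1 * d) 1 :=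
    ((((hd p).mul_const a).add ((hd q).mul_const b)).add ((hd r).mul_const c)).sub
      ((hasDerivAt_id 1).mul_const d)
  rw [one_mul] at hd'
  refine IsLocalMax.hasDerivAt_eq_zero ?_ hd'
  filter_upwards [Ioi_mem_nhds (zero_lt_one' ℝ)] with τ hτ using h τ hτ

/-- Stationarity of the maximal value of the profile at a minimum over a one parameter family. -/
theorem deriv_profile_eq_zero (hp : p ∈ Ioo (0 : ℝ) 1) (hq : q ∈ Ioo (0 : ℝ) 1)
    (hr : r ∈ Ioo (0 : ℝ) 1) {a b c d : ℝ → ℝ} {a' b' c' d' : ℝ}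
    (ha : HasDerivAt a a' 0) (hb : HasDerivAt b b' 0) (hc : HasDerivAt c c' 0)
    (hd : HasDerivAt d d' 0) (ha0 : ∀ ε, 0 ≤ a ε) (hb0 : ∀ ε, 0 ≤ b ε) (hc0 : ∀ ε, 0 ≤ c ε)
    (hcpos : 0 < c 0)
    (hmax : ∀ τ, 0 < τ → profile p q r (a 0) (b 0) (c 0) (d 0) τ ≤
      profile p q r (a 0) (b 0) (c 0) (d 0) 1)
    (hmin : ∀ᶠ ε in 𝓝 0, ∀ R, (∀ τ, 0 < τ → profile p q r (a ε) (b ε) (c ε) (d ε) τ ≤ R) →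
      profile p q r (a 0) (b 0) (c 0) (d 0) 1 ≤ R) : a' + b' + c' - d' = 0 := by
  -- Stated for arbitrary families so that it applies both to the given one and to its reflection ε
  -- ↦ −ε; the two inequalities give equality.
  have key : ∀ {a b c d : ℝ → ℝ} {a' b' c' d' : ℝ}, HasDerivAt a a' 0 → HasDerivAt b b' 0 →
      HasDerivAt c c' 0 → HasDerivAt d d' 0 → (∀ ε, 0 ≤ a ε) → (∀ ε, 0 ≤ b ε) → (∀ ε, 0 ≤ c ε) →
      0 < c 0 → (∀ τ, 0 < τ → profile p q r (a 0) (b 0) (c 0) (d 0) τ ≤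
        profile p q r (a 0) (b 0) (c 0) (d 0) 1) →
      (∀ᶠ ε in 𝓝 0, ∀ R, (∀ τ, 0 < τ → profile p q r (a ε) (b ε) (c ε) (d ε) τ ≤ R) →
        profile p q r (a 0) (b 0) (c 0) (d 0) 1 ≤ R) → 0 ≤ a' + b' + c' - d' := by
    intro a b c d a' b' c' d' ha hb hc hd ha0 hb0 hc0 hcpos hmax hmin
    have hs := slope_eq_zero_of_max hmax
    refine nonneg_of_minimal_sup (H := fun ε => profile p q r (a ε) (b ε) (c ε) (d ε))
      (κ := fun ε => p * a ε + q * b ε + r * c ε - d ε)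
      (κ' := p * a' + q * b' + r * c' - d') ?_ ?_ ?_ ?_ hs ?_ ?_ hmin
    · exact Eventually.of_forall fun ε => concaveOn_profile hp hq hr (ha0 ε) (hb0 ε) (hc0 ε)
    · intro τ hτ hτ1
      have := profile_lt_tangent hp hq hr (d := d 0) (ha0 0) (hb0 0) hcpos hτ hτ1
      rwa [hs, zero_mul, add_zero] at this
    · intro τ _
      have := ha.continuousAt; have := hb.continuousAt; have := hc.continuousAt
      have := hd.continuousAt
      unfold profile
      fun_prop
    · exact (((ha.const_mul p).add (hb.const_mul q)).add (hc.const_mul r)).sub hd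
    · exact Eventually.of_forall fun ε τ hτ =>
        profile_le_tangent hp hq hr (ha0 ε) (hb0 ε) (hc0 ε) hτ
    · simp only [profile, Real.one_rpow, one_mul]
      exact ((ha.add hb).add hc).sub hd
  have h1 := key ha hb hc hd ha0 hb0 hc0 hcpos hmax hmin
  have hneg : ∀ {f : ℝ → ℝ} {f' : ℝ}, HasDerivAt f f' 0 →
      HasDerivAt (fun ε => f (-ε)) (-f') 0 := fun {f f'} hf => by
    have : HasDerivAt f f' (-0) := by simpa using hf
    simpa [Function.comp_def] using this.scomp (0 : ℝ) (hasDerivAt_neg (0 : ℝ))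
  have h2 := key (hneg ha) (hneg hb) (hneg hc) (hneg hd) (fun _ => ha0 _) (fun _ => hb0 _)
    (fun _ => hc0 _) (by simpa using hcpos) (by simpa using hmax) (by
      have : Tendsto (fun ε : ℝ => -ε) (𝓝 0) (𝓝 0) := by simpa using (continuous_neg.tendsto (0 : ℝ))
      simpa using this.eventually hmin)
  linarith

end Choquard

end

/-! ### Radial test functions with positive nonlocal energy. -/

noncomputable section

namespace Choquard

open scoped ENNReal NNReal
open Set Metric

variable {N : ℕ}

theorem isH1With_gradient {u : Space N → ℝ} (hu : ContDiff ℝ ∞ u) (hc : HasCompactSupport u) :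
    IsH1With u (gradient u) := by
  have hd : Continuous (fderiv ℝ u) := hu.continuous_fderiv (by simp)
  have hdc : HasCompactSupport (gradient u) :=
    (hc.fderiv ℝ).comp_left (g := (InnerProductSpace.toDual ℝ (Space N)).symm) (map_zero _)
  have hdu : Continuous (gradient u) :=
    (InnerProductSpace.toDual ℝ (Space N)).symm.continuous.comp hd
  refine ⟨hu.continuous.memLp_of_hasCompactSupport hc, hdu.memLp_of_hasCompactSupport hdc,
    fun φ hφ hφc i => ?_⟩
  have hφd : Continuous (fderiv ℝ φ) := hφ.continuous_fderiv (by simp)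
  have hφ0 := hφ.continuous
  have hu0 := hu.continuous
  have e : ∀ x, gradient u x i = fderiv ℝ u x (EuclideanSpace.single i 1) := fun x => by
    rw [← InnerProductSpace.toDual_symm_apply (y := fderiv ℝ u x), real_inner_comm,
      EuclideanSpace.inner_single_left]
    simp [gradient]
  simp only [e]
  refine integral_mul_fderiv_eq_neg_fderiv_mul_of_integrable ?_ ?_ ?_
    (fun x _ => hu.differentiable (by simp) x) (fun x _ => hφ.differentiable (by simp) x)
  · exact Continuous.integrable_of_hasCompactSupport (by fun_prop) hφc.mul_left
  · exact Continuous.integrable_of_hasCompactSupport (by fun_prop) hc.mul_right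
  · exact Continuous.integrable_of_hasCompactSupport (by fun_prop) hφc.mul_left

/-- A smooth radial cutoff, equal to `c` on the unit ball and vanishing where `1 + δ ≤ |x|²`. -/
def plateau (c δ : ℝ) (x : Space N) : ℝ :=
  c * Real.smoothTransition ((1 + δ - ‖x‖ ^ 2) / δ)

theorem contDiff_plateau (c δ : ℝ) : ContDiff ℝ ∞ (plateau c δ : Space N → ℝ) := by
  refine contDiff_const.mul (Real.smoothTransition.contDiff.comp ?_)
  exact (contDiff_const.sub (contDiff_norm_sq ℝ)).div_const _

theorem plateau_eq {c δ : ℝ} (hδ : 0 < δ) {x : Space N} (hx : ‖x‖ ≤ 1) : plateau c δ x = c := by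
  rw [plateau, Real.smoothTransition.one_of_one_le, mul_one]
  rw [one_le_div hδ]
  nlinarith [norm_nonneg x]

theorem plateau_eq_zero {c δ : ℝ} (hδ : 0 < δ) {x : Space N} (hx : 1 + δ ≤ ‖x‖ ^ 2) :
    plateau c δ x = 0 := by
  rw [plateau, Real.smoothTransition.zero_of_nonpos, mul_zero]
  exact div_nonpos_of_nonpos_of_nonneg (by linarith) hδ.le

theorem abs_plateau_le (c δ : ℝ) (x : Space N) : |plateau c δ x| ≤ |c| := by
  rw [plateau, abs_mul, abs_of_nonneg (Real.smoothTransition.nonneg _)]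
  exact mul_le_of_le_one_right (abs_nonneg c) (Real.smoothTransition.le_one _)

theorem plateau_eq_zero_of_two_le {c δ : ℝ} (hδ : 0 < δ) (hδ1 : δ ≤ 1) {x : Space N}
    (hx : 2 ≤ ‖x‖) : plateau c δ x = 0 :=
  plateau_eq_zero hδ (by nlinarith)

theorem hasCompactSupport_plateau {c δ : ℝ} (hδ : 0 < δ) (hδ1 : δ ≤ 1) :
    HasCompactSupport (plateau c δ : Space N → ℝ) := by
  refine HasCompactSupport.intro (isCompact_closedBall (0 : Space N) 2) fun x hx => ?_
  exact plateau_eq_zero_of_two_le hδ hδ1 (by simpa using (not_le.1 (by simpa using hx)).le)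

theorem radial_plateau (c δ : ℝ) : Radial (plateau c δ : Space N → ℝ) := fun g =>
  ae_of_all _ fun x => by simp [plateau]

theorem memLp_indicator_closedBall (R c : ℝ) (p : ℝ≥0∞) :
    MemLp ((closedBall (0 : Space N) R).indicator fun _ => c) p volume :=
  memLp_indicator_const _ measurableSet_closedBall c (Or.inr measure_closedBall_lt_top.ne)

/-- The constant enters as c² and the kernel is positive off the diagonal, so the sign of c is
irrelevant. This is why (f3) only asks for F(t₀) ≠ 0. -/
theorem rieszForm_indicator_pos (hN : 1 ≤ N) {α : ℝ} (hα : 0 < α) (hαN : α < N) {c : ℝ}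
    (hc : c ≠ 0) : 0 < rieszForm α ((closedBall (0 : Space N) 1).indicator fun _ => c)
      ((closedBall (0 : Space N) 1).indicator fun _ => c) := by
  obtain ⟨C, -, hls⟩ := hls hN hα hαN
  have hm := memLp_indicator_closedBall (N := N) 1 c (hlsExp N α)
  set f := (closedBall (0 : Space N) 1).indicator fun _ => c
  have hff : ∀ x y, 0 ≤ f x * f y := fun x y => by
    by_cases hx : x ∈ closedBall (0 : Space N) 1 <;> by_cases hy : y ∈ closedBall (0 : Space N) 1 <;>
      simp only [f, indicator_of_mem, indicator_of_notMem, hx, hy, mul_zero, zero_mul, le_refl,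
        not_false_eq_true]
    exact mul_self_nonneg c
  rw [rieszForm, integral_pos_iff_support_of_nonneg
    (fun q => mul_nonneg (rieszKernel_nonneg hα hαN _) (hff _ _)) (hls f f hm hm).1]
  set U : Set (Space N × Space N) := (ball 0 1 ×ˢ ball 0 1) ∩ {q | q.1 ≠ q.2}
  have hU : IsOpen U := (isOpen_ball.prod isOpen_ball).inter
    (isOpen_ne_fun continuous_fst continuous_snd)
  have hne : U.Nonempty := by
    refine ⟨(0, EuclideanSpace.single ⟨0, hN⟩ (1 / 2)), ⟨by simp, ?_⟩, ?_⟩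
    · simp only [mem_ball_zero_iff]
      rw [PiLp.norm_single]
      norm_num
    · intro h
      have := congrArg norm h
      simp only at this
      rw [PiLp.norm_single, norm_zero] at this
      norm_num at this
  have : (volume : Measure (Space N × Space N)).IsOpenPosMeasure := by
    rw [Measure.volume_eq_prod]; infer_instance
  refine (hU.measure_pos volume hne).trans_le (measure_mono fun q hq => ?_)
  have h1 : q.1 ∈ closedBall (0 : Space N) 1 := ball_subset_closedBall hq.1.1
  have h2 : q.2 ∈ closedBall (0 : Space N) 1 := ball_subset_closedBall hq.1.2
  have := rieszKernel_pos hα hαN (sub_ne_zero.2 hq.2)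
  rw [Function.mem_support]
  simp only [f, indicator_of_mem h1, indicator_of_mem h2]
  positivity

/-- As δ → 0, F of the plateau converges pointwise to F(c) times the indicator of the closed unit
ball, dominated by a constant on the ball of radius 2. The Riesz forms converge to a positive limit.
-/
theorem exists_radial_rieszForm_pos (hN : 1 ≤ N) {α : ℝ} (hα : 0 < α) (hαN : α < N) {F : ℝ → ℝ}
    (hF : Continuous F) (hF0 : F 0 = 0) (h3 : CondF3 F) :
    ∃ (u : Space N → ℝ) (Du : Space N → Space N), IsH1With u Du ∧ Radial u ∧
      0 < rieszForm α (fun x => F (u x)) fun x => F (u x) := by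
  obtain ⟨c, -, hc⟩ := h3
  set δ : ℕ → ℝ := fun n => 1 / ((n : ℝ) + 1)
  have hδ : ∀ n, 0 < δ n := fun n => by positivity
  have hδ1 : ∀ n, δ n ≤ 1 := fun n => by
    rw [div_le_one (by positivity)]; simp
  have hδlim : Tendsto δ atTop (𝓝 0) := tendsto_one_div_add_atTop_nhds_zero_nat
  set f : Space N → ℝ := (closedBall (0 : Space N) 1).indicator fun _ => F c
  obtain ⟨M, hM⟩ := (isCompact_Icc (a := -|c|) (b := |c|)).exists_bound_of_continuousOn
    hF.continuousOn
  have hM0 : 0 ≤ M := (norm_nonneg _).trans (hM 0 (by simp))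
  set G : Space N → ℝ := (closedBall (0 : Space N) 2).indicator fun _ => M
  have hG : MemLp G (hlsExp N α) volume := memLp_indicator_closedBall 2 M _
  have hbd : ∀ n x, ‖F (plateau c (δ n) x)‖ ≤ G x := fun n x => by
    by_cases hx : x ∈ closedBall (0 : Space N) 2
    · simp only [G, indicator_of_mem hx]
      exact hM _ (abs_le.1 (abs_plateau_le _ _ _))
    · simp only [G, indicator_of_notMem hx]
      rw [plateau_eq_zero_of_two_le (hδ n) (hδ1 n)
        (by simpa using (not_le.1 (by simpa using hx)).le), hF0, norm_zero]
  have hpt : ∀ x, Tendsto (fun n => F (plateau c (δ n) x)) atTop (𝓝 (f x)) := fun x => by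
    refine tendsto_const_nhds.congr' ?_
    rcases le_or_gt ‖x‖ 1 with hx | hx
    · refine Eventually.of_forall fun n => ?_
      simp only [plateau_eq (hδ n) hx]
      exact indicator_of_mem (by simpa using hx) _
    · have h1 : ∀ᶠ n in atTop, δ n < ‖x‖ ^ 2 - 1 :=
        hδlim.eventually (gt_mem_nhds (by nlinarith))
      filter_upwards [h1] with n hn
      rw [plateau_eq_zero (hδ n) (by linarith), hF0]
      exact indicator_of_notMem (by simpa using hx) _
  obtain ⟨C, -, hls⟩ := hls hN hα hαN
  have hlim : Tendsto (fun n => rieszForm α (fun x : Space N => F (plateau c (δ n) x))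
      fun x => F (plateau c (δ n) x)) atTop (𝓝 (rieszForm α f f)) := by
    refine tendsto_integral_of_dominated_convergence
      (fun q : Space N × Space N => rieszKernel α (q.1 - q.2) * (G q.1 * G q.2)) (fun n => ?_)
      (hls G G hG hG).1 (fun n => ae_of_all _ fun q => ?_) (ae_of_all _ fun q => ?_)
    · have : AEStronglyMeasurable (fun x : Space N => F (plateau c (δ n) x)) volume :=
        (hF.comp (contDiff_plateau c (δ n)).continuous).aestronglyMeasurable
      exact aestronglyMeasurable_riesz α this this
    · rw [norm_mul, norm_mul, Real.norm_of_nonneg (rieszKernel_nonneg hα hαN _)]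
      have := rieszKernel_nonneg hα hαN (q.1 - q.2)
      have := (norm_nonneg _).trans (hbd n q.1)
      gcongr <;> exact hbd n _
    · exact ((hpt q.1).mul (hpt q.2)).const_mul _
  obtain ⟨n, hn⟩ := (hlim.eventually (lt_mem_nhds (rieszForm_indicator_pos hN hα hαN hc))).exists
  exact ⟨_, _, isH1With_gradient (contDiff_plateau c (δ n))
    (hasCompactSupport_plateau (hδ n) (hδ1 n)), radial_plateau _ _, hn⟩

end Choquard

end

/-! ### The minimax level and its minimiser. -/

noncomputable section

namespace Choquard

open scoped ENNReal NNReal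
open Set Metric

variable {N : ℕ}

theorem Radial.sub {u v : Space N → ℝ} (hu : Radial u) (hv : Radial v) :
    Radial (fun x => u x - v x) := fun g => by
  filter_upwards [hu g, hv g] with x h1 h2
  rw [h1, h2]

theorem rieszForm_comp_eq_zero {α : ℝ} {F : ℝ → ℝ} (hF0 : F 0 = 0) {u : Space N → ℝ}
    (hu : u =ᵐ[volume] 0) : (rieszForm α (fun x => F (u x)) fun x => F (u x)) = 0 := by
  have h : (fun x => F (u x)) =ᵐ[volume] fun _ => 0 := by
    filter_upwards [hu] with x hx
    rw [hx, Pi.zero_apply, hF0]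
  rw [rieszForm_congr α h h]
  simp [rieszForm]

theorem integral_mul_self_pos {u : Space N → ℝ} (hu : MemLp u 2 volume)
    (h : ¬ u =ᵐ[volume] 0) : 0 < ∫ x, u x * u x := by
  refine (integral_nonneg fun x => mul_self_nonneg (u x)).lt_of_ne fun h0 => h ?_
  have := (integral_eq_zero_iff_of_nonneg (fun x => mul_self_nonneg (u x))
    (hu.integrable_mul hu)).1 h0.symm
  filter_upwards [this] with x hx
  exact mul_self_eq_zero.1 hx

theorem integral_mul_two_mul_sub_le {u v : Space N → ℝ} (hu : MemLp u 2 volume)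
    (hv : MemLp v 2 volume) :
    2 * (∫ x, u x * v x) - (∫ x, v x * v x) ≤ ∫ x, u x * u x := by
  simpa only [RCLike.inner_apply, conj_trivial, mul_comm] using integral_inner_two_mul_sub_le hu hv

theorem exponents_mem (hN : 3 ≤ N) {s α : ℝ} (hs : s ∈ Ioo (0 : ℝ) 1) (hα : 0 < α) :
    ((N : ℝ) - 2) / (N + α) ∈ Ioo (0 : ℝ) 1 ∧ ((N : ℝ) - 2 * s) / (N + α) ∈ Ioo (0 : ℝ) 1 ∧
      (N : ℝ) / (N + α) ∈ Ioo (0 : ℝ) 1 := by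
  have hN' : (3 : ℝ) ≤ N := by exact_mod_cast hN
  have h : (0 : ℝ) < N + α := by linarith
  obtain ⟨h0, h1⟩ := hs
  refine ⟨⟨?_, ?_⟩, ⟨?_, ?_⟩, ⟨?_, ?_⟩⟩ <;> first
    | exact div_pos (by linarith) h
    | rw [div_lt_one h]; linarith

variable [NeZero N]

/-- The energy of the dilations of `u`, by the parameter `τ ^ (1 / (N + α))`. -/
def fiber (s α : ℝ) (F : ℝ → ℝ) (u : Space N → ℝ) (Du : Space N → Space N) : ℝ → ℝ :=
  profile (((N : ℝ) - 2) / (N + α)) (((N : ℝ) - 2 * s) / (N + α)) ((N : ℝ) / (N + α))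
    (∫ x, inner ℝ (Du x) (Du x)) (fracForm s u u) (∫ x, u x * u x)
    (rieszForm α (fun x => F (u x)) fun x => F (u x))

/-- Dilate by R = σ^(1/(N+α)): the nonlocal term gains R^(N+α) = σ, and the other terms gain exactly
the powers of σ in the profile. -/
theorem exists_rescale {s α : ℝ} (hα : 0 < α) (F : ℝ → ℝ) {u : Space N → ℝ}
    {Du : Space N → Space N} (hu : IsH1With u Du) (hr : Radial u) {σ : ℝ} (hσ : 0 < σ) :
    ∃ (w : Space N → ℝ) (Dw : Space N → Space N), IsH1With w Dw ∧ Radial w ∧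
      (rieszForm α (fun x => F (w x)) fun x => F (w x)) =
        σ * (rieszForm α (fun x => F (u x)) fun x => F (u x)) ∧
      ∀ τ, 0 < τ → fiber s α F w Dw τ = fiber s α F u Du (σ * τ) := by
  have hNα : (0 : ℝ) < N + α := by positivity
  set R : ℝ := σ ^ (1 / (N + α) : ℝ)
  have hR : 0 < R := by positivity
  have e : ∀ p : ℝ, R ^ p = σ ^ (p / (N + α)) := fun p => by
    rw [← Real.rpow_mul hσ.le]
    congr 1; ring
  have eD : (rieszForm α (fun x => F (dilate R u x)) fun x => F (dilate R u x)) =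
      σ * (rieszForm α (fun x => F (u x)) fun x => F (u x)) := by
    have := rieszForm_dilate hR α fun x => F (u x)
    rw [e, div_self hNα.ne', Real.rpow_one] at this
    exact this
  refine ⟨dilate R u, dilateGrad R Du, hu.dilate hR, hr.dilate hR, eD, fun τ hτ => ?_⟩
  rw [fiber, fiber, integral_dilateGrad_sq hR, integral_dilate_sq hR, fracForm_dilate hR, eD, e, e,
    e, profile, profile, Real.mul_rpow hσ.le hτ.le, Real.mul_rpow hσ.le hτ.le,
    Real.mul_rpow hσ.le hτ.le]
  ring

theorem exists_max_fiber (hN : 3 ≤ N) {s α : ℝ} (hs : s ∈ Ioo (0 : ℝ) 1) (hα : 0 < α) {F : ℝ → ℝ}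
    (hF0 : F 0 = 0) {u : Space N → ℝ} {Du : Space N → Space N} (hu : IsH1With u Du)
    (hpos : 0 < rieszForm α (fun x => F (u x)) fun x => F (u x)) :
    ∃ σ, 0 < σ ∧ ∀ τ, 0 < τ → fiber s α F u Du τ ≤ fiber s α F u Du σ := by
  obtain ⟨hp, hq, hr⟩ := exponents_mem hN hs hα
  refine exists_max_profile hp hq hr (integral_nonneg fun x => real_inner_self_nonneg)
    (fracForm_self_nonneg s u) (integral_mul_self_pos hu.memLp fun h => ?_) hpos
  rw [rieszForm_comp_eq_zero hF0 h] at hpos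
  exact lt_irrefl _ hpos

/-- Weak limits of normalised sequences of radial functions. -/
theorem exists_limit_of_fiber_le (hN : 3 ≤ N) {s α : ℝ} (hs : s ∈ Ioo (0 : ℝ) 1) (hα : 0 < α)
    (hαN : α < N) {F : ℝ → ℝ} {C : ℝ} (hG : GrowthBound N α F C) (hF0 : F 0 = 0)
    (h2 : CondF2 N α F) {w : ℕ → Space N → ℝ} {Dw : ℕ → Space N → Space N} {r : ℕ → ℝ} {m : ℝ}
    (hw : ∀ n, IsH1With (w n) (Dw n)) (hrad : ∀ n, Radial (w n))
    (hD : ∀ n, (rieszForm α (fun x => F (w n x)) fun x => F (w n x)) = 1)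
    (hle : ∀ n τ, 0 < τ → fiber s α F (w n) (Dw n) τ ≤ r n) (hr : Tendsto r atTop (𝓝 m)) :
    ∃ (v : Space N → ℝ) (Dv : Space N → Space N), IsH1With v Dv ∧ Radial v ∧
      (rieszForm α (fun x => F (v x)) fun x => F (v x)) = 1 ∧
      ∀ τ, 0 < τ → fiber s α F v Dv τ ≤ m := by
  have hN1 : 1 ≤ N := by omega
  obtain ⟨R, hR⟩ := hr.bddAbove_range
  -- The fiber at τ = 1 is the sum of the quadratic terms minus 1, so a bound on it bounds the H¹
  -- norm.
  have hsum : ∀ n, (∫ x, inner ℝ (Dw n x) (Dw n x)) + fracForm s (w n) (w n) +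
      (∫ x, w n x * w n x) ≤ R + 1 := fun n => by
    have h1 := (hle n 1 one_pos).trans (hR ⟨n, rfl⟩)
    simp only [fiber, profile, Real.one_rpow, one_mul, hD] at h1
    linarith
  have hA0 : ∀ n, 0 ≤ ∫ x, inner ℝ (Dw n x) (Dw n x) := fun n =>
    integral_nonneg fun x => real_inner_self_nonneg
  have hC0 : ∀ n, 0 ≤ ∫ x, w n x * w n x := fun n =>
    integral_nonneg fun x => mul_self_nonneg _
  have hB0 : ∀ n, 0 ≤ fracForm s (w n) (w n) := fun n => fracForm_self_nonneg _ _
  set B₀ : ℝ≥0 := (R + 1).toNNReal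
  have hRB : R + 1 ≤ B₀ := Real.le_coe_toNNReal _
  set B : ℝ≥0 := B₀ + 1
  have bw : ∀ n, eLpNorm (w n) 2 volume ≤ B := fun n => by
    refine eLpNorm_two_le_of_integral_inner_le (hw n).memLp ?_
    simp only [RCLike.inner_apply, conj_trivial]
    linarith [hsum n, hA0 n, hB0 n]
  have bDw : ∀ n, eLpNorm (Dw n) 2 volume ≤ B := fun n =>
    eLpNorm_two_le_of_integral_inner_le (hw n).memLp_grad
      (by linarith [hsum n, hC0 n, hB0 n])
  obtain ⟨v, Dv, k, hk, hv, hweak, hweakD⟩ := exists_weak_limit hw bw bDw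
  have hvrad : Radial v := Radial.of_weak_limit (fun n => hrad (k n)) hv.memLp hweak
  obtain ⟨S, hS⟩ := sobolev hN
  have hvS := hv.memL2Sob hN
  have hfin : ∀ {a : ℝ≥0∞}, a < ⊤ → ∃ b : ℝ≥0, (b : ℝ≥0∞) = a := fun h =>
    ⟨_, ENNReal.coe_toNNReal h.ne⟩
  obtain ⟨b₁, hb₁⟩ := hfin hv.memLp.2
  obtain ⟨b₂, hb₂⟩ := hfin hv.memLp_grad.2
  obtain ⟨b₃, hb₃⟩ := hfin hvS.2.2
  have hm : ∀ η : ℝ, 0 < η →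
      Tendsto (fun n => volume {x | η ≤ |w (k n) x - v x|}) atTop (𝓝 0) := fun η hη => by
    refine tendsto_measure_of_radial (by omega) (B := B + b₁ + b₂)
      (fun n => (hw (k n)).sub hv) (fun n => (hrad (k n)).sub hvrad) (fun n => ?_) (fun n => ?_)
      (fun φ hφ => ?_) hη
    · refine (eLpNorm_sub_le (hw (k n)).memLp.1 hv.memLp.1 one_le_two).trans ?_
      rw [← hb₁]
      refine (add_le_add_left (bw _) _).trans ?_
      norm_cast
      exact le_self_add
    · refine (eLpNorm_sub_le (hw (k n)).memLp_grad.1 hv.memLp_grad.1 one_le_two).trans ?_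
      rw [← hb₂]
      refine (add_le_add_left (bDw _) _).trans ?_
      push_cast
      gcongr
      exact le_self_add
    · have e : ∀ n, ∫ x, (w (k n) x - v x) * φ x =
          (∫ x, w (k n) x * φ x) - ∫ x, v x * φ x := fun n => by
        refine Eq.trans ?_ (integral_sub ((hw (k n)).memLp.integrable_mul hφ)
          (hv.memLp.integrable_mul hφ))
        congr 1; ext x
        exact sub_mul _ _ _
      have := (hweak φ hφ).sub_const (∫ x, v x * φ x)
      rw [sub_self] at this
      exact this.congr fun n => (e n).symm
  have hwS : ∀ n, MemL2Sob (w n) := fun n => (hw n).memL2Sob hN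
  -- One constant must bound the L² and Sobolev norms of both the sequence and the limit; its
  -- summands are these four bounds.
  have hcomp := tendsto_eLpNorm_comp hN hα hG.continuous hF0 h2 (fun n => hwS (k n)) hvS
    (B := B + S * B + b₁ + b₃) (fun n => (bw _).trans ?_)
    (fun n => ((hS _ _ (hw _)).trans (mul_le_mul_right (bDw _) _)).trans ?_) ?_ ?_ hm
  rotate_left
  · norm_cast
    rw [add_assoc, add_assoc]
    exact le_self_add
  · norm_cast
    rw [add_assoc, add_assoc, add_left_comm]
    exact le_self_add
  · rw [← hb₁]
    norm_cast
    rw [add_right_comm]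
    exact le_add_self
  · rw [← hb₃]
    norm_cast
    exact le_add_self
  have hDlim := tendsto_rieszForm hN1 hα hαN (fun n => hG.memLp hN hα hαN (hwS (k n)))
    (hG.memLp hN hα hαN hvS) hcomp
  simp only [hD] at hDlim
  have hDv := tendsto_nhds_unique hDlim tendsto_const_nhds
  refine ⟨v, Dv, hv, hvrad, hDv, fun τ hτ => ?_⟩
  have hfrac := tendsto_fracForm hN1 hs (fun n => hw (k n)) hv hv hweak hweakD
  set p : ℝ := ((N : ℝ) - 2) / (N + α)
  set q : ℝ := ((N : ℝ) - 2 * s) / (N + α)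
  set t : ℝ := (N : ℝ) / (N + α)
  -- For fixed τ, each quadratic term is replaced by its affine minorant at v. These minorants
  -- converge weakly to the fiber of v, while the fibers of w (k n) stay below r (k n).
  have hlow : Tendsto (fun n =>
      τ ^ p * (2 * (∫ x, inner ℝ (Dw (k n) x) (Dv x)) - ∫ x, inner ℝ (Dv x) (Dv x)) +
      τ ^ q * (2 * fracForm s (w (k n)) v - fracForm s v v) +
      τ ^ t * (2 * (∫ x, w (k n) x * v x) - ∫ x, v x * v x) - τ * 1) atTop
      (𝓝 (fiber s α F v Dv τ)) := by
    have := (((((hweakD _ hv.memLp_grad).const_mul 2).sub_const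
      (∫ x, inner ℝ (Dv x) (Dv x))).const_mul (τ ^ p)).add
      (((hfrac.const_mul 2).sub_const (fracForm s v v)).const_mul (τ ^ q))).add
      ((((hweak _ hv.memLp).const_mul 2).sub_const (∫ x, v x * v x)).const_mul (τ ^ t))
    convert this.sub_const (τ * 1) using 2
    rw [fiber, profile, hDv]
    ring
  refine le_of_tendsto_of_tendsto' hlow (hr.comp hk.tendsto_atTop) fun n => ?_
  refine le_trans ?_ (hle (k n) τ hτ)
  rw [fiber, profile, hD]
  have i1 := integral_inner_two_mul_sub_le (hw (k n)).memLp_grad hv.memLp_grad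
  have i2 := fracForm_two_mul_sub_le hN1 hs (hw (k n)) hv
  have i3 := integral_mul_two_mul_sub_le (hw (k n)).memLp hv.memLp
  gcongr

/-- The minimax level is attained, at a function whose fiber is maximal at `1`. -/
theorem exists_minimizer (hN : 3 ≤ N) {s α : ℝ} (hs : s ∈ Ioo (0 : ℝ) 1) (hα : 0 < α)
    (hαN : α < N) {F : ℝ → ℝ} {C : ℝ} (hG : GrowthBound N α F C) (hF0 : F 0 = 0)
    (h2 : CondF2 N α F) (h3 : CondF3 F) :
    ∃ (u : Space N → ℝ) (Du : Space N → Space N), IsH1With u Du ∧ Radial u ∧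
      (0 < rieszForm α (fun x => F (u x)) fun x => F (u x)) ∧
      (∀ τ, 0 < τ → fiber s α F u Du τ ≤ fiber s α F u Du 1) ∧
      ∀ (v : Space N → ℝ) (Dv : Space N → Space N), IsH1With v Dv → Radial v →
        (0 < rieszForm α (fun x => F (v x)) fun x => F (v x)) →
        ∀ R, (∀ τ, 0 < τ → fiber s α F v Dv τ ≤ R) → fiber s α F u Du 1 ≤ R := by
  -- All upper bounds of fibers are collected; the infimum is the same as that of the maxima, and no
  -- supremum has to be formed.
  set S : Set ℝ := {R | ∃ (v : Space N → ℝ) (Dv : Space N → Space N), IsH1With v Dv ∧ Radial v ∧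
    (0 < rieszForm α (fun x => F (v x)) fun x => F (v x)) ∧
    ∀ τ, 0 < τ → fiber s α F v Dv τ ≤ R}
  have hne : S.Nonempty := by
    obtain ⟨v, Dv, hv, hr, hpos⟩ :=
      exists_radial_rieszForm_pos (show 1 ≤ N by omega) hα hαN hG.continuous hF0 h3
    obtain ⟨σ, -, hmax⟩ := exists_max_fiber hN hs hα hF0 hv hpos
    exact ⟨_, v, Dv, hv, hr, hpos, hmax⟩
  -- Every fiber is at least −τd, which tends to 0 as τ → 0, so no upper bound of a fiber is
  -- negative.
  have hbdd : BddBelow S := by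
    refine ⟨0, ?_⟩
    rintro R ⟨v, Dv, hv, hr, hpos, hle⟩
    set d := rieszForm α (fun x => F (v x)) fun x => F (v x)
    have hlim : Tendsto (fun τ : ℝ => -(τ * d)) (𝓝[>] 0) (𝓝 0) := by
      have : Tendsto (fun τ : ℝ => -(τ * d)) (𝓝 0) (𝓝 (-(0 * d))) :=
        (Continuous.tendsto (by fun_prop) 0)
      rw [zero_mul, neg_zero] at this
      exact this.mono_left nhdsWithin_le_nhds
    refine le_of_tendsto hlim ?_
    filter_upwards [self_mem_nhdsWithin] with τ hτ
    have hτ : 0 < τ := hτ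
    refine le_trans ?_ (hle τ hτ)
    rw [fiber, profile]
    have i1 : 0 ≤ ∫ x, inner ℝ (Dv x) (Dv x) := integral_nonneg fun x => real_inner_self_nonneg
    have i2 := fracForm_self_nonneg s v
    have i3 : 0 ≤ ∫ x, v x * v x := integral_nonneg fun x => mul_self_nonneg _
    have : ∀ p b : ℝ, 0 ≤ b → 0 ≤ τ ^ p * b := fun p b hb => by positivity
    have j1 := this (((N : ℝ) - 2) / (N + α)) _ i1
    have j2 := this (((N : ℝ) - 2 * s) / (N + α)) _ i2
    have j3 := this ((N : ℝ) / (N + α)) _ i3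
    linarith
  obtain ⟨r, -, hrlim, hrS⟩ := exists_seq_tendsto_sInf hne hbdd
  choose u Du hu hrad hpos hle using hrS
  choose w Dw hw hwrad hwD hwle using fun n =>
    exists_rescale (s := s) hα F (hu n) (hrad n) (inv_pos.2 (hpos n))
  obtain ⟨v, Dv, hv, hvrad, hvD, hvle⟩ := exists_limit_of_fiber_le hN hs hα hαN hG hF0 h2 hw hwrad
    (fun n => by rw [hwD, inv_mul_cancel₀ (hpos n).ne'])
    (fun n τ hτ => by
      rw [hwle n τ hτ]
      exact hle n _ (mul_pos (inv_pos.2 (hpos n)) hτ)) hrlim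
  -- The weak limit v already realises the infimum, but its fiber may peak at some σ ≠ 1. A last
  -- dilation moves the peak to 1.
  obtain ⟨σ, hσ, hmax⟩ := exists_max_fiber (s := s) hN hs hα hF0 hv (by rw [hvD]; exact one_pos)
  obtain ⟨z, Dz, hz, hzrad, hzD, hzf⟩ := exists_rescale (s := s) hα F hv hvrad hσ
  have h1 : fiber s α F z Dz 1 = fiber s α F v Dv σ := by rw [hzf 1 one_pos, mul_one]
  refine ⟨z, Dz, hz, hzrad, by rw [hzD, hvD, mul_one]; exact hσ, fun τ hτ => ?_,
    fun y Dy hy hyrad hyD R hR => ?_⟩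
  · rw [h1, hzf τ hτ]
    exact hmax _ (mul_pos hσ hτ)
  · rw [h1]
    exact (hvle σ hσ).trans (csInf_le hbdd ⟨y, Dy, hy, hyrad, hyD, hR⟩)

end Choquard

end

/-! ### The Euler–Lagrange equation and symmetric criticality. -/

noncomputable section

namespace Choquard

open scoped ENNReal NNReal
open Set Metric

variable {N : ℕ}

theorem hasDerivAt_quadratic (a b c : ℝ) :
    HasDerivAt (fun ε : ℝ => a + 2 * ε * b + ε ^ 2 * c) (2 * b) 0 := by
  have h := (((hasDerivAt_id (0 : ℝ)).const_mul 2).mul_const b).const_add a |>.add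
    (((hasDerivAt_id (0 : ℝ)).pow 2).mul_const c)
  simpa [Pi.add_def] using h

theorem integral_mul_add_smul_self {u v : Space N → ℝ} (hu : MemLp u 2 volume)
    (hv : MemLp v 2 volume) (ε : ℝ) :
    ∫ x, (u x + ε * v x) * (u x + ε * v x) =
      (∫ x, u x * u x) + 2 * ε * (∫ x, u x * v x) + ε ^ 2 * ∫ x, v x * v x := by
  simpa only [RCLike.inner_apply, conj_trivial, smul_eq_mul, mul_comm] using
    integral_inner_add_smul_self hu hv ε

/-- The Euler-Lagrange equation in radial directions. -/
theorem radial_euler_lagrange [NeZero N] (hN : 3 ≤ N) {s α : ℝ} (hs : s ∈ Ioo (0 : ℝ) 1)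
    (hα : 0 < α) (hαN : α < N) {F : ℝ → ℝ} {C : ℝ} (hG : GrowthBound N α F C) (hF0 : F 0 = 0)
    {u : Space N → ℝ} {Du : Space N → Space N} (hu : IsH1With u Du) (hrad : Radial u)
    (hpos : 0 < rieszForm α (fun x => F (u x)) fun x => F (u x))
    (hmax : ∀ τ, 0 < τ → fiber s α F u Du τ ≤ fiber s α F u Du 1)
    (hmin : ∀ (v : Space N → ℝ) (Dv : Space N → Space N), IsH1With v Dv → Radial v →
      (0 < rieszForm α (fun x => F (v x)) fun x => F (v x)) →
      ∀ R, (∀ τ, 0 < τ → fiber s α F v Dv τ ≤ R) → fiber s α F u Du 1 ≤ R)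
    {v : Space N → ℝ} {Dv : Space N → Space N} (hv : IsH1With v Dv) (hvrad : Radial v) :
    (∫ x, inner ℝ (Du x) (Dv x)) + fracForm s u v + (∫ x, u x * v x) =
      rieszForm α (fun x => deriv F (u x) * v x) fun x => F (u x) := by
  obtain ⟨hp, hq, hr⟩ := exponents_mem hN hs hα
  have hN1 : 1 ≤ N := by omega
  set a : ℝ → ℝ := fun ε => ∫ x, inner ℝ (Du x + ε • Dv x) (Du x + ε • Dv x) with ha
  set b : ℝ → ℝ := fun ε => fracForm s (fun x => u x + ε * v x) fun x => u x + ε * v x with hb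
  set c : ℝ → ℝ := fun ε => ∫ x, (u x + ε * v x) * (u x + ε * v x) with hc
  set d : ℝ → ℝ := fun ε => rieszForm α (fun x => F (u x + ε * v x)) fun x => F (u x + ε * v x)
    with hd
  have a1 : HasDerivAt a (2 * ∫ x, inner ℝ (Du x) (Dv x)) 0 := by
    rw [ha]
    simp only [integral_inner_add_smul_self hu.memLp_grad hv.memLp_grad]
    exact hasDerivAt_quadratic _ _ _
  have b1 : HasDerivAt b (2 * fracForm s u v) 0 := by
    rw [hb]
    simp only [fracForm_add_smul_self hN1 hs hu hv]
    exact hasDerivAt_quadratic _ _ _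
  have c1 : HasDerivAt c (2 * ∫ x, u x * v x) 0 := by
    rw [hc]
    simp only [integral_mul_add_smul_self hu.memLp hv.memLp]
    exact hasDerivAt_quadratic _ _ _
  have d1 : HasDerivAt d _ 0 :=
    hG.hasDerivAt_rieszForm hN hα hαN (hu.memL2Sob hN) (hv.memL2Sob hN)
  have a0 : a 0 = ∫ x, inner ℝ (Du x) (Du x) := by simp [ha]
  have b0 : b 0 = fracForm s u u := by simp [hb]
  have c0 : c 0 = ∫ x, u x * u x := by simp [hc]
  have d0 : d 0 = rieszForm α (fun x => F (u x)) fun x => F (u x) := by simp [hd]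
  have hcpos : 0 < c 0 := by
    rw [c0]
    refine integral_mul_self_pos hu.memLp fun h => ?_
    rw [rieszForm_comp_eq_zero hF0 h] at hpos
    exact lt_irrefl _ hpos
  have hfib : fiber s α F u Du = profile (((N : ℝ) - 2) / (N + α)) (((N : ℝ) - 2 * s) / (N + α))
      ((N : ℝ) / (N + α)) (a 0) (b 0) (c 0) (d 0) := by rw [a0, b0, c0, d0, fiber]
  have key := deriv_profile_eq_zero hp hq hr a1 b1 c1 d1
    (fun ε => integral_nonneg fun x => real_inner_self_nonneg)
    (fun ε => fracForm_self_nonneg _ _) (fun ε => integral_nonneg fun x => mul_self_nonneg _)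
    hcpos (by simpa only [hfib] using hmax) (by
      rw [← hfib]
      -- By continuity u + εv stays an admissible competitor for small ε.
      have : ∀ᶠ ε in 𝓝 (0 : ℝ), 0 < d ε :=
        d1.continuousAt.eventually (lt_mem_nhds (by rw [d0]; exact hpos))
      filter_upwards [this] with ε hε R hR
      exact hmin _ _ (hu.add (hv.const_smul ε)) (hrad.add (hvrad.const_mul ε)) hε R hR)
  linarith

theorem rieszForm_add_left (hN : 1 ≤ N) {α : ℝ} (hα : 0 < α) (hαN : α < N)
    {f f' g : Space N → ℝ} (hf : MemLp f (hlsExp N α) volume)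
    (hf' : MemLp f' (hlsExp N α) volume) (hg : MemLp g (hlsExp N α) volume) :
    rieszForm α (fun x => f x + f' x) g = rieszForm α f g + rieszForm α f' g := by
  obtain ⟨C, -, hls⟩ := hls hN hα hαN
  refine Eq.trans ?_ (integral_add (hls f g hf hg).1 (hls f' g hf' hg).1)
  rw [rieszForm]
  congr 1; ext q
  ring

theorem rieszForm_smul_left (α c : ℝ) (f g : Space N → ℝ) :
    rieszForm α (fun x => c * f x) g = c * rieszForm α f g := by
  rw [rieszForm, rieszForm, ← integral_const_mul]
  congr 1; ext q
  ring

theorem GrowthBound.exists_abs_rieszForm_deriv_le (hN : 3 ≤ N) {α : ℝ} (hα : 0 < α) (hαN : α < N)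
    {F : ℝ → ℝ} {C : ℝ} (hG : GrowthBound N α F C) {u : Space N → ℝ} {Du : Space N → Space N}
    (hu : IsH1With u Du) : ∃ K : ℝ, ∀ (v : Space N → ℝ) (Dv : Space N → Space N),
      IsH1With v Dv → eLpNorm v 2 volume ≤ 1 → eLpNorm Dv 2 volume ≤ 1 →
      |rieszForm α (fun x => deriv F (u x) * v x) fun x => F (u x)| ≤ K := by
  have hN' : (3 : ℝ) ≤ N := by exact_mod_cast hN
  have hN2 : (0 : ℝ) < N - 2 := by linarith
  obtain ⟨C', -, hls⟩ := hls (show 1 ≤ N by omega) hα hαN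
  obtain ⟨S, hS⟩ := sobolev hN
  have hu2 := hu.memL2Sob hN
  have hp1 : 1 ≤ sobExp N := by
    rw [sobExp, ENNReal.one_le_ofReal, one_le_div hN2]
    linarith
  -- Bounds the growth function at |u| + |v| when v and its gradient lie in the unit ball of L²; S
  -- is the Sobolev constant.
  set Kg : ℝ≥0∞ := ENNReal.ofReal C * ((eLpNorm u 2 volume + 1) ^ (((N : ℝ) + α) / N) +
    (eLpNorm u (sobExp N) volume + S) ^ (((N : ℝ) + α) / (N - 2)))
  have hKg : Kg ≠ ⊤ := by
    refine (ENNReal.mul_lt_top ENNReal.ofReal_lt_top (ENNReal.add_lt_top.2 ⟨?_, ?_⟩)).ne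
    · exact ENNReal.rpow_lt_top_of_nonneg (by positivity)
        (ENNReal.add_lt_top.2 ⟨hu2.1.2, ENNReal.one_lt_top⟩).ne
    · exact ENNReal.rpow_lt_top_of_nonneg (by positivity)
        (ENNReal.add_lt_top.2 ⟨hu2.2.2, ENNReal.coe_lt_top⟩).ne
  have hFu := hG.memLp hN hα hαN hu2
  refine ⟨C' * (Kg.toReal + 1) *
    ((eLpNorm (fun x => F (u x)) (hlsExp N α) volume).toReal + 1), fun v Dv hv h1 h2 => ?_⟩
  have hv2 := hv.memL2Sob hN
  refine (hls _ _ (hG.memLp_deriv hN hα hαN hu2 hv2) hFu).2 _ _ (by positivity) (by positivity)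
    ?_ ?_
  · refine (eLpNorm_le_of_growth hN hα hαN (hu2.abs.add hv2.abs).1.1
      fun x => hG.deriv_bound_add x).trans (le_trans ?_ (show Kg ≤ _ from ?_))
    · refine mul_le_mul_right (add_le_add ?_ ?_) _ <;>
        refine ENNReal.rpow_le_rpow ?_ (by positivity)
      · refine (eLpNorm_add_le hu2.abs.1.1 hv2.abs.1.1 one_le_two).trans (add_le_add ?_ ?_)
        · exact (eLpNorm_norm u).le
        · exact (eLpNorm_norm v).trans_le h1
      · refine (eLpNorm_add_le hu2.abs.1.1 hv2.abs.1.1 hp1).trans (add_le_add ?_ ?_)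
        · exact (eLpNorm_norm u).le
        · refine (eLpNorm_norm v).trans_le ((hS v Dv hv).trans ?_)
          exact (mul_le_mul_right h2 _).trans_eq (mul_one _)
    · rw [← ENNReal.ofReal_toReal hKg]
      exact ENNReal.ofReal_le_ofReal (by simp)
  · conv_lhs => rw [← ENNReal.ofReal_toReal hFu.2.ne]
    exact ENNReal.ofReal_le_ofReal (by simp)

/-- A function representing a rotation invariant functional on `H¹` is radial. -/
theorem radial_of_invariant {w : Space N → ℝ} {Dw : Space N → Space N} (hw : IsH1With w Dw)
    (h : ∀ (g : Space N ≃ₗᵢ[ℝ] Space N) (v : Space N → ℝ) (Dv : Space N → Space N),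
      IsH1With v Dv → (∫ x, inner ℝ (Dw x) (rotGrad g Dv x)) + (∫ x, w x * v (g x)) =
        (∫ x, inner ℝ (Dw x) (Dv x)) + ∫ x, w x * v x) : Radial w := by
  intro g
  have hg := hw.comp_isometry g
  have hd := hg.sub hw
  -- Take v = w ∘ g − w and the inverse isometry. After a change of variables, w ∘ g and w have the
  -- same H¹ inner product with v, so v has norm zero.
  have e := h g.symm _ _ hd
  have e1 : ∫ x, inner ℝ (Dw x) (rotGrad g.symm (fun x => rotGrad g Dw x - Dw x) x) =
      ∫ x, inner ℝ (rotGrad g Dw x) (rotGrad g Dw x - Dw x) := by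
    rw [← integral_comp_isometry g]
    congr 1; ext x
    simp only [rotGrad, LinearIsometryEquiv.symm_symm, LinearIsometryEquiv.symm_apply_apply]
    rw [← LinearIsometryEquiv.inner_map_map g (g.symm (Dw (g x))),
      LinearIsometryEquiv.apply_symm_apply]
  have e2 : ∫ x, w x * (w (g (g.symm x)) - w (g.symm x)) =
      ∫ x, w (g x) * (w (g x) - w x) := by
    rw [← integral_comp_isometry g]
    simp
  rw [e1, e2] at e
  have i1 := integrable_inner_of_memLp hg.memLp_grad hd.memLp_grad
  have i2 := integrable_inner_of_memLp hw.memLp_grad hd.memLp_grad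
  have j1 : Integrable fun x => w (g x) * (w (g x) - w x) := hg.memLp.integrable_mul hd.memLp
  have j2 : Integrable fun x => w x * (w (g x) - w x) := hw.memLp.integrable_mul hd.memLp
  have s1 : ∫ x, inner ℝ (rotGrad g Dw x - Dw x) (rotGrad g Dw x - Dw x) =
      (∫ x, inner ℝ (rotGrad g Dw x) (rotGrad g Dw x - Dw x)) -
        ∫ x, inner ℝ (Dw x) (rotGrad g Dw x - Dw x) := by
    rw [← integral_sub i1 i2]
    congr 1; ext x
    rw [inner_sub_left]
  have s2 : ∫ x, (w (g x) - w x) * (w (g x) - w x) =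
      (∫ x, w (g x) * (w (g x) - w x)) - ∫ x, w x * (w (g x) - w x) := by
    rw [← integral_sub j1 j2]
    congr 1; ext x
    ring
  have p1 : 0 ≤ ∫ x, inner ℝ (rotGrad g Dw x - Dw x) (rotGrad g Dw x - Dw x) :=
    integral_nonneg fun x => real_inner_self_nonneg
  by_contra hne
  have p2 := integral_mul_self_pos hd.memLp fun h0 => hne (by
    filter_upwards [h0] with x hx
    exact sub_eq_zero.1 hx)
  linarith

/-- Symmetric criticality. -/
theorem euler_lagrange [NeZero N] (hN : 3 ≤ N) {s α : ℝ} (hs : s ∈ Ioo (0 : ℝ) 1)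
    (hα : 0 < α) (hαN : α < N) {F : ℝ → ℝ} {C : ℝ} (hG : GrowthBound N α F C)
    {u : Space N → ℝ} {Du : Space N → Space N} (hu : IsH1With u Du) (hrad : Radial u)
    (hEL : ∀ (v : Space N → ℝ) (Dv : Space N → Space N), IsH1With v Dv → Radial v →
      (∫ x, inner ℝ (Du x) (Dv x)) + fracForm s u v + (∫ x, u x * v x) =
        rieszForm α (fun x => deriv F (u x) * v x) fun x => F (u x))
    {v : Space N → ℝ} {Dv : Space N → Space N} (hv : IsH1With v Dv) :
    (∫ x, inner ℝ (Du x) (Dv x)) + fracForm s u v + (∫ x, u x * v x) =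
      rieszForm α (fun x => deriv F (u x) * v x) fun x => F (u x) := by
  have hN1 : 1 ≤ N := by omega
  have hu2 := hu.memL2Sob hN
  have hFu := hG.memLp hN hα hαN hu2
  -- The part of the equation other than the H¹ inner product with u. If w represents it, the
  -- equation says u + w = 0.
  set ℓ : (Space N → ℝ) → (Space N → Space N) → ℝ := fun v _ =>
    fracForm s u v - rieszForm α (fun x => deriv F (u x) * v x) fun x => F (u x) with hℓ
  obtain ⟨K₁, hK₁⟩ := exists_abs_fracForm_le hN1 hs hu
  obtain ⟨K₂, hK₂⟩ := hG.exists_abs_rieszForm_deriv_le hN hα hαN hu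
  obtain ⟨w, Dw, hw, hrep⟩ := exists_riesz_representer ℓ (K := K₁ + K₂) (by
      intro v v' _ _ _ hvv _
      simp only [hℓ]
      rw [fracForm_congr s EventuallyEq.rfl hvv]
      congr 1
      refine rieszForm_congr α ?_ EventuallyEq.rfl
      filter_upwards [hvv] with x hx
      rw [hx]) (by
      intro v v' Dv Dv' h h'
      simp only [hℓ, mul_add]
      rw [fracForm_add_right hN1 hs hu h h', rieszForm_add_left hN1 hα hαN
        (hG.memLp_deriv hN hα hαN hu2 (h.memL2Sob hN))
        (hG.memLp_deriv hN hα hαN hu2 (h'.memL2Sob hN)) hFu]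
      ring) (by
      intro c v Dv h
      simp only [hℓ, mul_left_comm _ c]
      rw [fracForm_smul_right, rieszForm_smul_left]
      ring) (by
      intro v Dv h h1 h2
      exact (abs_sub _ _).trans (add_le_add (hK₁ v Dv h h1 h2) (hK₂ v Dv h h1 h2)))
  -- Rotating v amounts to rotating u back, and u is radial, so the functional is rotation
  -- invariant.
  have hwrad : Radial w := radial_of_invariant hw fun g v Dv hv => by
    rw [← hrep _ _ (hv.comp_isometry g), ← hrep _ _ hv]
    simp only [hℓ]
    have e1 : fracForm s u (fun x => v (g x)) = fracForm s u v := by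
      rw [← fracForm_comp_isometry s g u v]
      exact fracForm_congr s (hrad g).symm EventuallyEq.rfl
    have e2 : (rieszForm α (fun x => deriv F (u x) * v (g x)) fun x => F (u x)) =
        rieszForm α (fun x => deriv F (u x) * v x) fun x => F (u x) := by
      rw [← rieszForm_comp_isometry α g (fun x => deriv F (u x) * v x)]
      refine rieszForm_congr α ?_ ?_ <;> filter_upwards [hrad g] with x hx <;> rw [hx]
    rw [e1, e2]
  have hz := hu.add hw
  have key : ∀ (v : Space N → ℝ) (Dv : Space N → Space N), IsH1With v Dv →
      (∫ x, inner ℝ (Du x) (Dv x)) + fracForm s u v + (∫ x, u x * v x) -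
        (rieszForm α (fun x => deriv F (u x) * v x) fun x => F (u x)) =
      (∫ x, inner ℝ (Du x + Dw x) (Dv x)) + ∫ x, (u x + w x) * v x := by
    intro v Dv hv
    have h1 := hrep v Dv hv
    have e1 : ∫ x, inner ℝ (Du x + Dw x) (Dv x) =
        (∫ x, inner ℝ (Du x) (Dv x)) + ∫ x, inner ℝ (Dw x) (Dv x) := by
      rw [← integral_add (integrable_inner_of_memLp hu.memLp_grad hv.memLp_grad)
        (integrable_inner_of_memLp hw.memLp_grad hv.memLp_grad)]
      simp only [inner_add_left]
    have e2 : ∫ x, (u x + w x) * v x = (∫ x, u x * v x) + ∫ x, w x * v x := by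
      refine Eq.trans ?_ (integral_add (hu.memLp.integrable_mul hv.memLp)
        (hw.memLp.integrable_mul hv.memLp))
      simp only [add_mul]
    rw [e1, e2]
    simp only [hℓ] at h1
    linarith
  -- The residual u + w is radial, hence an admissible test function for the radial equation.
  -- Testing with it shows that its own H¹ norm vanishes.
  have h0 := key _ _ hz
  rw [hEL _ _ hz (hrad.add hwrad), sub_self] at h0
  have p1 : 0 ≤ ∫ x, inner ℝ (Du x + Dw x) (Du x + Dw x) :=
    integral_nonneg fun x => real_inner_self_nonneg
  have p2 : 0 ≤ ∫ x, (u x + w x) * (u x + w x) := integral_nonneg fun x => mul_self_nonneg _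
  have z1 : (fun x => u x + w x) =ᵐ[volume] 0 := by
    by_contra hne
    linarith [integral_mul_self_pos hz.memLp hne]
  have z2 : (fun x => Du x + Dw x) =ᵐ[volume] 0 := by
    have : ∫ x, inner ℝ (Du x + Dw x) (Du x + Dw x) = 0 := by linarith
    have := (integral_eq_zero_iff_of_nonneg (fun x => real_inner_self_nonneg)
      (integrable_inner_of_memLp hz.memLp_grad hz.memLp_grad)).1 this
    filter_upwards [this] with x hx
    exact inner_self_eq_zero.1 hx
  rw [← sub_eq_zero, key v Dv hv]
  have y1 : ∫ x, inner ℝ (Du x + Dw x) (Dv x) = 0 := by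
    refine integral_eq_zero_of_ae ?_
    filter_upwards [z2] with x hx
    simp only [Pi.zero_apply] at hx ⊢
    rw [hx, inner_zero_left]
  have y2 : ∫ x, (u x + w x) * v x = 0 := by
    refine integral_eq_zero_of_ae ?_
    filter_upwards [z1] with x hx
    simp only [Pi.zero_apply] at hx ⊢
    rw [hx, zero_mul]
  rw [y1, y2, add_zero]

end Choquard

end

/-! ### Conclusion. -/

theorem theorem1 (N : ℕ) [NeZero N] (hN : 3 ≤ N) (s : ℝ) (hs : s ∈ Set.Ioo (0 : ℝ) 1)
    (α : ℝ) (hα : α ∈ Set.Ioo (0 : ℝ) (N : ℝ))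
    (F : ℝ → ℝ) (hF : ContDiff ℝ 1 F)
    (hf1 : Choquard.CondF1 N α F) (hf2 : Choquard.CondF2 N α F) (hf3 : Choquard.CondF3 F) :
    ∃ u : Choquard.Space N → ℝ,
      Choquard.MemH1 u ∧ ¬ (u =ᵐ[volume] 0) ∧ Choquard.IsWeakSolution s α F u := by
  have hN1 : 1 ≤ N := by omega
  obtain ⟨C, hG⟩ := Choquard.exists_growthBound hN hα.1 hF hf1 hf2
  have hF0 := hf2.map_zero hN hα.1 hF.continuous
  obtain ⟨u, Du, hu, hrad, hpos, hmax, hmin⟩ :=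
    Choquard.exists_minimizer hN hs hα.1 hα.2 hG hF0 hf2 hf3
  have hu2 := hu.memL2Sob hN
  have hFu := hG.memLp hN hα.1 hα.2 hu2
  refine ⟨u, ⟨Du, hu⟩, fun h => ?_, Du, hu,
    Choquard.ae_integrable_rieszConv hN1 hα.1 hα.2 hFu, fun v Dv hv => ?_⟩
  -- Nontriviality: the nonlocal energy of u is positive, whereas F(0) = 0 makes it vanish at u = 0.
  · rw [Choquard.rieszForm_comp_eq_zero hF0 h] at hpos
    exact lt_irrefl _ hpos
  · have hfv := hG.memLp_deriv hN hα.1 hα.2 hu2 (hv.memL2Sob hN)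
    have hi := Choquard.integrable_mul_rieszConv hN1 hα.1 hα.2 hfv hFu
    have e : ∀ x, Choquard.rieszConv α (fun y => F (u y)) x * deriv F (u x) * v x =
        deriv F (u x) * v x * Choquard.rieszConv α (fun y => F (u y)) x := fun x => by ring
    simp only [e]
    refine ⟨hu.integrable_gagliardoIntegrand hN1 hs hv, hi.1, ?_⟩
    rw [hi.2]
    exact Choquard.euler_lagrange hN hs hα.1 hα.2 hG hu hrad (fun v Dv hv hvrad =>
      Choquard.radial_euler_lagrange hN hs hα.1 hα.2 hG hF0 hu hrad hpos hmax hmin hv hvrad) hv
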